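/- Let $k$ be a field, $H$ a Hopf algebra over $k$ with bijective antipode $S$, and let ${}^H_H\mathcal{YD}$ be the braided category of left Yetter–Drinfeld modules over $H$, i.e. left $H$-modules and left $H$-comodules $M$ with $\delta(h\cdot m)=h_{(1)}m_{(-1)}S(h_{(3)})\otimes h_{(2)}\cdot m_{(0)}$, with diagonal tensor products and braiding $c(m\otimes n)=m_{(-1)}\cdot n\otimes m_{(0)}$. For $V$ in ${}^H_H\mathcal{YD}$ let $T(V)$ be the tensor algebra, regarded as a Hopf algebra in ${}^H_H\mathcal{YD}$ with the elements of $V$ primitive, and let $\mathfrak S^n=\sum_{x\in S_n}s(x)$ on $V^{\otimes n}$ be the quantum symmetrizer, where $s(x)=\sigma_{i_1}\cdots\sigma_{i_r}$ for a reduced word $x=\tau_{i_1}\cdots\tau_{i_r}$ in the transpositions $\tau_i=(i,i+1)$, and $\sigma_i$ is $c_{V,V}$ acting on the factors $i,i+1$. The Nichols algebra of $V$ is the quotient Hopf algebra $\mathfrak B(V)=T(V)/\bigoplus_{n\ge 0}\ker\mathfrak S^n$. For a finite-dimensional $M$ in ${}^H_H\mathcal{YD}$ the left dual ${}^*M$ is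 the linear dual of $M$ with $(h\cdot f)(m)=f(S^{-1}(h)\cdot m)$ and $f_{(-1)}f_{(0)}(m)=S(m_{(-1)})f(m_{(0)})$. If $R$ is a finite-dimensional Hopf algebra in ${}^H_H\mathcal{YD}$, then ${}^*R$ is a Hopf algebra in ${}^H_H\mathcal{YD}$ with multiplication ${}^*\Delta_R\circ\sigma$ and comultiplication $\sigma^{-1}\circ{}^*m_R$, where $\sigma=\phi\circ c^{-1}:{}^*R\otimes{}^*R\to{}^*(R\otimes R)$ and $\phi(f\otimes g)(r\otimes s)=g(r)f(s)$, and with unit, counit and antipode the transposes of the counit, unit and antipode of $R$. For a Hopf algebra $R$ in ${}^H_H\mathcal{YD}$, $R^{\mathrm{bop}}$ is $R$ with multiplication $m_R\circ c_{R,R}$ and comultiplication $c_{R,R}^{-1}\circ\Delta_R$, and unchanged unit, counit and antipode. **Proposition.** Let $V$ be a finite-dimensional Yetter–Drinfeld module over $H$ such that $\mathfrak B(V)$ is finite dimensional. Then $\bigoplus_n\ker\mathfrak S^n$ is a Hopf ideal of $T(V)$ and of $T({}^*V)$, so that $\mathfrak B(V)$ and $\mathfrak B({}^*V)$ are well defined;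 $\mathfrak B(V)$, $\mathfrak B({}^*V)$ and $({}^*\mathfrak B(V))^{\mathrm{bop}}$ are Hopf algebras in ${}^H_H\mathcal{YD}$; and $$\mathfrak B({}^*V)\simeq({}^*\mathfrak B(V))^{\mathrm{bop}}$$ as Hopf algebras in ${}^H_H\mathcal{YD}$. -/

import Mathlib

open scoped TensorProduct

noncomputable section

namespace BraidedHopf

universe u v w w₁ w₂

section YetterDrinfeld

variable (k : Type u) (H : Type v) [Field k] [Ring H] [HopfAlgebra k H]

/-- An action and a coaction of `H` on a vector space `M` (no axioms yet). -/
structure YDData (M : Type w) [AddCommGroup M] [Module k M] where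
  /-- the action `h ⊗ m ↦ h · m` -/
  act : H →ₗ[k] M →ₗ[k] M
  /-- the coaction `m ↦ m₍₋₁₎ ⊗ m₍₀₎` -/
  coact : M →ₗ[k] H ⊗[k] M

/-- The antipode of `H` is bijective. -/
class BijectiveAntipode : Prop where
  bijective : Function.Bijective (HopfAlgebra.antipode k : H →ₗ[k] H)

/-- The inverse of the antipode of `H`. -/
def antipodeInv [h : BijectiveAntipode k H] : H →ₗ[k] H :=
  ((LinearEquiv.ofBijective (HopfAlgebra.antipode k : H →ₗ[k] H) h.bijective).symm :
    H →ₗ[k] H)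

variable {k H}

namespace YDData

variable {M : Type w} [AddCommGroup M] [Module k M]
variable {N : Type w₁} [AddCommGroup N] [Module k N]

/-- `(a ⊗ b ⊗ c) ⊗ (g ⊗ m) ↦ a g S(c) ⊗ b · m`. -/
def sandwich (s : YDData k H M) : (H ⊗[k] (H ⊗[k] H)) ⊗[k] (H ⊗[k] M) →ₗ[k] H ⊗[k] M :=
  TensorProduct.map
      (LinearMap.mul' k H ∘ₗ
        TensorProduct.map LinearMap.id (LinearMap.mul' k H ∘ₗ
          (TensorProduct.comm k H H).toLinearMap ∘ₗ
            TensorProduct.map (HopfAlgebra.antipode k) LinearMap.id) ∘ₗ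
        (TensorProduct.assoc k H H H).toLinearMap)
      (TensorProduct.lift s.act) ∘ₗ
    (TensorProduct.tensorTensorTensorComm k (H ⊗[k] H) H H M).toLinearMap ∘ₗ
    TensorProduct.map
      ((TensorProduct.assoc k H H H).symm.toLinearMap ∘ₗ
        TensorProduct.map LinearMap.id (TensorProduct.comm k H H).toLinearMap) LinearMap.id

theorem sandwich_tmul (s : YDData k H M) (a b c g : H) (m : M) :
    s.sandwich ((a ⊗ₜ (b ⊗ₜ c)) ⊗ₜ (g ⊗ₜ m)) =
      (a * (g * HopfAlgebra.antipode k c)) ⊗ₜ[k] s.act b m := rfl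

/-- Left Yetter-Drinfeld modules over `H`: a left module and a left comodule such that
`δ(h · m) = h₍₁₎ m₍₋₁₎ S(h₍₃₎) ⊗ h₍₂₎ · m₍₀₎`. -/
structure IsYetterDrinfeld (s : YDData k H M) : Prop where
  one_act : ∀ m, s.act 1 m = m
  mul_act : ∀ g h m, s.act (g * h) m = s.act g (s.act h m)
  coassoc :
    (TensorProduct.assoc k H H M).toLinearMap ∘ₗ
        TensorProduct.map Coalgebra.comul LinearMap.id ∘ₗ s.coact =
      TensorProduct.map LinearMap.id s.coact ∘ₗ s.coact
  counit_coact :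
    (TensorProduct.lid k M).toLinearMap ∘ₗ
      TensorProduct.map Coalgebra.counit LinearMap.id ∘ₗ s.coact = LinearMap.id
  coact_act : ∀ h m,
    s.coact (s.act h m) =
      s.sandwich ((TensorProduct.map LinearMap.id Coalgebra.comul (Coalgebra.comul (R := k) h))
        ⊗ₜ s.coact m)

/-- Morphisms: `H`-linear and `H`-colinear maps. -/
structure IsHom (s : YDData k H M) (t : YDData k H N) (f : M →ₗ[k] N) : Prop where
  map_act : ∀ h m, f (s.act h m) = t.act h (f m)
  coact_map : t.coact ∘ₗ f = TensorProduct.map LinearMap.id f ∘ₗ s.coact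

/-- The unit object: `h · 1 = ε(h)` and `δ(1) = 1 ⊗ 1`. -/
def unitObj : YDData k H k where
  act := LinearMap.mul k k ∘ₗ (Coalgebra.counit : H →ₗ[k] k)
  coact := TensorProduct.mk k H k 1

/-- The tensor product, with the diagonal action and the codiagonal coaction. -/
def tensor (s : YDData k H M) (t : YDData k H N) : YDData k H (M ⊗[k] N) where
  act := TensorProduct.homTensorHomMap (RingHom.id k) M N M N ∘ₗ
    TensorProduct.map s.act t.act ∘ₗ Coalgebra.comul
  coact := TensorProduct.map (LinearMap.mul' k H) LinearMap.id ∘ₗ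
    (TensorProduct.tensorTensorTensorComm k H M H N).toLinearMap ∘ₗ
    TensorProduct.map s.coact t.coact

/-- The braiding `c : M ⊗ N → N ⊗ M`, `m ⊗ n ↦ m₍₋₁₎ · n ⊗ m₍₀₎`. -/
def braiding (s : YDData k H M) (t : YDData k H N) : M ⊗[k] N →ₗ[k] N ⊗[k] M :=
  TensorProduct.map (TensorProduct.lift t.act) LinearMap.id ∘ₗ
    (TensorProduct.rightComm k H M N).toLinearMap ∘ₗ
    TensorProduct.map s.coact LinearMap.id

/-- The inverse braiding `c⁻¹ : M ⊗ N → N ⊗ M`, `m ⊗ n ↦ n₍₀₎ ⊗ S⁻¹(n₍₋₁₎) · m`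
(the inverse of the braiding `N ⊗ M → M ⊗ N`). -/
def braidingInv [BijectiveAntipode k H] (s : YDData k H M) (t : YDData k H N) :
    M ⊗[k] N →ₗ[k] N ⊗[k] M :=
  (TensorProduct.comm k M N).toLinearMap ∘ₗ
    TensorProduct.map (TensorProduct.lift (s.act ∘ₗ antipodeInv k H)) LinearMap.id ∘ₗ
    (TensorProduct.rightComm k H N M).toLinearMap ∘ₗ
    TensorProduct.map t.coact LinearMap.id ∘ₗ
    (TensorProduct.comm k M N).toLinearMap

/-- The left dual of a finite-dimensional Yetter-Drinfeld module: the linear dual with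
`(h · f)(m) = f(S⁻¹(h) · m)` and `δ(f) = ∑ᵢ S((bᵢ)₍₋₁₎) ⊗ f((bᵢ)₍₀₎) bⁱ`, where `(bᵢ)`, `(bⁱ)` are
dual bases. -/
def leftDual [BijectiveAntipode k H] [Module.Finite k M] (s : YDData k H M) :
    YDData k H (Module.Dual k M) where
  act :=
    { toFun := fun h => (s.act (antipodeInv k H h)).dualMap
      map_add' := fun g h => by ext; simp
      map_smul' := fun a h => by ext; simp }
  coact :=
    { toFun := fun f => ∑ i, TensorProduct.map (HopfAlgebra.antipode k)
        (LinearMap.smulRight f ((Module.finBasis k M).coord i)) (s.coact (Module.finBasis k M i))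
      map_add' := fun f g => by
        rw [← Finset.sum_add_distrib]
        refine Finset.sum_congr rfl fun i _ => ?_
        rw [← LinearMap.add_apply, ← TensorProduct.map_add_right]
        congr 2
        ext m n
        simp [add_mul]
      map_smul' := fun a f => by
        rw [RingHom.id_apply, Finset.smul_sum]
        refine Finset.sum_congr rfl fun i _ => ?_
        rw [← LinearMap.smul_apply, ← TensorProduct.map_smul_right]
        congr 2
        ext m n
        simp [mul_assoc] }

end YDData

/-! ### Hopf algebras in the category of Yetter-Drinfeld modules -/

variable (k H) in
/-- The structure maps of a Hopf algebra in the category of Yetter-Drinfeld modules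
(no axioms yet). -/
structure HopfData (R : Type w) [AddCommGroup R] [Module k R] extends YDData k H R where
  mul : R ⊗[k] R →ₗ[k] R
  unit : k →ₗ[k] R
  comul : R →ₗ[k] R ⊗[k] R
  counit : R →ₗ[k] k
  antipode : R →ₗ[k] R

/-- `id ⊗ c ⊗ id : (A ⊗ B) ⊗ (C ⊗ D) → (A ⊗ C) ⊗ (B ⊗ D)` for `c : B ⊗ C → C ⊗ B`; all four
factors are the same space. -/
def middle {R : Type w} [AddCommGroup R] [Module k R] (c : R ⊗[k] R →ₗ[k] R ⊗[k] R) :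
    (R ⊗[k] R) ⊗[k] (R ⊗[k] R) →ₗ[k] (R ⊗[k] R) ⊗[k] (R ⊗[k] R) :=
  (TensorProduct.assoc k R R (R ⊗[k] R)).symm.toLinearMap ∘ₗ
    TensorProduct.map LinearMap.id
      ((TensorProduct.assoc k R R R).toLinearMap ∘ₗ
        TensorProduct.map c LinearMap.id ∘ₗ
        (TensorProduct.assoc k R R R).symm.toLinearMap) ∘ₗ
    (TensorProduct.assoc k R R (R ⊗[k] R)).toLinearMap

namespace HopfData

variable {R : Type w} [AddCommGroup R] [Module k R]
variable {R' : Type w₁} [AddCommGroup R'] [Module k R']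

/-- Hopf algebras in the category of (not necessarily finite-dimensional) Yetter-Drinfeld
modules. -/
structure IsHopfAlgebra (A : HopfData k H R) : Prop where
  isYetterDrinfeld : A.toYDData.IsYetterDrinfeld
  mul_hom : (A.toYDData.tensor A.toYDData).IsHom A.toYDData A.mul
  unit_hom : YDData.unitObj.IsHom A.toYDData A.unit
  comul_hom : A.toYDData.IsHom (A.toYDData.tensor A.toYDData) A.comul
  counit_hom : A.toYDData.IsHom YDData.unitObj A.counit
  antipode_hom : A.toYDData.IsHom A.toYDData A.antipode
  mul_assoc :
    A.mul ∘ₗ TensorProduct.map A.mul LinearMap.id =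
      A.mul ∘ₗ TensorProduct.map LinearMap.id A.mul ∘ₗ (TensorProduct.assoc k R R R).toLinearMap
  unit_mul : ∀ x, A.mul (A.unit 1 ⊗ₜ x) = x
  mul_unit : ∀ x, A.mul (x ⊗ₜ A.unit 1) = x
  coassoc :
    (TensorProduct.assoc k R R R).toLinearMap ∘ₗ TensorProduct.map A.comul LinearMap.id ∘ₗ
      A.comul = TensorProduct.map LinearMap.id A.comul ∘ₗ A.comul
  counit_comul :
    (TensorProduct.lid k R).toLinearMap ∘ₗ TensorProduct.map A.counit LinearMap.id ∘ₗ A.comul =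
      LinearMap.id
  comul_counit :
    (TensorProduct.rid k R).toLinearMap ∘ₗ TensorProduct.map LinearMap.id A.counit ∘ₗ A.comul =
      LinearMap.id
  counit_unit : A.counit (A.unit 1) = 1
  counit_mul : ∀ x y, A.counit (A.mul (x ⊗ₜ y)) = A.counit x * A.counit y
  comul_unit : A.comul (A.unit 1) = A.unit 1 ⊗ₜ A.unit 1
  comul_mul :
    A.comul ∘ₗ A.mul =
      TensorProduct.map A.mul A.mul ∘ₗ middle (A.toYDData.braiding A.toYDData) ∘ₗ
        TensorProduct.map A.comul A.comul
  antipode_left :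
    A.mul ∘ₗ TensorProduct.map A.antipode LinearMap.id ∘ₗ A.comul = A.unit ∘ₗ A.counit
  antipode_right :
    A.mul ∘ₗ TensorProduct.map LinearMap.id A.antipode ∘ₗ A.comul = A.unit ∘ₗ A.counit

/-- Morphisms of Hopf algebras in the category of Yetter-Drinfeld modules. -/
structure IsHom (A : HopfData k H R) (B : HopfData k H R') (f : R →ₗ[k] R') : Prop where
  yd_hom : A.toYDData.IsHom B.toYDData f
  map_mul : f ∘ₗ A.mul = B.mul ∘ₗ TensorProduct.map f f
  map_unit : f ∘ₗ A.unit = B.unit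
  map_comul : B.comul ∘ₗ f = TensorProduct.map f f ∘ₗ A.comul
  map_counit : B.counit ∘ₗ f = A.counit
  map_antipode : f ∘ₗ A.antipode = B.antipode ∘ₗ f

/-- `A` and `B` are isomorphic as Hopf algebras in the category of Yetter-Drinfeld modules. -/
def Isomorphic (A : HopfData k H R) (B : HopfData k H R') : Prop :=
  ∃ e : R ≃ₗ[k] R', A.IsHom B e.toLinearMap

/-- `Rᵇᵒᵖ`: multiplication `m ∘ c`, comultiplication `c⁻¹ ∘ Δ`, the rest unchanged. -/
def bop [BijectiveAntipode k H] (A : HopfData k H R) : HopfData k H R where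
  toYDData := A.toYDData
  mul := A.mul ∘ₗ A.toYDData.braiding A.toYDData
  unit := A.unit
  comul := A.toYDData.braidingInv A.toYDData ∘ₗ A.comul
  counit := A.counit
  antipode := A.antipode

/-- The isomorphism `φ : *M ⊗ *N ≃ *(N ⊗ M)`, `φ(f ⊗ g)(n ⊗ m) = g(n) f(m)`. -/
def dualTensor (k : Type u) (M : Type w) (N : Type w₁) [Field k] [AddCommGroup M] [Module k M]
    [Module.Finite k M] [AddCommGroup N] [Module k N] [Module.Finite k N] :
    Module.Dual k M ⊗[k] Module.Dual k N ≃ₗ[k] Module.Dual k (N ⊗[k] M) :=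
  (TensorProduct.comm k (Module.Dual k M) (Module.Dual k N)).trans
    (TensorProduct.dualDistribEquiv k N M)

/-- The left dual `*R` in the braided category of finite-dimensional Yetter-Drinfeld modules:
with `σ = φ ∘ c⁻¹ : *R ⊗ *R → *(R ⊗ R)`, the multiplication is `*Δ ∘ σ`, the comultiplication is
`σ⁻¹ ∘ *m = c ∘ φ⁻¹ ∘ *m`, and unit, counit and antipode are the transposes of counit, unit and
antipode. -/
def leftDual [BijectiveAntipode k H] [Module.Finite k R] (A : HopfData k H R) :
    HopfData k H (Module.Dual k R) where
  toYDData := A.toYDData.leftDual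
  mul := A.comul.dualMap ∘ₗ (dualTensor k R R).toLinearMap ∘ₗ
    A.toYDData.leftDual.braidingInv A.toYDData.leftDual
  unit := A.counit.dualMap ∘ₗ LinearMap.toSpanSingleton k (Module.Dual k k) LinearMap.id
  comul := A.toYDData.leftDual.braiding A.toYDData.leftDual ∘ₗ
    (dualTensor k R R).symm.toLinearMap ∘ₗ A.mul.dualMap
  counit := Module.Dual.eval k k 1 ∘ₗ A.unit.dualMap
  antipode := A.antipode.dualMap

/-- `I` is a two-sided ideal, coideal and Yetter-Drinfeld submodule, stable under the antipode. -/
structure IsHopfIdeal (A : HopfData k H R) (I : Submodule k R) : Prop where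
  act_mem : ∀ h, ∀ x ∈ I, A.act h x ∈ I
  coact_mem : ∀ x ∈ I, TensorProduct.map LinearMap.id I.mkQ (A.coact x) = 0
  mul_mem_left : ∀ x, ∀ y ∈ I, A.mul (x ⊗ₜ y) ∈ I
  mul_mem_right : ∀ x ∈ I, ∀ y, A.mul (x ⊗ₜ y) ∈ I
  comul_mem : ∀ x ∈ I, TensorProduct.map I.mkQ I.mkQ (A.comul x) = 0
  counit_mem : ∀ x ∈ I, A.counit x = 0
  antipode_mem : ∀ x ∈ I, A.antipode x ∈ I

/-- The quotient by a Hopf ideal, with the induced structure maps. -/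
def quotient (A : HopfData k H R) (I : Submodule k R) (hI : A.IsHopfIdeal I) :
    HopfData k H (R ⧸ I) where
  act :=
    { toFun := fun h => I.mapQ I (A.act h) fun x hx => hI.act_mem h x hx
      map_add' := fun g h => by ext; simp
      map_smul' := fun a h => by ext; simp }
  coact := I.liftQ (TensorProduct.map LinearMap.id I.mkQ ∘ₗ A.coact)
    fun x hx => hI.coact_mem x hx
  mul := TensorProduct.lift <| I.liftQ
    { toFun := fun x => I.mapQ I (A.mul ∘ₗ TensorProduct.mk k R R x)
        fun y hy => hI.mul_mem_left x y hy
      map_add' := fun x y => by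
        ext z
        change I.mkQ (A.mul ((x + y) ⊗ₜ z)) = I.mkQ (A.mul (x ⊗ₜ z)) + I.mkQ (A.mul (y ⊗ₜ z))
        rw [TensorProduct.add_tmul, map_add, map_add]
      map_smul' := fun a x => by
        ext z
        change I.mkQ (A.mul ((a • x) ⊗ₜ z)) = a • I.mkQ (A.mul (x ⊗ₜ z))
        rw [← TensorProduct.smul_tmul', map_smul, map_smul] }
    fun x hx => by
      ext y
      exact (Submodule.Quotient.mk_eq_zero I).2 (hI.mul_mem_right x hx y)
  unit := I.mkQ ∘ₗ A.unit
  comul := I.liftQ (TensorProduct.map I.mkQ I.mkQ ∘ₗ A.comul) fun x hx => hI.comul_mem x hx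
  counit := I.liftQ A.counit fun x hx => hI.counit_mem x hx
  antipode := I.mapQ I A.antipode fun x hx => hI.antipode_mem x hx

end HopfData

/-! ### The tensor algebra as a Hopf algebra in Yetter-Drinfeld modules -/

namespace YDData

variable {V : Type w} [AddCommGroup V] [Module k V]

/-- The action on `T(V)` with `h · 1 = ε(h)` and `h · (xy) = (h₍₁₎ · x)(h₍₂₎ · y)`: the map
`x ↦ (h ↦ h · x)` is the algebra map to the convolution algebra `Hom(H, T(V))` extending the
action on `V`. -/
def tensorAct (s : YDData k H V) : H →ₗ[k] TensorAlgebra k V →ₗ[k] TensorAlgebra k V :=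
  LinearMap.flip
    { toFun := fun x => (TensorAlgebra.lift k
        ({ toFun := fun v => WithConv.toConv (TensorAlgebra.ι k ∘ₗ s.act.flip v)
           map_add' := fun v w => by ext; simp
           map_smul' := fun a v => by ext; simp } :
          V →ₗ[k] WithConv (H →ₗ[k] TensorAlgebra k V)) x).ofConv
      map_add' := fun x y => by simp
      map_smul' := fun a x => by simp }

/-- The coaction on `T(V)`: the algebra map `T(V) → H ⊗ T(V)` extending the coaction on `V`. -/
def tensorCoact (s : YDData k H V) : TensorAlgebra k V →ₗ[k] H ⊗[k] TensorAlgebra k V :=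
  (TensorAlgebra.lift k (TensorProduct.map LinearMap.id (TensorAlgebra.ι k) ∘ₗ s.coact)).toLinearMap

/-- Left multiplication by `v ⊗ 1 + 1 ⊗ v` in the braided tensor product algebra `T(V) ⊗ T(V)`:
`a ⊗ b ↦ va ⊗ b + (v₍₋₁₎ · a) ⊗ v₍₀₎b`. -/
def primitiveMul (s : YDData k H V) :
    V →ₗ[k] Module.End k (TensorAlgebra k V ⊗[k] TensorAlgebra k V) :=
  (TensorProduct.mapBilinear (RingHom.id k) _ _ _ _).flip LinearMap.id ∘ₗ
      LinearMap.mul k (TensorAlgebra k V) ∘ₗ TensorAlgebra.ι k +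
    TensorProduct.homTensorHomMap (RingHom.id k) _ _ _ _ ∘ₗ
      TensorProduct.map s.tensorAct (LinearMap.mul k (TensorAlgebra k V) ∘ₗ TensorAlgebra.ι k) ∘ₗ
      s.coact

/-- The comultiplication of `T(V)`: the algebra map to the braided tensor product algebra with
`Δ(v) = v ⊗ 1 + 1 ⊗ v`, i.e. `Δ(1) = 1 ⊗ 1` and `Δ(v x) = (v ⊗ 1 + 1 ⊗ v) Δ(x)`. -/
def tensorComul (s : YDData k H V) :
    TensorAlgebra k V →ₗ[k] TensorAlgebra k V ⊗[k] TensorAlgebra k V :=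
  LinearMap.applyₗ (1 ⊗ₜ 1) ∘ₗ (TensorAlgebra.lift k s.primitiveMul).toLinearMap

/-- `y ↦ m(S ⊗ S)c(v ⊗ x) = -(v₍₋₁₎ · y) v₍₀₎`, where `y = S(x)`. -/
def antipodeStep (s : YDData k H V) : V →ₗ[k] Module.End k (TensorAlgebra k V) :=
  -(TensorProduct.lift (LinearMap.mk₂ k
      (fun (h : H) (v : V) =>
        (LinearMap.mulRight k (TensorAlgebra.ι k v) ∘ₗ s.tensorAct h :
          Module.End k (TensorAlgebra k V)))
      (fun g h v => by ext; simp [add_mul]) (fun a h v => by ext; simp)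
      (fun h v w => by ext; simp [mul_add]) (fun a h v => by ext; simp)) ∘ₗ s.coact)

/-- The antipode of `T(V)`: `S(1) = 1`, `S(v) = -v` and `S ∘ m = m ∘ (S ⊗ S) ∘ c`, i.e.
`S(v x) = -(v₍₋₁₎ · S(x)) v₍₀₎`. -/
def tensorAntipode (s : YDData k H V) : TensorAlgebra k V →ₗ[k] TensorAlgebra k V :=
  LinearMap.applyₗ 1 ∘ₗ (TensorAlgebra.lift k s.antipodeStep).toLinearMap

/-- The tensor algebra of a Yetter-Drinfeld module, in which the elements of `V` are primitive. -/
def tensorHopf (s : YDData k H V) : HopfData k H (TensorAlgebra k V) where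
  act := s.tensorAct
  coact := s.tensorCoact
  mul := LinearMap.mul' k (TensorAlgebra k V)
  unit := Algebra.linearMap k (TensorAlgebra k V)
  comul := s.tensorComul
  counit := TensorAlgebra.algebraMapInv.toLinearMap
  antipode := s.tensorAntipode

end YDData

/-! ### Quantum symmetrizers -/

section Symmetrizer

variable {V : Type w} [AddCommGroup V] [Module k V]

/-- `x ⊗ y ↦ v₀ ⊗ ⋯ ⊗ x ⊗ ⋯ ⊗ y ⊗ ⋯ ⊗ vₙ₋₁`, with `x` in position `a` and `y` in position `b`. -/
def insertPair {n : ℕ} (a b : Fin n) (hab : a ≠ b) (v : Fin n → V) :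
    V ⊗[k] V →ₗ[k] ⨂[k]^n V :=
  TensorProduct.lift (LinearMap.mk₂ k
    (fun x y => PiTensorProduct.tprod k (Function.update (Function.update v a x) b y))
    (fun x x' y => by simp [Function.update_comm hab])
    (fun c x y => by simp [Function.update_comm hab])
    (fun x y y' => by simp)
    (fun c x y => by simp))

theorem insertPair_update {n : ℕ} (a b : Fin n) (hab : a ≠ b) (v : Fin n → V) (i : Fin n)
    (hi : i = a ∨ i = b) (z : V) :
    insertPair (k := k) a b hab (Function.update v i z) = insertPair a b hab v := by
  ext x y
  rcases hi with rfl | rfl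
  · simp [insertPair]
  · simp [insertPair, Function.update_comm hab]

theorem insertPair_update_add {n : ℕ} (a b : Fin n) (hab : a ≠ b) (v : Fin n → V) (i : Fin n)
    (ha : i ≠ a) (hb : i ≠ b) (z z' : V) :
    insertPair (k := k) a b hab (Function.update v i (z + z')) =
      insertPair a b hab (Function.update v i z) +
        insertPair a b hab (Function.update v i z') := by
  ext x y
  simp [insertPair, Function.update_comm ha, Function.update_comm hb]

theorem insertPair_update_smul {n : ℕ} (a b : Fin n) (hab : a ≠ b) (v : Fin n → V) (i : Fin n)
    (ha : i ≠ a) (hb : i ≠ b) (r : k) (z : V) :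
    insertPair (k := k) a b hab (Function.update v i (r • z)) =
      r • insertPair a b hab (Function.update v i z) := by
  ext x y
  simp [insertPair, Function.update_comm ha, Function.update_comm hb]

/-- The endomorphism `id ⊗ ⋯ ⊗ c ⊗ ⋯ ⊗ id` of `V^{⊗n}`, with `c` acting on the distinct factors
in positions `a` and `b`. -/
def applyAt (c : V ⊗[k] V →ₗ[k] V ⊗[k] V) {n : ℕ} (a b : Fin n) (hab : a ≠ b) :
    Module.End k (⨂[k]^n V) :=
  PiTensorProduct.lift <| MultilinearMap.mk' (fun v => insertPair a b hab v (c (v a ⊗ₜ v b)))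
    (fun v i x y => by
      by_cases ha : i = a
      · subst ha
        simp [insertPair_update, hab.symm, TensorProduct.add_tmul]
      by_cases hb : i = b
      · subst hb
        simp [insertPair_update, hab, TensorProduct.tmul_add]
      simp [insertPair_update_add a b hab v i ha hb, Ne.symm ha, Ne.symm hb])
    (fun v i r x => by
      by_cases ha : i = a
      · subst ha
        simp [insertPair_update, hab.symm, ← TensorProduct.smul_tmul']
      by_cases hb : i = b
      · subst hb
        simp [insertPair_update, hab]
      simp [insertPair_update_smul a b hab v i ha hb, Ne.symm ha, Ne.symm hb])

/-- The generator `σᵢ` of the braid group acting on `V^{⊗n}`: `c` acts on the factors in positions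
`i` and `i + 1` (counted from `0`); only the values for `i + 1 < n` are used. -/
def braidGen (c : V ⊗[k] V →ₗ[k] V ⊗[k] V) (n i : ℕ) : Module.End k (⨂[k]^n V) :=
  if h : i + 1 < n then
    applyAt c ⟨i, Nat.lt_of_succ_lt h⟩ ⟨i + 1, h⟩ (by simp)
  else 1

/-- A reduced word of `x ∈ Sₙ` in the adjacent transpositions `τᵢ = (i, i + 1)`, `0 ≤ i < n - 1`:
the concatenation for `j = 0, …, n - 1` of the runs `τ_{j-1} τ_{j-2} ⋯ τ_{j-r}`, where
`r = #{i < j | x⁻¹(i) > x⁻¹(j)}`. Its length is the number of inversions of `x`. -/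
def reducedWord {n : ℕ} (x : Equiv.Perm (Fin n)) : List ℕ :=
  (List.finRange n).flatMap fun j =>
    (List.range (Finset.univ.filter fun i => i < j ∧ x.symm j < x.symm i).card).map
      fun t => (j : ℕ) - 1 - t

/-- The endomorphism `σ_{i₁} ∘ ⋯ ∘ σ_{iᵣ}` of `V^{⊗n}` attached to `x ∈ Sₙ` with reduced word
`τ_{i₁} ⋯ τ_{iᵣ}`, that is, the action of the Matsumoto section of `x` in the braid group. -/
def braidLift (c : V ⊗[k] V →ₗ[k] V ⊗[k] V) {n : ℕ} (x : Equiv.Perm (Fin n)) :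
    Module.End k (⨂[k]^n V) :=
  ((reducedWord x).map (braidGen c n)).prod

/-- The quantum symmetrizer `𝔖ⁿ = ∑_{x ∈ Sₙ} s(x)` on `V^{⊗n}`. -/
def symmetrizer (c : V ⊗[k] V →ₗ[k] V ⊗[k] V) (n : ℕ) : Module.End k (⨂[k]^n V) :=
  ∑ x : Equiv.Perm (Fin n), braidLift c x

end Symmetrizer

/-! ### Nichols algebras -/

namespace YDData

variable {V : Type w} [AddCommGroup V] [Module k V]

/-- The subspace `⨁ₙ ker 𝔖ⁿ` of `T(V)`. -/
def nicholsIdeal (s : YDData k H V) : Submodule k (TensorAlgebra k V) :=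
  ⨆ n : ℕ, (LinearMap.ker (symmetrizer (s.braiding s) n)).map TensorPower.toTensorAlgebra

/-- The underlying space `T(V) / ⨁ₙ ker 𝔖ⁿ` of the Nichols algebra of `V`. -/
abbrev NicholsSpace (s : YDData k H V) : Type (max u w) := TensorAlgebra k V ⧸ s.nicholsIdeal

/-- The Nichols algebra of `V`, as a quotient Hopf algebra of `T(V)`. -/
def nichols (s : YDData k H V) (hs : s.tensorHopf.IsHopfIdeal s.nicholsIdeal) :
    HopfData k H s.NicholsSpace :=
  s.tensorHopf.quotient s.nicholsIdeal hs

end YDData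

end YetterDrinfeld

end BraidedHopf

end

/-!
The skew derivations `∂_f = (id ⊗ f) Δ` of `T(V)`, for `f ∈ *V`, define the pairing
`⟨f₁ ⋯ fₙ, x⟩ = ε(∂_{fₙ} ⋯ ∂_{f₁} x)` of `T(*V)` with `T(V)`. It exchanges products and coproducts,
in the order prescribed by `bop`, and is compatible with actions, coactions and antipodes. On degree
`n + 1`, `∂_f` is contraction of the last factor with `f` after
`1 + σₙ₋₁ + σₙ₋₁ σₙ₋₂ + ⋯ + σₙ₋₁ ⋯ σ₀`. As `𝔖ⁿ⁺¹` is this operator followed by `𝔖ⁿ ⊗ id`, the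
pairing in degree `n` is `⟨f₁ ⋯ fₙ, x⟩ = (fₙ ⊗ ⋯ ⊗ f₁)(𝔖ⁿ x)`, so its radical in `T(V)` is
`⨁ₙ ker 𝔖ⁿ`, which is therefore a Hopf ideal.

The pairing agrees with the analogous one built from `*V` and the evaluations `V → **V`, so its
radical in `T(*V)` is the Hopf ideal of `*V`. Hence it induces a morphism of Hopf algebras
`T(*V) → (*𝔅(V))ᵇᵒᵖ` with this kernel, which is surjective because the functionals `⟨F, ·⟩` separate
the points of the finite-dimensional space `𝔅(V)`. The axioms of a Hopf algebra pass from `T(V)` and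
`T(*V)` to the images of surjective morphisms.
-/

open scoped TensorProduct

noncomputable section

namespace BraidedHopf

/-! ### Comatrices and coactions -/

section Comatrix

open Coalgebra

variable {k : Type*} [CommSemiring k] {C : Type*} [AddCommMonoid C] [Module k C] [Coalgebra k C]
variable {ι : Type*} [Fintype ι] [DecidableEq ι]
variable {M : Type*} [AddCommMonoid M] [Module k M]

variable (k) in
/-- A square matrix `t` over a coalgebra with `Δ(tᵢⱼ) = ∑ₗ tᵢₗ ⊗ tₗⱼ` and `ε(tᵢⱼ) = δᵢⱼ`. Comatrices
replace Sweedler's notation: linear maps out of a coalgebra are determined by their values on the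
entries of comatrices, and there iterated comultiplications are finite sums. -/
structure IsComatrix (t : ι → ι → C) : Prop where
  comul : ∀ i j, comul (R := k) (t i j) = ∑ l, t i l ⊗ₜ[k] t l j
  counit : ∀ i j, counit (R := k) (t i j) = if i = j then 1 else 0

/-- A left coaction of a coalgebra on a vector space. -/
structure IsCoaction (δ : M →ₗ[k] C ⊗[k] M) : Prop where
  coassoc :
    (TensorProduct.assoc k C C M).toLinearMap ∘ₗ TensorProduct.map comul LinearMap.id ∘ₗ δ =
      TensorProduct.map LinearMap.id δ ∘ₗ δ
  counit :
    (TensorProduct.lid k M).toLinearMap ∘ₗ TensorProduct.map counit LinearMap.id ∘ₗ δ =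
      LinearMap.id

/-- The comatrix `t` describes the coaction `δ` on the family `x`: `δ(xⱼ) = ∑ᵢ tⱼᵢ ⊗ xᵢ`. Finite
families of this kind, which need not be bases, span every comodule. -/
structure IsCoactionMatrix (δ : M →ₗ[k] C ⊗[k] M) (x : ι → M) (t : ι → ι → C) : Prop extends
    IsComatrix k t where
  apply : ∀ j, δ (x j) = ∑ i, t j i ⊗ₜ x i

omit [Coalgebra k C] in
theorem lid_rTensor_assoc_tmul (φ : Module.Dual k C) (z : C ⊗[k] C) (m : M) :
    TensorProduct.lid k (C ⊗[k] M)
        (φ.rTensor (C ⊗[k] M) (TensorProduct.assoc k C C M (z ⊗ₜ m))) =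
      TensorProduct.lid k C (φ.rTensor C z) ⊗ₜ m := by
  induction z with
  | zero => simp
  | add x y hx hy => simp only [TensorProduct.add_tmul, map_add, hx, hy]
  | tmul x y => simp [TensorProduct.smul_tmul']

theorem isCoaction_of_basis {δ : M →ₗ[k] C ⊗[k] M} (b : Module.Basis ι k M) {t : ι → ι → C}
    (ht : IsCoactionMatrix δ b t) : IsCoaction δ where
  coassoc := b.ext fun j => by
    simp only [LinearMap.comp_apply, ht.apply, map_sum, TensorProduct.map_tmul, ht.comul,
      TensorProduct.sum_tmul, TensorProduct.tmul_sum, LinearMap.id_apply, LinearEquiv.coe_coe,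
      TensorProduct.assoc_tmul]
    exact Finset.sum_comm
  counit := b.ext fun j => by simp [ht.apply, map_sum, ht.counit]

end Comatrix

section CoactionOverField

open Coalgebra

variable {k : Type*} [Field k] {C : Type*} [AddCommGroup C] [Module k C] [Coalgebra k C]
variable {ι : Type*} [Fintype ι] [DecidableEq ι]
variable {M : Type*} [AddCommGroup M] [Module k M] {X : Type*} [AddCommGroup X] [Module k X]

namespace IsCoaction

theorem comul : IsCoaction (comul : C →ₗ[k] C ⊗[k] C) where
  coassoc := Coalgebra.coassoc
  counit := by
    ext x
    exact (congrArg (TensorProduct.lid k C) (rTensor_counit_comul (R := k) x)).trans (by simp)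

variable {δ : M →ₗ[k] C ⊗[k] M} (hδ : IsCoaction δ)
include hδ

theorem isCoactionMatrix {x : ι → M} (hx : LinearIndependent k x) {t : ι → ι → C}
    (ht : ∀ j, δ (x j) = ∑ i, t j i ⊗ₜ x i) : IsCoactionMatrix δ x t := by
  obtain ⟨π, hπ⟩ := (Finsupp.linearCombination k x).exists_leftInverse_of_injective
    (LinearMap.ker_eq_bot.2 hx)
  have hφ (i j : ι) : π (x j) i = if i = j then 1 else 0 := by
    have h := LinearMap.congr_fun hπ (Finsupp.single j 1)
    simp only [LinearMap.comp_apply, Finsupp.linearCombination_single, one_smul,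
      LinearMap.id_apply] at h
    simp [h, Finsupp.single_apply, eq_comm]
  refine ⟨⟨fun i j => ?_, fun i j => ?_⟩, ht⟩
  · have h := congrArg ((TensorProduct.rid k (C ⊗[k] C)).toLinearMap ∘ₗ
      TensorProduct.map LinearMap.id (Finsupp.lapply j ∘ₗ π) ∘ₗ
      (TensorProduct.assoc k C C M).symm.toLinearMap) (LinearMap.congr_fun hδ.coassoc (x i))
    simpa [ht, map_sum, hφ, TensorProduct.sum_tmul, TensorProduct.tmul_sum] using h
  · have h := congrArg (π · j) (LinearMap.congr_fun hδ.counit (x i))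
    simpa [ht, map_sum, hφ, eq_comm] using h

theorem exists_finiteDimensional_mem (m : M) :
    ∃ W : Submodule k M, Module.Finite k W ∧ m ∈ W ∧
      ∀ w ∈ W, δ w ∈ LinearMap.range (W.subtype.lTensor C) := by
  set e := Module.Basis.ofVectorSpace k C
  obtain ⟨a, ha⟩ := TensorProduct.eq_repr_basis_left e (δ m)
  have mem_a (i) : a i ∈ Submodule.span k (Set.range a) := Submodule.subset_span ⟨i, rfl⟩
  have δ_a (i) : δ (a i) = a.sum fun j c => ((TensorProduct.lid k C)
      ((e.coord i).rTensor C (Coalgebra.comul (e j)))) ⊗ₜ c := by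
    have h := congrArg (TensorProduct.lid k (C ⊗[k] M) ∘ (e.coord i).rTensor (C ⊗[k] M))
      (LinearMap.congr_fun hδ.coassoc m)
    simp only [LinearMap.comp_apply, ← ha, Finsupp.sum, map_sum, Function.comp_apply,
      TensorProduct.map_tmul, LinearMap.id_apply, LinearMap.rTensor_tmul, LinearEquiv.coe_coe,
      Module.Basis.coord_apply, Module.Basis.repr_self, TensorProduct.lid_tmul] at h
    have hi : ∑ j ∈ a.support, (Finsupp.single j (1 : k)) i • δ (a j) = δ (a i) := by
      rw [Finset.sum_eq_single i] <;> simp +contextual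
    rw [← hi, ← h]
    exact Finset.sum_congr rfl fun j _ => lid_rTensor_assoc_tmul (e.coord i) _ (a j)
  refine ⟨Submodule.span k (Set.range a), ?_, ?_, fun w hw => ?_⟩
  · exact Module.Finite.iff_fg.2 (Submodule.fg_span (Finsupp.finite_range a))
  · have h := LinearMap.congr_fun hδ.counit m
    simp only [LinearMap.comp_apply, ← ha, Finsupp.sum, map_sum, TensorProduct.map_tmul,
      LinearEquiv.coe_coe, TensorProduct.lid_tmul, LinearMap.id_apply] at h
    rw [← h]
    exact Submodule.sum_mem _ fun i _ => Submodule.smul_mem _ _ (mem_a i)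
  · refine (Submodule.span_le (p := (LinearMap.range _).comap δ)).2 ?_ hw
    rintro _ ⟨i, rfl⟩
    rw [SetLike.mem_coe, Submodule.mem_comap, δ_a]
    exact Submodule.sum_mem _ fun j _ => ⟨_ ⊗ₜ ⟨a j, mem_a j⟩, rfl⟩

theorem exists_isCoactionMatrix (m : M) :
    ∃ (n : ℕ) (x : Fin n → M) (t : Fin n → Fin n → C), IsCoactionMatrix δ x t ∧
      m ∈ Submodule.span k (Set.range x) := by
  obtain ⟨W, hfin, hm, hW⟩ := hδ.exists_finiteDimensional_mem m
  have b := Module.finBasis k W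
  have hcoact (j) : ∃ c : _ → C, δ (b j) = ∑ i, c i ⊗ₜ (b i : M) := by
    obtain ⟨z, hz⟩ := hW (b j) (b j).2
    obtain ⟨c, rfl⟩ := TensorProduct.eq_repr_basis_right b z
    exact ⟨c, by simp [← hz, Finsupp.sum_fintype, map_sum]⟩
  choose t ht using hcoact
  have hli : LinearIndependent k fun i => (b i : M) :=
    b.linearIndependent.map' W.subtype W.ker_subtype
  refine ⟨_, _, t, hδ.isCoactionMatrix hli ht, ?_⟩
  have : Set.range (fun i => (b i : M)) = W.subtype '' Set.range b := by
    rw [← Set.range_comp]; rfl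
  rwa [this, Submodule.span_image, b.span_eq, Submodule.map_top, Submodule.range_subtype]

theorem linearMap_ext {f g : M →ₗ[k] X}
    (hfg : ∀ (n : ℕ) (x : Fin n → M) (t : Fin n → Fin n → C), IsCoactionMatrix δ x t →
      ∀ j, f (x j) = g (x j)) : f = g := by
  ext m
  obtain ⟨n, x, t, hx, hm⟩ := hδ.exists_isCoactionMatrix m
  exact LinearMap.eqOn_span (by rintro _ ⟨j, rfl⟩; exact hfg n x t hx j) hm

theorem exists_coact_basis (b : Module.Basis ι k M) :
    ∃ t : ι → ι → C, IsCoactionMatrix δ b t := by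
  choose c hc using fun j => TensorProduct.eq_repr_basis_right b (δ (b j))
  exact ⟨fun j i => c j i, hδ.isCoactionMatrix b.linearIndependent fun j => by
    simp [← hc, Finsupp.sum_fintype]⟩

end IsCoaction

theorem linearMap_ext_comatrix {f g : C →ₗ[k] X}
    (hfg : ∀ (n : ℕ) (t : Fin n → Fin n → C), IsComatrix k t → ∀ i j, f (t i j) = g (t i j)) :
    f = g :=
  IsCoaction.comul.linearMap_ext fun n x t hx j => by
    have h := congrArg (TensorProduct.rid k C) (lTensor_counit_comul (R := k) (x j))
    simp only [hx.apply, map_sum, LinearMap.lTensor_tmul, TensorProduct.rid_tmul, one_smul] at h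
    simp only [← h, map_sum, map_smul, hfg n t hx.toIsComatrix]

end CoactionOverField

namespace IsComatrix

open HopfAlgebra

variable {k : Type*} {H : Type*} [CommSemiring k] [Semiring H] [HopfAlgebra k H]
variable {ι : Type*} [Fintype ι] [DecidableEq ι] {t : ι → ι → H} (ht : IsComatrix k t)
include ht

theorem sum_antipode_mul (i j : ι) :
    ∑ l, antipode k (t i l) * t l j = if i = j then 1 else 0 := by
  have h := mul_antipode_rTensor_comul_apply (R := k) (t i j)
  rw [ht.comul, ht.counit] at h
  simpa [map_sum] using h

theorem sum_mul_antipode (i j : ι) :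
    ∑ l, t i l * antipode k (t l j) = if i = j then 1 else 0 := by
  have h := mul_antipode_lTensor_comul_apply (R := k) (t i j)
  rw [ht.comul, ht.counit] at h
  simpa [map_sum] using h

theorem comul_antipode (i j : ι) :
    Coalgebra.comul (R := k) (antipode k (t i j)) =
      ∑ l, antipode k (t l j) ⊗ₜ[k] antipode k (t i l) := by
  -- both sides are inverse to the matrix of the `Δ(tᵢⱼ)` over `H ⊗ H`
  let A : Matrix ι ι (H ⊗[k] H) := .of fun i j => Coalgebra.comul (R := k) (antipode k (t i j))
  let B : Matrix ι ι (H ⊗[k] H) := .of fun i j => Coalgebra.comul (R := k) (t i j)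
  let C : Matrix ι ι (H ⊗[k] H) := .of fun i j =>
    ∑ l, antipode k (t l j) ⊗ₜ[k] antipode k (t i l)
  have hAB : A * B = 1 := by
    ext i j
    simp only [Matrix.mul_apply, A, B, Matrix.of_apply]
    simp_rw [← Bialgebra.comul_mul, ← map_sum, ht.sum_antipode_mul, Matrix.one_apply]
    split_ifs <;> simp
  have hBC : B * C = 1 := by
    ext i j
    have hsum (p : ι) : ∑ l, ∑ r, (t i r * antipode k (t p j)) ⊗ₜ[k]
        (t r l * antipode k (t l p)) = (t i p * antipode k (t p j)) ⊗ₜ[k] 1 := by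
      rw [Finset.sum_comm]
      simp_rw [← TensorProduct.tmul_sum, ht.sum_mul_antipode]
      rw [Finset.sum_eq_single p] <;> simp +contextual
    simp only [Matrix.mul_apply, Matrix.of_apply, B, C, ht.comul, Finset.sum_mul, Finset.mul_sum,
      Algebra.TensorProduct.tmul_mul_tmul]
    rw [Finset.sum_comm]
    simp_rw [hsum, ← TensorProduct.sum_tmul, ht.sum_mul_antipode, Matrix.one_apply]
    split_ifs <;> simp [Algebra.TensorProduct.one_def]
  have hAC : A = C := left_inv_eq_right_inv hAB hBC
  exact congrFun (congrFun hAC i) j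

theorem antipode_transpose : IsComatrix k fun i j => antipode k (t j i) where
  counit i j := by simp [ht.counit, eq_comm]
  comul i j := ht.comul_antipode j i

end IsComatrix

/-! ### Yetter-Drinfeld modules -/

section YetterDrinfeldBasics

open HopfAlgebra

variable {k : Type*} {H : Type*} [Field k] [Ring H] [HopfAlgebra k H]
variable {ι : Type*} [Fintype ι] [DecidableEq ι]

section AntipodeInv

variable [BijectiveAntipode k H]

@[simp]
theorem antipodeInv_antipode (h : H) : antipodeInv k H (antipode k h) = h :=
  (LinearEquiv.ofBijective (antipode k : H →ₗ[k] H) BijectiveAntipode.bijective).symm_apply_apply h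

@[simp]
theorem antipode_antipodeInv (h : H) : antipode k (antipodeInv k H h) = h :=
  (LinearEquiv.ofBijective (antipode k : H →ₗ[k] H) BijectiveAntipode.bijective).apply_symm_apply h

theorem antipode_injective : Function.Injective (antipode k : H →ₗ[k] H) :=
  BijectiveAntipode.bijective.1

theorem antipodeInv_one : antipodeInv k H (1 : H) = 1 :=
  antipode_injective (k := k) (by simp)

theorem antipodeInv_mul (g h : H) :
    antipodeInv k H (g * h) = antipodeInv k H h * antipodeInv k H g :=
  antipode_injective (k := k) (by simp [antipode_mul_antidistrib])

namespace IsComatrix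

variable {t : ι → ι → H} (ht : IsComatrix k t)
include ht

theorem sum_antipodeInv_mul (i j : ι) :
    ∑ l, antipodeInv k H (t l j) * t i l = if i = j then 1 else 0 := by
  apply antipode_injective (k := k)
  simp only [map_sum, antipode_mul_antidistrib, antipode_antipodeInv, ht.sum_antipode_mul]
  split_ifs <;> simp

theorem antipodeInv_transpose : IsComatrix k fun i j => antipodeInv k H (t j i) where
  counit i j := by
    rw [← counit_antipode (R := k), antipode_antipodeInv, ht.counit]
    simp only [eq_comm]
  comul i j := by
    have hS : TensorProduct.map (antipode k) (antipode k) ∘ₗ Coalgebra.comul =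
        (TensorProduct.comm k H H).toLinearMap ∘ₗ Coalgebra.comul ∘ₗ antipode k :=
      linearMap_ext_comatrix fun n u hu p q => by
        simp [hu.comul, hu.comul_antipode, map_sum]
    let e := LinearEquiv.ofBijective (antipode k : H →ₗ[k] H) BijectiveAntipode.bijective
    apply (TensorProduct.congr e e).injective
    have h := LinearMap.congr_fun hS (antipodeInv k H (t j i))
    simp only [LinearMap.comp_apply, antipode_antipodeInv, ht.comul, map_sum] at h
    exact h.trans (by simp [e])

end IsComatrix

end AntipodeInv

namespace YDData

variable {M : Type*} [AddCommGroup M] [Module k M] {N : Type*} [AddCommGroup N] [Module k N]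

theorem IsYetterDrinfeld.isCoaction {s : YDData k H M} (hs : s.IsYetterDrinfeld) :
    IsCoaction s.coact :=
  ⟨hs.coassoc, hs.counit_coact⟩

theorem tensor_act_tmul (s : YDData k H M) (r : YDData k H N) {t : ι → ι → H}
    (ht : IsComatrix k t) (i j : ι) (m : M) (n : N) :
    (s.tensor r).act (t i j) (m ⊗ₜ n) = ∑ l, s.act (t i l) m ⊗ₜ r.act (t l j) n := by
  simp [tensor, ht.comul, map_sum, LinearMap.sum_apply]

/-- The map `(g ⊗ m) ⊗ (h ⊗ n) ↦ gh ⊗ (m ⊗ n)`, through which the coactions on `M` and `N` give the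
coaction on `M ⊗ N`. -/
def coactMul (M N : Type*) [AddCommGroup M] [Module k M] [AddCommGroup N] [Module k N] :
    (H ⊗[k] M) ⊗[k] (H ⊗[k] N) →ₗ[k] H ⊗[k] (M ⊗[k] N) :=
  TensorProduct.map (LinearMap.mul' k H) LinearMap.id ∘ₗ
    (TensorProduct.tensorTensorTensorComm k H M H N).toLinearMap

@[simp]
theorem coactMul_tmul (g h : H) (m : M) (n : N) :
    coactMul M N ((g ⊗ₜ[k] m) ⊗ₜ (h ⊗ₜ n)) = (g * h) ⊗ₜ (m ⊗ₜ n) := rfl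

theorem tensor_coact_tmul (s : YDData k H M) (r : YDData k H N) (m : M) (n : N) :
    (s.tensor r).coact (m ⊗ₜ n) = coactMul M N (s.coact m ⊗ₜ r.coact n) := rfl

/-- The map `(h ⊗ m) ⊗ n ↦ h · n ⊗ m`, through which the coaction on `M` gives the braiding of `M`
and `N`. -/
def braidingAux (r : YDData k H N) (M : Type*) [AddCommGroup M] [Module k M] :
    (H ⊗[k] M) ⊗[k] N →ₗ[k] N ⊗[k] M :=
  TensorProduct.map (TensorProduct.lift r.act) LinearMap.id ∘ₗ
    (TensorProduct.rightComm k H M N).toLinearMap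

@[simp]
theorem braidingAux_tmul (r : YDData k H N) (h : H) (m : M) (n : N) :
    r.braidingAux M ((h ⊗ₜ m) ⊗ₜ n) = r.act h n ⊗ₜ m := rfl

theorem braiding_tmul (s : YDData k H M) (r : YDData k H N) (m : M) (n : N) :
    s.braiding r (m ⊗ₜ n) = r.braidingAux M (s.coact m ⊗ₜ n) := rfl

theorem braidingInv_tmul_of_coact [BijectiveAntipode k H] {s : YDData k H M} (r : YDData k H N)
    {x : ι → M} {t : ι → ι → H} (hx : IsCoactionMatrix s.coact x t) (i : ι) (n : N) :
    r.braidingInv s (n ⊗ₜ x i) = ∑ l, x l ⊗ₜ r.act (antipodeInv k H (t i l)) n := by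
  simp [braidingInv, hx.apply, TensorProduct.sum_tmul, map_sum]

theorem braidingInv_braiding [BijectiveAntipode k H] {s : YDData k H M} {r : YDData k H N}
    (hs : s.IsYetterDrinfeld) (hr : r.IsYetterDrinfeld) (z : M ⊗[k] N) :
    r.braidingInv s (s.braiding r z) = z := by
  suffices h : ∀ n, r.braidingInv s ∘ₗ s.braiding r ∘ₗ (TensorProduct.mk k M N).flip n =
      (TensorProduct.mk k M N).flip n by
    induction z with
    | zero => simp
    | add x y hx hy => simp only [map_add, hx, hy]
    | tmul m n => exact LinearMap.congr_fun (h n) m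
  refine fun n => hs.isCoaction.linearMap_ext fun _ x t hx j => ?_
  have hinv (i l) : x l ⊗ₜ[k] r.act (antipodeInv k H (t i l)) (r.act (t j i) n) =
      x l ⊗ₜ r.act (antipodeInv k H (t i l) * t j i) n := by rw [hr.mul_act]
  simp only [LinearMap.comp_apply, LinearMap.flip_apply, TensorProduct.mk_apply, braiding_tmul,
    hx.apply, TensorProduct.sum_tmul, map_sum, braidingAux_tmul, braidingInv_tmul_of_coact r hx,
    hinv]
  rw [Finset.sum_comm]
  simp only [← TensorProduct.tmul_sum, ← LinearMap.sum_apply, ← map_sum, hx.sum_antipodeInv_mul]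
  rw [Finset.sum_eq_single j] <;> simp +contextual [hr.one_act, eq_comm]

section Compat

/-- Right multiplication on the first factor: `rightMul M g (h ⊗ m) = hg ⊗ m`. -/
def rightMul (M : Type*) [AddCommGroup M] [Module k M] : H →ₗ[k] Module.End k (H ⊗[k] M) :=
  LinearMap.rTensorHom M ∘ₗ (LinearMap.mul k H).flip

@[simp]
theorem rightMul_tmul (g h : H) (m : M) : rightMul M g (h ⊗ₜ[k] m) = (h * g) ⊗ₜ m := rfl

theorem rightMul_one (z : H ⊗[k] M) : rightMul M 1 z = z := by
  induction z with
  | zero => simp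
  | add x y hx hy => rw [map_add, hx, hy]
  | tmul h m => simp

theorem rightMul_rightMul (g h : H) (z : H ⊗[k] M) :
    rightMul M h (rightMul M g z) = rightMul M (g * h) z := by
  induction z with
  | zero => simp
  | add x y hx hy => simp only [map_add, hx, hy]
  | tmul h m => simp [mul_assoc]

theorem sum_rightMul_rightMul {a b : ι → ι → H} {q : ι}
    (hab : ∀ l, ∑ r, a l r * b r q = if l = q then 1 else 0) (z : ι → H ⊗[k] M) :
    ∑ r, rightMul M (b r q) (∑ l, rightMul M (a l r) (z l)) = z q := by
  simp only [map_sum, rightMul_rightMul]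
  rw [Finset.sum_comm]
  simp only [← LinearMap.sum_apply, ← map_sum, hab]
  rw [Finset.sum_eq_single q] <;> simp +contextual [rightMul_one]

variable {s : YDData k H M}

theorem sandwich_comul_comul {t : ι → ι → H} (ht : IsComatrix k t) (p q : ι) (z : H ⊗[k] M) :
    s.sandwich (TensorProduct.map LinearMap.id Coalgebra.comul
        (Coalgebra.comul (R := k) (t p q)) ⊗ₜ z) =
      ∑ r, rightMul M (antipode k (t r q))
        (∑ l, TensorProduct.map (LinearMap.mulLeft k (t p l)) (s.act (t l r)) z) := by
  induction z with
  | zero => simp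
  | add x y hx hy => simp only [TensorProduct.tmul_add, map_add, hx, hy, Finset.sum_add_distrib]
  | tmul g m =>
    simp only [ht.comul, map_sum, TensorProduct.map_tmul, LinearMap.id_apply,
      TensorProduct.sum_tmul, TensorProduct.tmul_sum, sandwich_tmul, LinearMap.mulLeft_apply,
      rightMul_tmul, mul_assoc]
    exact Finset.sum_comm

/-- In Sweedler notation, `(h₍₁₎ · m)₍₋₁₎ h₍₂₎ ⊗ (h₍₁₎ · m)₍₀₎ = h₍₁₎ m₍₋₁₎ ⊗ h₍₂₎ · m₍₀₎`. -/
theorem IsYetterDrinfeld.compat (hs : s.IsYetterDrinfeld) {t : ι → ι → H} (ht : IsComatrix k t)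
    (p q : ι) (m : M) :
    ∑ l, rightMul M (t l q) (s.coact (s.act (t p l) m)) =
      ∑ l, TensorProduct.map (LinearMap.mulLeft k (t p l)) (s.act (t l q)) (s.coact m) := by
  simp only [hs.coact_act, sandwich_comul_comul ht]
  exact sum_rightMul_rightMul (fun l => ht.sum_antipode_mul l q) _

theorem IsYetterDrinfeld.of_compat (one_act : ∀ m, s.act 1 m = m)
    (mul_act : ∀ g h m, s.act (g * h) m = s.act g (s.act h m)) (hδ : IsCoaction s.coact)
    (compat : ∀ (n : ℕ) (t : Fin n → Fin n → H), IsComatrix k t → ∀ p q m,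
      ∑ l, rightMul M (t l q) (s.coact (s.act (t p l) m)) =
        ∑ l, TensorProduct.map (LinearMap.mulLeft k (t p l)) (s.act (t l q)) (s.coact m)) :
    s.IsYetterDrinfeld where
  one_act := one_act
  mul_act := mul_act
  coassoc := hδ.coassoc
  counit_coact := hδ.counit
  coact_act h m := by
    suffices hlin : s.coact ∘ₗ s.act.flip m =
        s.sandwich ∘ₗ (TensorProduct.mk k _ _).flip (s.coact m) ∘ₗ
          TensorProduct.map LinearMap.id Coalgebra.comul ∘ₗ Coalgebra.comul from
      LinearMap.congr_fun hlin h
    refine linearMap_ext_comatrix fun n t ht p q => ?_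
    have hinv := sum_rightMul_rightMul (a := t) (b := fun i j => antipode k (t i j))
      (fun l => ht.sum_mul_antipode l q) fun l => s.coact (s.act (t p l) m)
    simp only [compat n t ht] at hinv
    exact hinv.symm.trans (sandwich_comul_comul ht p q _).symm

end Compat

section LeftDual

/-- The map `h ⊗ f ↦ f(x) h`; it turns the coaction of the left dual into `f₍₋₁₎ f₍₀₎(x)`. -/
def evalRight (H : Type*) [Ring H] [HopfAlgebra k H] (x : M) :
    H ⊗[k] Module.Dual k M →ₗ[k] H :=
  (TensorProduct.rid k H).toLinearMap ∘ₗ TensorProduct.map LinearMap.id (Module.Dual.eval k M x)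

@[simp]
theorem evalRight_tmul (x : M) (h : H) (f : Module.Dual k M) :
    evalRight H x (h ⊗ₜ f) = f x • h := rfl

/-- The map `h ⊗ x ↦ f(x) S(h)`; it turns the coaction on `x` into `S(x₍₋₁₎) f(x₍₀₎)`. -/
def antipodeEval (H : Type*) [Ring H] [HopfAlgebra k H] (f : Module.Dual k M) :
    H ⊗[k] M →ₗ[k] H :=
  (TensorProduct.rid k H).toLinearMap ∘ₗ TensorProduct.map (antipode k) f

@[simp]
theorem antipodeEval_tmul (f : Module.Dual k M) (h : H) (x : M) :
    antipodeEval H f (h ⊗ₜ x) = f x • antipode k h := rfl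

theorem evalRight_rightMul (x : M) (h : H) (z : H ⊗[k] Module.Dual k M) :
    evalRight H x (rightMul _ h z) = evalRight H x z * h := by
  induction z with
  | zero => simp
  | add x y hx hy => simp only [map_add, add_mul, hx, hy]
  | tmul g n => simp

theorem evalRight_map_mulLeft (x : M) (h : H) (f : M →ₗ[k] M) (z : H ⊗[k] Module.Dual k M) :
    evalRight H x (TensorProduct.map (LinearMap.mulLeft k h) f.dualMap z) =
      h * evalRight H (f x) z := by
  induction z with
  | zero => simp
  | add x y hx hy => simp only [map_add, mul_add, hx, hy]
  | tmul g n => simp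

theorem antipodeEval_rightMul (f : Module.Dual k M) (h : H) (z : H ⊗[k] M) :
    antipodeEval H f (rightMul M h z) = antipode k h * antipodeEval H f z := by
  induction z with
  | zero => simp
  | add x y hx hy => simp only [map_add, mul_add, hx, hy]
  | tmul g n => simp [antipode_mul_antidistrib]

theorem antipodeEval_map_mulLeft (f : Module.Dual k M) (h : H) (g : M →ₗ[k] M) (z : H ⊗[k] M) :
    antipodeEval H f (TensorProduct.map (LinearMap.mulLeft k h) g z) =
      antipodeEval H (f ∘ₗ g) z * antipode k h := by
  induction z with
  | zero => simp
  | add x y hx hy => simp only [map_add, add_mul, hx, hy]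
  | tmul g' n => simp [antipode_mul_antidistrib]

omit [DecidableEq ι] in
theorem eq_sum_evalRight (b : Module.Basis ι k M) (z : H ⊗[k] Module.Dual k M) :
    z = ∑ i, evalRight H (b i) z ⊗ₜ b.coord i := by
  induction z with
  | zero => simp
  | add x y hx hy =>
    simp only [map_add, TensorProduct.add_tmul, Finset.sum_add_distrib]
    rw [← hx, ← hy]
  | tmul g f =>
    simp only [evalRight_tmul, TensorProduct.smul_tmul, ← TensorProduct.tmul_sum]
    congr 1
    exact b.ext fun j => by simp

variable [Module.Finite k M]

theorem evalRight_ext {z z' : H ⊗[k] Module.Dual k M}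
    (h : ∀ x, evalRight H x z = evalRight H x z') : z = z' := by
  rw [eq_sum_evalRight (Module.finBasis k M) z, eq_sum_evalRight (Module.finBasis k M) z']
  exact Finset.sum_congr rfl fun i _ => by rw [h]

variable [BijectiveAntipode k H] (s : YDData k H M)

theorem leftDual_act (h : H) : s.leftDual.act h = (s.act (antipodeInv k H h)).dualMap := rfl

theorem leftDual_act_apply (h : H) (f : Module.Dual k M) (x : M) :
    s.leftDual.act h f x = f (s.act (antipodeInv k H h) x) := rfl

theorem evalRight_leftDual_coact (f : Module.Dual k M) (x : M) :
    evalRight H x (s.leftDual.coact f) = antipodeEval H f (s.coact x) := by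
  have hterm (i) (z : H ⊗[k] M) : evalRight H x (TensorProduct.map (antipode k)
      (LinearMap.smulRight f ((Module.finBasis k M).coord i)) z) =
        (Module.finBasis k M).repr x i • antipodeEval H f z := by
    induction z with
    | zero => simp
    | add x y hx hy => simp only [map_add, smul_add, hx, hy]
    | tmul g n => simp [smul_smul, mul_comm]
  have hcoact : s.leftDual.coact f = ∑ i, TensorProduct.map (antipode k)
      (LinearMap.smulRight f ((Module.finBasis k M).coord i)) (s.coact (Module.finBasis k M i)) :=
    rfl
  conv_rhs => rw [← (Module.finBasis k M).sum_repr x]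
  simp only [map_sum, map_smul, hcoact, hterm]

theorem leftDual_coact_coord (b : Module.Basis ι k M) {t : ι → ι → H}
    (ht : IsCoactionMatrix s.coact b t) (j : ι) :
    s.leftDual.coact (b.coord j) = ∑ i, antipode k (t i j) ⊗ₜ b.coord i := by
  rw [eq_sum_evalRight b (s.leftDual.coact (b.coord j))]
  refine Finset.sum_congr rfl fun i _ => ?_
  rw [evalRight_leftDual_coact, ht.apply]
  simp [map_sum, Finsupp.single_apply]

variable {s} (hs : s.IsYetterDrinfeld)
include hs

theorem IsYetterDrinfeld.isCoaction_leftDual : IsCoaction s.leftDual.coact := by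
  let b := Module.finBasis k M
  obtain ⟨t, ht⟩ := hs.isCoaction.exists_coact_basis b
  refine isCoaction_of_basis b.dualBasis (t := fun i j => antipode k (t j i))
    ⟨ht.antipode_transpose, fun j => ?_⟩
  simpa using s.leftDual_coact_coord b ht j

theorem IsYetterDrinfeld.leftDual : s.leftDual.IsYetterDrinfeld := by
  refine .of_compat (fun f => ?_) (fun g h f => ?_) hs.isCoaction_leftDual fun n t ht p q f => ?_
  · ext x
    rw [leftDual_act_apply, antipodeInv_one, hs.one_act]
  · ext x
    simp only [leftDual_act_apply, antipodeInv_mul, hs.mul_act]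
  · refine evalRight_ext fun x => ?_
    have hcompat := congrArg (antipodeEval H f) (hs.compat ht.antipodeInv_transpose q p x)
    simp only [map_sum, antipodeEval_rightMul, antipodeEval_map_mulLeft,
      antipode_antipodeInv] at hcompat
    simp only [map_sum, evalRight_rightMul, leftDual_act, evalRight_map_mulLeft,
      evalRight_leftDual_coact]
    exact hcompat.symm

end LeftDual

end YDData

end YetterDrinfeldBasics

/-! ### The tensor algebra -/

section TensorAlgebraYD

variable {k : Type*} {H : Type*} [Field k] [Ring H] [HopfAlgebra k H]
variable {ι : Type*} [Fintype ι] [DecidableEq ι]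
variable {V : Type*} [AddCommGroup V] [Module k V]

namespace YDData

theorem map_id_rightMul {W : Type*} [AddCommGroup W] [Module k W] (f : V →ₗ[k] W) (g : H)
    (z : H ⊗[k] V) : TensorProduct.map LinearMap.id f (rightMul V g z) =
      rightMul W g (TensorProduct.map LinearMap.id f z) := by
  induction z with
  | zero => simp
  | add x y hx hy => simp only [map_add, hx, hy]
  | tmul h v => simp

theorem rightMul_eq_mul {A : Type*} [Ring A] [Algebra k A] (g : H) (z : H ⊗[k] A) :
    rightMul A g z = z * g ⊗ₜ 1 := by
  induction z with
  | zero => simp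
  | add x y hx hy => simp only [map_add, add_mul, hx, hy]
  | tmul h a => simp

variable (s : YDData k H V)

theorem tensorAct_one (h : H) :
    s.tensorAct h 1 = algebraMap k (TensorAlgebra k V) (Coalgebra.counit h) := by
  simp [tensorAct]

theorem tensorAct_algebraMap (h : H) (c : k) :
    s.tensorAct h (algebraMap k _ c) = algebraMap k _ (Coalgebra.counit h * c) := by
  rw [Algebra.algebraMap_eq_smul_one, map_smul, tensorAct_one, mul_comm, map_mul,
    Algebra.smul_def]

@[simp]
theorem tensorAct_ι (h : H) (v : V) :
    s.tensorAct h (TensorAlgebra.ι k v) = TensorAlgebra.ι k (s.act h v) := by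
  simp [tensorAct]

theorem tensorAct_mul (h : H) (x y : TensorAlgebra k V) :
    s.tensorAct h (x * y) = LinearMap.mul' k _
      (TensorProduct.map (s.tensorAct.flip x) (s.tensorAct.flip y) (Coalgebra.comul h)) := by
  simp only [tensorAct, LinearMap.flip_apply, LinearMap.coe_mk, AddHom.coe_mk, map_mul]
  rfl

theorem tensorAct_mul_comatrix {t : ι → ι → H} (ht : IsComatrix k t) (i j : ι)
    (x y : TensorAlgebra k V) :
    s.tensorAct (t i j) (x * y) = ∑ l, s.tensorAct (t i l) x * s.tensorAct (t l j) y := by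
  simp [tensorAct_mul, ht.comul, map_sum]

variable {s} in
theorem IsYetterDrinfeld.one_tensorAct (hs : s.IsYetterDrinfeld) (x : TensorAlgebra k V) :
    s.tensorAct 1 x = x := by
  induction x using TensorAlgebra.induction with
  | algebraMap r => simp [tensorAct_algebraMap]
  | ι v => simp [hs.one_act]
  | mul a b ha hb =>
    rw [tensorAct_mul, Bialgebra.comul_one, Algebra.TensorProduct.one_def]
    simp [ha, hb]
  | add a b ha hb => rw [map_add, ha, hb]

variable {s} in
theorem IsYetterDrinfeld.mul_tensorAct (hs : s.IsYetterDrinfeld) (g h : H)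
    (x : TensorAlgebra k V) : s.tensorAct (g * h) x = s.tensorAct g (s.tensorAct h x) := by
  suffices hx : ∀ (n : ℕ) (t : Fin n → Fin n → H), IsComatrix k t → ∀ (m : ℕ)
      (r : Fin m → Fin m → H), IsComatrix k r → ∀ i j i' j',
      s.tensorAct (t i j * r i' j') x = s.tensorAct (t i j) (s.tensorAct (r i' j') x) by
    have hlin : (LinearMap.mul k H).compr₂ (s.tensorAct.flip x) =
        s.tensorAct.compl₂ (s.tensorAct.flip x) :=
      linearMap_ext_comatrix fun n t ht i j => linearMap_ext_comatrix fun m r hr i' j' =>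
        hx n t ht m r hr i j i' j'
    exact LinearMap.congr_fun₂ hlin g h
  intro n t ht m r hr
  induction x using TensorAlgebra.induction with
  | algebraMap c => intros; simp only [tensorAct_algebraMap, Bialgebra.counit_mul, mul_assoc]
  | ι v => simp [hs.mul_act]
  | mul a b ha hb =>
    intro i j i' j'
    rw [tensorAct_mul, Bialgebra.comul_mul, ht.comul, hr.comul]
    simp only [Finset.sum_mul, Finset.mul_sum, map_sum, Algebra.TensorProduct.tmul_mul_tmul,
      TensorProduct.map_tmul, LinearMap.mul'_apply, LinearMap.flip_apply, ha, hb,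
      s.tensorAct_mul_comatrix hr, s.tensorAct_mul_comatrix ht]
  | add a b ha hb => intro i j i' j'; simp only [map_add, ha, hb]

/-- The coaction on `T(V)` as an algebra map. -/
def tensorCoactHom : TensorAlgebra k V →ₐ[k] H ⊗[k] TensorAlgebra k V :=
  TensorAlgebra.lift k (TensorProduct.map LinearMap.id (TensorAlgebra.ι k) ∘ₗ s.coact)

theorem tensorCoact_eq (x : TensorAlgebra k V) : s.tensorCoact x = s.tensorCoactHom x := rfl

theorem tensorCoact_mul (x y : TensorAlgebra k V) :
    s.tensorCoact (x * y) = s.tensorCoact x * s.tensorCoact y :=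
  map_mul s.tensorCoactHom x y

theorem tensorCoact_algebraMap (c : k) :
    s.tensorCoact (algebraMap k _ c) = 1 ⊗ₜ algebraMap k _ c := by
  rw [tensorCoact_eq, AlgHom.commutes, Algebra.TensorProduct.algebraMap_apply,
    Algebra.algebraMap_eq_smul_one, Algebra.algebraMap_eq_smul_one, TensorProduct.smul_tmul]

theorem tensorCoact_one : s.tensorCoact 1 = 1 ⊗ₜ 1 := map_one s.tensorCoactHom

theorem tensorCoact_ι (v : V) : s.tensorCoact (TensorAlgebra.ι k v) =
    TensorProduct.map LinearMap.id (TensorAlgebra.ι k) (s.coact v) := by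
  simp [tensorCoact]

variable {s} in
theorem tensorCoact_ι_of_coact {x : ι → V} {t : ι → ι → H} (hx : IsCoactionMatrix s.coact x t)
    (j : ι) : s.tensorCoact (TensorAlgebra.ι k (x j)) = ∑ i, t j i ⊗ₜ TensorAlgebra.ι k (x i) := by
  rw [tensorCoact_ι, hx.apply]
  simp [map_sum]

variable {s} in
theorem IsYetterDrinfeld.isCoaction_tensorCoact (hs : s.IsYetterDrinfeld) :
    IsCoaction s.tensorCoact where
  coassoc := by
    suffices h : ((Algebra.TensorProduct.assoc k k k H H (TensorAlgebra k V)).toAlgHom.comp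
        (Algebra.TensorProduct.map (Bialgebra.comulAlgHom k H) (AlgHom.id k _))).comp
          s.tensorCoactHom =
        (Algebra.TensorProduct.map (AlgHom.id k H) s.tensorCoactHom).comp s.tensorCoactHom from
      congrArg AlgHom.toLinearMap h
    refine TensorAlgebra.hom_ext (hs.isCoaction.linearMap_ext fun n x t hx j => ?_)
    simp only [LinearMap.comp_apply, AlgHom.toLinearMap_apply, AlgHom.comp_apply,
      ← tensorCoact_eq, tensorCoact_ι_of_coact hx, map_sum, Algebra.TensorProduct.map_tmul,
      Bialgebra.comulAlgHom_apply, hx.comul, TensorProduct.sum_tmul, AlgHom.id_apply,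
      TensorProduct.tmul_sum]
    rw [Finset.sum_comm]
    rfl
  counit := by
    suffices h : ((Algebra.TensorProduct.lid k (TensorAlgebra k V)).toAlgHom.comp
        (Algebra.TensorProduct.map (Bialgebra.counitAlgHom k H) (AlgHom.id k _))).comp
          s.tensorCoactHom = AlgHom.id k _ from congrArg AlgHom.toLinearMap h
    refine TensorAlgebra.hom_ext (hs.isCoaction.linearMap_ext fun n x t hx j => ?_)
    simp [← tensorCoact_eq, tensorCoact_ι_of_coact hx, map_sum, hx.counit]

section Compat

variable {s} (hs : s.IsYetterDrinfeld) {t : ι → ι → H} (ht : IsComatrix k t)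
include ht

theorem sum_map_mulLeft_tensorAct_mul (p q : ι) (z : H ⊗[k] TensorAlgebra k V) (g : H)
    (y : TensorAlgebra k V) :
    ∑ l, TensorProduct.map (LinearMap.mulLeft k (t p l)) (s.tensorAct (t l q)) (z * g ⊗ₜ y) =
      ∑ m, (∑ l, TensorProduct.map (LinearMap.mulLeft k (t p l)) (s.tensorAct (t l m)) z) *
        g ⊗ₜ s.tensorAct (t m q) y := by
  induction z with
  | zero => simp
  | add z z' hz hz' => simp only [map_add, add_mul, Finset.sum_add_distrib, hz, hz']
  | tmul h x =>
    simp only [TensorProduct.map_tmul, LinearMap.mulLeft_apply, Finset.sum_mul,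
      Algebra.TensorProduct.tmul_mul_tmul, s.tensorAct_mul_comatrix ht, TensorProduct.tmul_sum,
      mul_assoc]
    exact Finset.sum_comm

theorem tensorAct_compat_mul {x y : TensorAlgebra k V}
    (hx : ∀ p q, ∑ l, rightMul _ (t l q) (s.tensorCoact (s.tensorAct (t p l) x)) =
      ∑ l, TensorProduct.map (LinearMap.mulLeft k (t p l)) (s.tensorAct (t l q)) (s.tensorCoact x))
    (hy : ∀ p q, ∑ l, rightMul _ (t l q) (s.tensorCoact (s.tensorAct (t p l) y)) =
      ∑ l, TensorProduct.map (LinearMap.mulLeft k (t p l)) (s.tensorAct (t l q)) (s.tensorCoact y))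
    (p q : ι) :
    ∑ l, rightMul _ (t l q) (s.tensorCoact (s.tensorAct (t p l) (x * y))) =
      ∑ l, TensorProduct.map (LinearMap.mulLeft k (t p l)) (s.tensorAct (t l q))
        (s.tensorCoact (x * y)) := by
  have hpush (z : H ⊗[k] TensorAlgebra k V) :
      ∑ m, s.tensorCoact (s.tensorAct (t p m) x) *
          ∑ l, TensorProduct.map (LinearMap.mulLeft k (t m l)) (s.tensorAct (t l q)) z =
        ∑ l, TensorProduct.map (LinearMap.mulLeft k (t p l)) (s.tensorAct (t l q))
          (s.tensorCoact x * z) := by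
    induction z with
    | zero => simp
    | add z z' hz hz' => simp only [map_add, mul_add, Finset.sum_add_distrib, hz, hz']
    | tmul g y =>
      simp only [sum_map_mulLeft_tensorAct_mul ht, ← hx, rightMul_eq_mul, Finset.sum_mul,
        mul_assoc, Algebra.TensorProduct.tmul_mul_tmul, one_mul, TensorProduct.map_tmul,
        LinearMap.mulLeft_apply, Finset.mul_sum]
      exact Finset.sum_comm
  simp only [s.tensorAct_mul_comatrix ht, map_sum, tensorCoact_mul, ← hpush, ← hy, rightMul_eq_mul,
    Finset.mul_sum, mul_assoc]
  exact Finset.sum_comm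

include hs in
theorem IsYetterDrinfeld.tensorAct_compat_ι (p q : ι) (v : V) :
    ∑ l, rightMul _ (t l q) (s.tensorCoact (s.tensorAct (t p l) (TensorAlgebra.ι k v))) =
      ∑ l, TensorProduct.map (LinearMap.mulLeft k (t p l)) (s.tensorAct (t l q))
        (s.tensorCoact (TensorAlgebra.ι k v)) := by
  have hmap (h : H) (h' : H) (z : H ⊗[k] V) :
      TensorProduct.map (LinearMap.mulLeft k h) (s.tensorAct h')
          (TensorProduct.map LinearMap.id (TensorAlgebra.ι k) z) =
        TensorProduct.map LinearMap.id (TensorAlgebra.ι k)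
          (TensorProduct.map (LinearMap.mulLeft k h) (s.act h') z) := by
    induction z with
    | zero => simp
    | add x y hx hy => simp only [map_add, hx, hy]
    | tmul g w => simp
  have h := congrArg (TensorProduct.map LinearMap.id (TensorAlgebra.ι k)) (hs.compat ht p q v)
  simpa only [tensorAct_ι, tensorCoact_ι, hmap, map_sum, map_id_rightMul] using h

include hs in
theorem IsYetterDrinfeld.tensorAct_compat (p q : ι) (x : TensorAlgebra k V) :
    ∑ l, rightMul _ (t l q) (s.tensorCoact (s.tensorAct (t p l) x)) =
      ∑ l, TensorProduct.map (LinearMap.mulLeft k (t p l)) (s.tensorAct (t l q))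
        (s.tensorCoact x) := by
  induction x using TensorAlgebra.induction generalizing p q with
  | algebraMap c =>
    have hact (i j) : s.tensorAct (t i j) (algebraMap k _ c) =
        (if i = j then (1 : k) else 0) • algebraMap k (TensorAlgebra k V) c := by
      rw [tensorAct_algebraMap, ht.counit, map_mul, Algebra.smul_def]
    simp only [hact, map_smul, tensorCoact_algebraMap, TensorProduct.map_tmul]
    simp [TensorProduct.tmul_ite]
  | ι v => exact hs.tensorAct_compat_ι ht p q v
  | add a b ha hb => simp only [map_add, Finset.sum_add_distrib, ha, hb]
  | mul x y hx hy => exact tensorAct_compat_mul ht hx hy p q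

end Compat

@[simp]
theorem tensorHopf_act : s.tensorHopf.act = s.tensorAct := rfl

@[simp]
theorem tensorHopf_coact : s.tensorHopf.coact = s.tensorCoact := rfl

@[simp]
theorem tensorHopf_mul_tmul (x y : TensorAlgebra k V) : s.tensorHopf.mul (x ⊗ₜ y) = x * y := rfl

variable {s} in
theorem IsYetterDrinfeld.tensorHopf (hs : s.IsYetterDrinfeld) :
    s.tensorHopf.toYDData.IsYetterDrinfeld :=
  .of_compat hs.one_tensorAct hs.mul_tensorAct hs.isCoaction_tensorCoact
    fun _ _ ht => hs.tensorAct_compat ht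

end YDData

end TensorAlgebraYD

section TensorAlgebraComul

variable {k : Type*} {H : Type*} [Field k] [Ring H] [HopfAlgebra k H]
variable {ι : Type*} [Fintype ι] [DecidableEq ι]
variable {V : Type*} [AddCommGroup V] [Module k V]
variable {X : Type*} [AddCommGroup X] [Module k X]
variable {Y : Type*} [AddCommGroup Y] [Module k Y]

theorem IsCoaction.tensorAlgebra_intertwine {C : Type*} [AddCommGroup C] [Module k C]
    [Coalgebra k C] {δ : V →ₗ[k] C ⊗[k] V} (hδ : IsCoaction δ)
    {D : TensorAlgebra k V →ₐ[k] Module.End k X} {D' : TensorAlgebra k V →ₐ[k] Module.End k Y}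
    {A : X →ₗ[k] Y}
    (h : ∀ (n : ℕ) (x : Fin n → V) (t : Fin n → Fin n → C), IsCoactionMatrix δ x t →
      ∀ j z, A (D (TensorAlgebra.ι k (x j)) z) = D' (TensorAlgebra.ι k (x j)) (A z))
    (a : TensorAlgebra k V) (z : X) : A (D a z) = D' a (A z) := by
  induction a using TensorAlgebra.induction generalizing z with
  | algebraMap r => simp
  | ι v =>
    have hlin : A ∘ₗ (D.toLinearMap ∘ₗ TensorAlgebra.ι k).flip z =
        (D'.toLinearMap ∘ₗ TensorAlgebra.ι k).flip (A z) :=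
      hδ.linearMap_ext fun n x t hx j => h n x t hx j z
    exact LinearMap.congr_fun hlin v
  | mul a b ha hb => simp [ha, hb]
  | add a b ha hb => simp [ha, hb]

omit [DecidableEq ι] in
theorem tensorProduct_map_sum_right {Z W : Type*} [AddCommGroup Z] [Module k Z] [AddCommGroup W]
    [Module k W] (g : X →ₗ[k] Y) (f : ι → Z →ₗ[k] W) (z : X ⊗[k] Z) :
    TensorProduct.map g (∑ i, f i) z = ∑ i, TensorProduct.map g (f i) z := by
  induction z with
  | zero => simp
  | add z w hz hw => simp only [map_add, hz, hw, Finset.sum_add_distrib]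
  | tmul x z => simp only [TensorProduct.map_tmul, LinearMap.sum_apply, TensorProduct.tmul_sum]

namespace YDData

theorem coactMul_rightMul (f : X →ₗ[k] Y) (g : H) (z : H ⊗[k] V) (w : H ⊗[k] X) :
    coactMul V Y (z ⊗ₜ TensorProduct.map (LinearMap.mulLeft k g) f w) =
      TensorProduct.map LinearMap.id (TensorProduct.map LinearMap.id f)
        (coactMul V X (rightMul V g z ⊗ₜ w)) := by
  induction z with
  | zero => simp
  | add x y hx hy => simp only [map_add, TensorProduct.add_tmul, hx, hy]
  | tmul h v =>
    induction w with
    | zero => simp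
    | add x y hx hy => simp only [map_add, TensorProduct.tmul_add, hx, hy]
    | tmul h' x => simp [mul_assoc]

theorem coactMul_map_mulLeft (f : V →ₗ[k] Y) (g : H) (z : H ⊗[k] V) (w : H ⊗[k] X) :
    coactMul Y X (TensorProduct.map (LinearMap.mulLeft k g) f z ⊗ₜ w) =
      TensorProduct.map (LinearMap.mulLeft k g) (TensorProduct.map f LinearMap.id)
        (coactMul V X (z ⊗ₜ w)) := by
  induction z with
  | zero => simp
  | add x y hx hy => simp only [map_add, TensorProduct.add_tmul, hx, hy]
  | tmul h v =>
    induction w with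
    | zero => simp
    | add x y hx hy => simp only [map_add, TensorProduct.tmul_add, hx, hy]
    | tmul h' x => simp [mul_assoc]

variable (s : YDData k H V)

theorem tensorAlgebra_covariant {t : ι → ι → H} (ht : IsComatrix k t)
    {D : TensorAlgebra k V →ₐ[k] Module.End k X} {ρ : H →ₗ[k] Module.End k X}
    (h : ∀ v z p q, ρ (t p q) (D (TensorAlgebra.ι k v) z) =
      ∑ l, D (TensorAlgebra.ι k (s.act (t p l) v)) (ρ (t l q) z))
    (x : TensorAlgebra k V) (z : X) (p q : ι) :
    ρ (t p q) (D x z) = ∑ l, D (s.tensorAct (t p l) x) (ρ (t l q) z) := by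
  induction x using TensorAlgebra.induction generalizing z p q with
  | algebraMap r =>
    simp only [tensorAct_algebraMap, AlgHom.commutes, ht.counit]
    rw [Finset.sum_eq_single p] <;> simp +contextual [eq_comm]
  | ι v => simp [h]
  | mul a b ha hb =>
    simp only [map_mul, Module.End.mul_apply, ha, hb, s.tensorAct_mul_comatrix ht, map_sum,
      LinearMap.sum_apply]
    exact Finset.sum_comm
  | add a b ha hb => simp [ha, hb, Finset.sum_add_distrib]

/-- For an action `D` of `T(V)` on `X`, the action `x ↦ x₍₋₁₎ ⊗ D(x₍₀₎)` on `H ⊗ X`; a coaction of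
`H` on `X` is compatible with `D` when it intertwines these actions. -/
def coactEnd (D : TensorAlgebra k V →ₐ[k] Module.End k X) :
    TensorAlgebra k V →ₐ[k] Module.End k (H ⊗[k] X) :=
  (Module.endTensorEndAlgHom (R := k) (A := k) (S := k) (M := H) (N := X)).comp <|
    (Algebra.TensorProduct.map (Algebra.lmul k H) D).comp s.tensorCoactHom

variable {s} in
theorem coactEnd_ι_of_coact {x : ι → V} {t : ι → ι → H} (hx : IsCoactionMatrix s.coact x t)
    (D : TensorAlgebra k V →ₐ[k] Module.End k X) (j : ι) :
    s.coactEnd D (TensorAlgebra.ι k (x j)) =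
      ∑ i, TensorProduct.map (LinearMap.mulLeft k (t j i)) (D (TensorAlgebra.ι k (x i))) := by
  simp only [coactEnd, AlgHom.comp_apply, ← tensorCoact_eq, tensorCoact_ι_of_coact hx, map_sum,
    Algebra.TensorProduct.map_tmul]
  rfl

theorem coactEnd_one_tmul (D : TensorAlgebra k V →ₐ[k] Module.End k X) (x : TensorAlgebra k V)
    (z : X) : s.coactEnd D x (1 ⊗ₜ z) =
      TensorProduct.map LinearMap.id (D.toLinearMap.flip z) (s.tensorCoact x) := by
  simp only [coactEnd, AlgHom.comp_apply, ← tensorCoact_eq]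
  generalize s.tensorCoact x = y
  induction y with
  | zero => simp
  | add x y hx hy => simp only [map_add, LinearMap.add_apply, hx, hy]
  | tmul h x =>
    change (h * 1) ⊗ₜ D x z = h ⊗ₜ D x z
    rw [mul_one]

theorem coactEnd_lmul (x : TensorAlgebra k V) (z : H ⊗[k] TensorAlgebra k V) :
    s.coactEnd (Algebra.lmul k _) x z = s.tensorCoact x * z := by
  simp only [coactEnd, AlgHom.comp_apply, ← tensorCoact_eq]
  generalize s.tensorCoact x = y
  induction y with
  | zero => simp
  | add x y hx hy => simp only [map_add, LinearMap.add_apply, add_mul, hx, hy]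
  | tmul h x =>
    induction z with
    | zero => simp
    | add z w hz hw => simp only [map_add, mul_add, hz, hw]
    | tmul g y => exact (Algebra.TensorProduct.tmul_mul_tmul h g x y).symm

/-- For an action `D` of `T(V)` on `X`, the operators `a ⊗ z ↦ h · a ⊗ D(v)z` on `T(V) ⊗ X`. -/
def actMul (D : TensorAlgebra k V →ₐ[k] Module.End k X) :
    H ⊗[k] V →ₗ[k] Module.End k (TensorAlgebra k V ⊗[k] X) :=
  TensorProduct.homTensorHomMap (RingHom.id k) _ _ _ _ ∘ₗ
    TensorProduct.map s.tensorAct (D.toLinearMap ∘ₗ TensorAlgebra.ι k)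

theorem actMul_tmul (D : TensorAlgebra k V →ₐ[k] Module.End k X) (h : H) (v : V) :
    s.actMul D (h ⊗ₜ v) = TensorProduct.map (s.tensorAct h) (D (TensorAlgebra.ι k v)) := rfl

/-- For an action `D` of `T(V)` on `X`, the braided diagonal action of `T(V)` on `T(V) ⊗ X`, in
which `v` acts by `a ⊗ z ↦ va ⊗ z + v₍₋₁₎ · a ⊗ D(v₍₀₎)z`. -/
def tensorEnd (D : TensorAlgebra k V →ₐ[k] Module.End k X) :
    TensorAlgebra k V →ₐ[k] Module.End k (TensorAlgebra k V ⊗[k] X) :=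
  TensorAlgebra.lift k <|
    (TensorProduct.mapBilinear (RingHom.id k) _ _ _ _).flip LinearMap.id ∘ₗ
      LinearMap.mul k (TensorAlgebra k V) ∘ₗ TensorAlgebra.ι k + s.actMul D ∘ₗ s.coact

theorem tensorEnd_ι (D : TensorAlgebra k V →ₐ[k] Module.End k X) (v : V) :
    s.tensorEnd D (TensorAlgebra.ι k v) =
      TensorProduct.map (LinearMap.mulLeft k (TensorAlgebra.ι k v)) LinearMap.id +
        s.actMul D (s.coact v) :=
  TensorAlgebra.lift_ι_apply _ _

variable {s} in
theorem tensorEnd_ι_of_coact {x : ι → V} {t : ι → ι → H} (hx : IsCoactionMatrix s.coact x t)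
    (D : TensorAlgebra k V →ₐ[k] Module.End k X) (j : ι) :
    s.tensorEnd D (TensorAlgebra.ι k (x j)) =
      TensorProduct.map (LinearMap.mulLeft k (TensorAlgebra.ι k (x j))) LinearMap.id +
        ∑ i, TensorProduct.map (s.tensorAct (t j i)) (D (TensorAlgebra.ι k (x i))) := by
  simp only [tensorEnd_ι, hx.apply, map_sum, actMul_tmul]

/-- The action of `T(V)` on `T(V) ⊗ T(V)` by left multiplication with the coproduct. -/
def comulEnd : TensorAlgebra k V →ₐ[k] Module.End k (TensorAlgebra k V ⊗[k] TensorAlgebra k V) :=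
  s.tensorEnd (Algebra.lmul k (TensorAlgebra k V))

theorem tensorComul_eq (x : TensorAlgebra k V) : s.tensorComul x = s.comulEnd x (1 ⊗ₜ 1) := rfl

theorem tensorComul_mul' (x y : TensorAlgebra k V) :
    s.tensorComul (x * y) = s.comulEnd x (s.tensorComul y) := by
  simp [tensorComul_eq]

@[simp]
theorem tensorComul_one : s.tensorComul 1 = 1 ⊗ₜ 1 := by simp [tensorComul_eq]

variable {s} in
theorem comulEnd_ι_of_coact {x : ι → V} {t : ι → ι → H} (hx : IsCoactionMatrix s.coact x t)
    (j : ι) (a c : TensorAlgebra k V) :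
    s.comulEnd (TensorAlgebra.ι k (x j)) (a ⊗ₜ c) =
      (TensorAlgebra.ι k (x j) * a) ⊗ₜ c +
        ∑ i, s.tensorAct (t j i) a ⊗ₜ (TensorAlgebra.ι k (x i) * c) := by
  simp [comulEnd, tensorEnd_ι_of_coact hx, LinearMap.sum_apply]

theorem tensor_act_one_tmul_one (h : H) :
    (s.tensorHopf.tensor s.tensorHopf.toYDData).act h (1 ⊗ₜ 1) =
      Coalgebra.counit (R := k) h • 1 ⊗ₜ 1 := by
  suffices hlin : (s.tensorHopf.tensor s.tensorHopf.toYDData).act.flip (1 ⊗ₜ 1) =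
      (Coalgebra.counit (R := k) (A := H)).smulRight (1 ⊗ₜ 1) from LinearMap.congr_fun hlin h
  refine linearMap_ext_comatrix fun n t ht p q => ?_
  simp only [LinearMap.flip_apply, tensor_act_tmul _ _ ht, tensorHopf_act, tensorAct_one,
    ht.counit, LinearMap.smulRight_apply]
  rw [Finset.sum_eq_single p] <;> simp +contextual [eq_comm, TensorProduct.tmul_ite]

section Covariance

variable {s} (hs : s.IsYetterDrinfeld) {t : ι → ι → H} (ht : IsComatrix k t)
include hs

theorem IsYetterDrinfeld.actMul_act (D : TensorAlgebra k V →ₐ[k] Module.End k X) (h : H)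
    (z : H ⊗[k] V) (a : TensorAlgebra k V) (c : X) :
    s.actMul D z (s.tensorAct h a ⊗ₜ c) = s.actMul D (rightMul V h z) (a ⊗ₜ c) := by
  induction z with
  | zero => simp
  | add x y hx hy => simp only [map_add, LinearMap.add_apply, hx, hy]
  | tmul g v => simp [actMul_tmul, hs.mul_tensorAct]

variable {r : YDData k H X} {D : TensorAlgebra k V →ₐ[k] Module.End k X}
  (hD : ∀ v z p q, r.act (t p q) (D (TensorAlgebra.ι k v) z) =
    ∑ l, D (TensorAlgebra.ι k (s.act (t p l) v)) (r.act (t l q) z))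
include ht hD

theorem IsYetterDrinfeld.tensor_act_actMul (p q : ι) (z : H ⊗[k] V) (a : TensorAlgebra k V)
    (c : X) :
    (s.tensorHopf.tensor r).act (t p q) (s.actMul D z (a ⊗ₜ c)) =
      ∑ m, s.actMul D (∑ l, TensorProduct.map (LinearMap.mulLeft k (t p l)) (s.act (t l m)) z)
        (a ⊗ₜ r.act (t m q) c) := by
  induction z with
  | zero => simp
  | add x y hx hy => simp only [map_add, LinearMap.add_apply, Finset.sum_add_distrib, hx, hy]
  | tmul g v =>
    simp only [actMul_tmul, TensorProduct.map_tmul, tensor_act_tmul _ _ ht, tensorHopf_act, hD,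
      TensorProduct.tmul_sum, map_sum, LinearMap.sum_apply, LinearMap.mulLeft_apply,
      hs.mul_tensorAct]
    exact Finset.sum_comm

theorem IsYetterDrinfeld.tensorEnd_covariant (x : TensorAlgebra k V)
    (z : TensorAlgebra k V ⊗[k] X) (p q : ι) :
    (s.tensorHopf.tensor r).act (t p q) (s.tensorEnd D x z) =
      ∑ l, s.tensorEnd D (s.tensorAct (t p l) x) ((s.tensorHopf.tensor r).act (t l q) z) := by
  refine s.tensorAlgebra_covariant ht (ρ := (s.tensorHopf.tensor r).act) ?_ x z p q
  intro v z p q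
  induction z with
  | zero => simp
  | add x y hx hy => simp only [map_add, hx, hy, Finset.sum_add_distrib]
  | tmul a c =>
    have hmul : (s.tensorHopf.tensor r).act (t p q) ((TensorAlgebra.ι k v * a) ⊗ₜ c) =
        ∑ l, ∑ m, (TensorAlgebra.ι k (s.act (t p l) v) * s.tensorAct (t l m) a) ⊗ₜ[k]
          r.act (t m q) c := by
      simp only [tensor_act_tmul _ _ ht, tensorHopf_act, s.tensorAct_mul_comatrix ht, tensorAct_ι,
        TensorProduct.sum_tmul]
      exact Finset.sum_comm
    have hact : (s.tensorHopf.tensor r).act (t p q) (s.actMul D (s.coact v) (a ⊗ₜ c)) =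
        ∑ l, ∑ m, s.actMul D (s.coact (s.act (t p l) v))
          (s.tensorAct (t l m) a ⊗ₜ r.act (t m q) c) := by
      rw [hs.tensor_act_actMul ht hD, Finset.sum_comm]
      simp only [hs.actMul_act, ← hs.compat ht, map_sum, LinearMap.sum_apply]
    simp only [tensorEnd_ι, LinearMap.add_apply, map_add, TensorProduct.map_tmul,
      LinearMap.mulLeft_apply, LinearMap.id_apply, hmul, hact, Finset.sum_add_distrib]
    simp only [tensor_act_tmul _ _ ht, map_sum, TensorProduct.map_tmul, LinearMap.mulLeft_apply,
      LinearMap.id_apply, tensorHopf_act]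

end Covariance

variable {s} (hs : s.IsYetterDrinfeld)
include hs

theorem IsYetterDrinfeld.tensorComul_act (h : H) (x : TensorAlgebra k V) :
    s.tensorComul (s.tensorAct h x) =
      (s.tensorHopf.tensor s.tensorHopf.toYDData).act h (s.tensorComul x) := by
  suffices hlin : s.tensorComul ∘ₗ s.tensorAct.flip x =
      (s.tensorHopf.tensor s.tensorHopf.toYDData).act.flip (s.tensorComul x) from
    LinearMap.congr_fun hlin h
  refine linearMap_ext_comatrix fun n t ht p q => ?_
  have hD (v : V) (z : TensorAlgebra k V) (p q) :
      s.tensorHopf.act (t p q) (Algebra.lmul k _ (TensorAlgebra.ι k v) z) =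
        ∑ l, Algebra.lmul k _ (TensorAlgebra.ι k (s.act (t p l) v))
          (s.tensorHopf.act (t l q) z) := by
    simp [s.tensorAct_mul_comatrix ht]
  simp only [LinearMap.comp_apply, LinearMap.flip_apply, tensorComul_eq, comulEnd,
    hs.tensorEnd_covariant ht hD, tensor_act_one_tmul_one, ht.counit, map_smul]
  simp

omit hs in
theorem tensorCoact_ι_mul_of_coact {x : ι → V} {t : ι → ι → H}
    (hx : IsCoactionMatrix s.coact x t) (j : ι) (a : TensorAlgebra k V) :
    s.tensorCoact (TensorAlgebra.ι k (x j) * a) =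
      ∑ i, TensorProduct.map (LinearMap.mulLeft k (t j i))
        (LinearMap.mulLeft k (TensorAlgebra.ι k (x i))) (s.tensorCoact a) := by
  rw [tensorCoact_mul, ← coactEnd_lmul, coactEnd_ι_of_coact hx, LinearMap.sum_apply]
  rfl

omit hs in
theorem coactEnd_tensorEnd_ι_of_coact {x : ι → V} {t : ι → ι → H}
    (hx : IsCoactionMatrix s.coact x t) (D : TensorAlgebra k V →ₐ[k] Module.End k X) (j : ι)
    (z : H ⊗[k] (TensorAlgebra k V ⊗[k] X)) :
    s.coactEnd (s.tensorEnd D) (TensorAlgebra.ι k (x j)) z =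
      ∑ i, TensorProduct.map (LinearMap.mulLeft k (t j i))
          (TensorProduct.map (LinearMap.mulLeft k (TensorAlgebra.ι k (x i))) LinearMap.id) z +
        ∑ i, ∑ l, TensorProduct.map (LinearMap.mulLeft k (t j i))
          (TensorProduct.map (s.tensorAct (t i l)) (D (TensorAlgebra.ι k (x l)))) z := by
  rw [coactEnd_ι_of_coact hx, LinearMap.sum_apply, ← Finset.sum_add_distrib]
  refine Finset.sum_congr rfl fun i _ => ?_
  rw [tensorEnd_ι_of_coact hx, TensorProduct.map_add_right, LinearMap.add_apply,
    tensorProduct_map_sum_right]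

theorem IsYetterDrinfeld.tensorEnd_coact {r : YDData k H X}
    {D : TensorAlgebra k V →ₐ[k] Module.End k X}
    (hD : ∀ v z, r.coact (D (TensorAlgebra.ι k v) z) =
      s.coactEnd D (TensorAlgebra.ι k v) (r.coact z))
    (x : TensorAlgebra k V) (z : TensorAlgebra k V ⊗[k] X) :
    (s.tensorHopf.tensor r).coact (s.tensorEnd D x z) =
      s.coactEnd (s.tensorEnd D) x ((s.tensorHopf.tensor r).coact z) := by
  refine hs.isCoaction.tensorAlgebra_intertwine (fun n x t hx j z => ?_) x z
  induction z with
  | zero => simp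
  | add x y hx hy => simp only [map_add, hx, hy]
  | tmul a c =>
    have hcomp (i l) (z : H ⊗[k] (TensorAlgebra k V ⊗[k] X)) :
        TensorProduct.map LinearMap.id
            (TensorProduct.map LinearMap.id (D (TensorAlgebra.ι k (x l))))
          (TensorProduct.map (LinearMap.mulLeft k (t j i))
            (TensorProduct.map (s.tensorAct (t i l)) LinearMap.id) z) =
        TensorProduct.map (LinearMap.mulLeft k (t j i))
          (TensorProduct.map (s.tensorAct (t i l)) (D (TensorAlgebra.ι k (x l)))) z := by
      rw [← LinearMap.comp_apply, ← TensorProduct.map_comp, ← TensorProduct.map_comp]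
      rfl
    rw [coactEnd_tensorEnd_ι_of_coact hx, tensorEnd_ι_of_coact hx]
    simp only [LinearMap.add_apply, LinearMap.sum_apply, TensorProduct.map_tmul, map_add, map_sum,
      tensor_coact_tmul, LinearMap.mulLeft_apply, LinearMap.id_apply, tensorHopf_coact,
      tensorCoact_ι_mul_of_coact hx, TensorProduct.sum_tmul, coactMul_map_mulLeft]
    congr 1
    simp only [hD, coactEnd_ι_of_coact hx, LinearMap.sum_apply, TensorProduct.tmul_sum, map_sum,
      coactMul_rightMul]
    rw [Finset.sum_comm]
    conv_rhs => rw [Finset.sum_comm]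
    refine Finset.sum_congr rfl fun l _ => ?_
    simp only [← map_sum, ← TensorProduct.sum_tmul, hs.tensorAct_compat hx.toIsComatrix]
    simp only [map_sum, TensorProduct.sum_tmul, coactMul_map_mulLeft, hcomp]

theorem IsYetterDrinfeld.tensorComul_coact (x : TensorAlgebra k V) :
    (s.tensorHopf.tensor s.tensorHopf.toYDData).coact (s.tensorComul x) =
      TensorProduct.map LinearMap.id s.tensorComul (s.tensorCoact x) := by
  have hmul (v : V) (z : TensorAlgebra k V) :
      s.tensorHopf.coact (Algebra.lmul k _ (TensorAlgebra.ι k v) z) =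
        s.coactEnd (Algebra.lmul k _) (TensorAlgebra.ι k v) (s.tensorHopf.coact z) := by
    simp [tensorCoact_mul, coactEnd_lmul]
  rw [tensorComul_eq, comulEnd, hs.tensorEnd_coact hmul, tensor_coact_tmul, tensorHopf_coact,
    tensorCoact_one, coactMul_tmul, mul_one, coactEnd_one_tmul]
  rfl

omit hs in
theorem map_mul_middle_tmul (a a' c c' : TensorAlgebra k V) :
    TensorProduct.map s.tensorHopf.mul s.tensorHopf.mul
        (middle (s.tensorHopf.braiding s.tensorHopf.toYDData) ((a ⊗ₜ a') ⊗ₜ (c ⊗ₜ c'))) =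
      TensorProduct.map (LinearMap.mulLeft k a ∘ₗ s.tensorAct.flip c) (LinearMap.mulRight k c')
        (s.tensorCoact a') := by
  change TensorProduct.map s.tensorHopf.mul s.tensorHopf.mul
      ((TensorProduct.assoc k _ _ _).symm (a ⊗ₜ TensorProduct.assoc k _ _ _
        (s.tensorHopf.braidingAux _ (s.tensorCoact a' ⊗ₜ c) ⊗ₜ c'))) = _
  generalize s.tensorCoact a' = y
  induction y with
  | zero => simp
  | add x y hx hy => simp only [TensorProduct.add_tmul, TensorProduct.tmul_add, map_add, hx, hy]
  | tmul h d => rfl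

theorem IsYetterDrinfeld.comulEnd_middle (x : TensorAlgebra k V)
    (w z : TensorAlgebra k V ⊗[k] TensorAlgebra k V) :
    TensorProduct.map s.tensorHopf.mul s.tensorHopf.mul
        (middle (s.tensorHopf.braiding s.tensorHopf.toYDData) (s.comulEnd x w ⊗ₜ z)) =
      s.comulEnd x (TensorProduct.map s.tensorHopf.mul s.tensorHopf.mul
        (middle (s.tensorHopf.braiding s.tensorHopf.toYDData) (w ⊗ₜ z))) := by
  refine hs.isCoaction.tensorAlgebra_intertwine
    (A := TensorProduct.map s.tensorHopf.mul s.tensorHopf.mul ∘ₗ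
      middle (s.tensorHopf.braiding s.tensorHopf.toYDData) ∘ₗ (TensorProduct.mk k _ _).flip z)
    (fun n x t hx j w => ?_) x w
  simp only [LinearMap.comp_apply, LinearMap.flip_apply, TensorProduct.mk_apply]
  induction z with
  | zero => simp
  | add x y hx hy => simp only [TensorProduct.tmul_add, map_add, hx, hy]
  | tmul c c' =>
    induction w with
    | zero => simp
    | add x y hx hy => simp only [TensorProduct.add_tmul, map_add, hx, hy]
    | tmul a a' =>
      simp only [comulEnd_ι_of_coact hx, TensorProduct.add_tmul, TensorProduct.sum_tmul, map_add,
        map_sum, map_mul_middle_tmul, tensorCoact_ι_mul_of_coact hx]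
      generalize s.tensorCoact a' = y
      induction y with
      | zero => simp
      | add y z hy hz =>
        simp only [map_add, Finset.sum_add_distrib, ← hy, ← hz]
        abel
      | tmul h d =>
        simp only [TensorProduct.map_tmul, LinearMap.comp_apply, LinearMap.mulLeft_apply,
          LinearMap.flip_apply, LinearMap.mulRight_apply, comulEnd_ι_of_coact hx,
          hs.mul_tensorAct, s.tensorAct_mul_comatrix hx.toIsComatrix, TensorProduct.sum_tmul,
          mul_assoc]
        rw [Finset.sum_comm]

theorem IsYetterDrinfeld.tensorComul_mul (x y : TensorAlgebra k V) :
    s.tensorComul (x * y) = TensorProduct.map s.tensorHopf.mul s.tensorHopf.mul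
        (middle (s.tensorHopf.braiding s.tensorHopf.toYDData)
          (s.tensorComul x ⊗ₜ s.tensorComul y)) := by
  rw [tensorComul_mul', s.tensorComul_eq x, hs.comulEnd_middle]
  congr 1
  generalize s.tensorComul y = z
  induction z with
  | zero => simp
  | add x y hx hy => simp only [TensorProduct.tmul_add, map_add, ← hx, ← hy]
  | tmul c c' => simp [map_mul_middle_tmul, tensorCoact_one, hs.one_tensorAct]

variable (s) in
omit hs in
/-- The action of `T(V)` on `T(V) ⊗ T(V) ⊗ T(V)` by left multiplication with the iterated
coproduct. -/
def comulEnd₃ : TensorAlgebra k V →ₐ[k]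
    Module.End k (TensorAlgebra k V ⊗[k] (TensorAlgebra k V ⊗[k] TensorAlgebra k V)) :=
  s.tensorEnd s.comulEnd

omit hs in
theorem comulEnd₃_ι_of_coact {x : ι → V} {t : ι → ι → H} (hx : IsCoactionMatrix s.coact x t)
    (j : ι) (a : TensorAlgebra k V) (z : TensorAlgebra k V ⊗[k] TensorAlgebra k V) :
    s.comulEnd₃ (TensorAlgebra.ι k (x j)) (a ⊗ₜ z) =
      (TensorAlgebra.ι k (x j) * a) ⊗ₜ z +
        ∑ i, s.tensorAct (t j i) a ⊗ₜ s.comulEnd (TensorAlgebra.ι k (x i)) z := by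
  simp [comulEnd₃, tensorEnd_ι_of_coact hx, LinearMap.sum_apply]

theorem IsYetterDrinfeld.comulEnd₃_left (x : TensorAlgebra k V)
    (z : TensorAlgebra k V ⊗[k] TensorAlgebra k V) :
    TensorProduct.assoc k _ _ _ (TensorProduct.map s.tensorComul LinearMap.id (s.comulEnd x z)) =
      s.comulEnd₃ x
        (TensorProduct.assoc k _ _ _ (TensorProduct.map s.tensorComul LinearMap.id z)) := by
  refine hs.isCoaction.tensorAlgebra_intertwine
    (A := (TensorProduct.assoc k _ _ _).toLinearMap ∘ₗ
      TensorProduct.map s.tensorComul LinearMap.id) (fun n x t hx j z => ?_) x z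
  simp only [LinearMap.comp_apply, LinearEquiv.coe_coe]
  induction z with
  | zero => simp
  | add x y hx hy => simp only [map_add, hx, hy]
  | tmul a c =>
    simp only [comulEnd_ι_of_coact hx, map_add, map_sum, TensorProduct.map_tmul, tensorComul_mul',
      hs.tensorComul_act, LinearMap.id_apply]
    generalize s.tensorComul a = y
    induction y with
    | zero => simp
    | add y z hy hz =>
      simp only [TensorProduct.add_tmul, map_add, Finset.sum_add_distrib, ← hy, ← hz]
      abel
    | tmul d d' =>
      simp only [comulEnd_ι_of_coact hx, tensor_act_tmul _ _ hx.toIsComatrix, tensorHopf_act,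
        TensorProduct.add_tmul, TensorProduct.sum_tmul, map_add, map_sum, TensorProduct.assoc_tmul,
        comulEnd₃_ι_of_coact hx, TensorProduct.tmul_add, TensorProduct.tmul_sum,
        Finset.sum_add_distrib, add_assoc]
      congr 2
      exact Finset.sum_comm

theorem IsYetterDrinfeld.comulEnd₃_right (x : TensorAlgebra k V)
    (z : TensorAlgebra k V ⊗[k] TensorAlgebra k V) :
    TensorProduct.map LinearMap.id s.tensorComul (s.comulEnd x z) =
      s.comulEnd₃ x (TensorProduct.map LinearMap.id s.tensorComul z) := by
  refine hs.isCoaction.tensorAlgebra_intertwine (fun n x t hx j z => ?_) x z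
  induction z with
  | zero => simp
  | add x y hx hy => simp only [map_add, hx, hy]
  | tmul a c =>
    simp only [comulEnd_ι_of_coact hx, map_add, map_sum, TensorProduct.map_tmul, tensorComul_mul',
      LinearMap.id_apply, comulEnd₃_ι_of_coact hx]

theorem IsYetterDrinfeld.tensorComul_coassoc (x : TensorAlgebra k V) :
    TensorProduct.assoc k _ _ _ (TensorProduct.map s.tensorComul LinearMap.id (s.tensorComul x)) =
      TensorProduct.map LinearMap.id s.tensorComul (s.tensorComul x) := by
  rw [tensorComul_eq, hs.comulEnd₃_left, hs.comulEnd₃_right]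
  simp

end YDData

end TensorAlgebraComul

section TensorAlgebraAntipode

variable {k : Type*} {H : Type*} [Field k] [Ring H] [HopfAlgebra k H]
variable {ι : Type*} [Fintype ι] [DecidableEq ι]
variable {V : Type*} [AddCommGroup V] [Module k V]

@[simp]
theorem algebraMapInv_ι (v : V) :
    TensorAlgebra.algebraMapInv (R := k) (TensorAlgebra.ι k v) = 0 := by
  simp [TensorAlgebra.algebraMapInv]

namespace YDData

variable (s : YDData k H V)

theorem algebraMapInv_tensorAct (h : H) (x : TensorAlgebra k V) :
    TensorAlgebra.algebraMapInv (s.tensorAct h x) =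
      Coalgebra.counit (R := k) h * TensorAlgebra.algebraMapInv x := by
  suffices hlin : TensorAlgebra.algebraMapInv.toLinearMap ∘ₗ s.tensorAct.flip x =
      LinearMap.mulRight k (TensorAlgebra.algebraMapInv x) ∘ₗ Coalgebra.counit from
    LinearMap.congr_fun hlin h
  refine linearMap_ext_comatrix fun n t ht p q => ?_
  simp only [LinearMap.comp_apply, LinearMap.flip_apply, AlgHom.toLinearMap_apply,
    LinearMap.mulRight_apply]
  induction x using TensorAlgebra.induction generalizing p q with
  | algebraMap r => simp [tensorAct_algebraMap, TensorAlgebra.algebraMapInv]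
  | ι v => simp
  | mul a b ha hb =>
    simp only [s.tensorAct_mul_comatrix ht, map_sum, map_mul, ha, hb, ht.counit]
    rw [Finset.sum_eq_single p] <;> simp +contextual [eq_comm]
  | add a b ha hb => simp only [map_add, ha, hb, mul_add]

theorem map_algebraMapInv_tensorCoact (x : TensorAlgebra k V) :
    TensorProduct.map LinearMap.id (TensorAlgebra.algebraMapInv (R := k)).toLinearMap
      (s.tensorCoact x) = 1 ⊗ₜ TensorAlgebra.algebraMapInv x := by
  have hcomp : (Algebra.TensorProduct.map (AlgHom.id k H) TensorAlgebra.algebraMapInv).comp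
      s.tensorCoactHom = Algebra.TensorProduct.includeRight.comp TensorAlgebra.algebraMapInv := by
    refine TensorAlgebra.hom_ext (LinearMap.ext fun v => ?_)
    simp only [LinearMap.comp_apply, AlgHom.toLinearMap_apply, AlgHom.comp_apply,
      ← tensorCoact_eq, tensorCoact_ι, algebraMapInv_ι, map_zero]
    generalize s.coact v = z
    induction z with
    | zero => simp
    | add x y hx hy => simp only [map_add, hx, hy, add_zero]
    | tmul g v => simp
  exact DFunLike.congr_fun hcomp x

/-- The action of `T(V)` on itself by which the antipode is computed: `S(xy) = x · S(y)`. -/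
def antipodeEnd : TensorAlgebra k V →ₐ[k] Module.End k (TensorAlgebra k V) :=
  TensorAlgebra.lift k s.antipodeStep

theorem tensorAntipode_eq (x : TensorAlgebra k V) : s.tensorAntipode x = s.antipodeEnd x 1 := rfl

theorem tensorAntipode_mul' (x y : TensorAlgebra k V) :
    s.tensorAntipode (x * y) = s.antipodeEnd x (s.tensorAntipode y) := by
  simp [tensorAntipode_eq]

@[simp]
theorem tensorAntipode_one : s.tensorAntipode 1 = 1 := by simp [tensorAntipode_eq]

/-- The linear map `h ⊗ v ↦ (h · y) v`, in terms of which `S(vx) = -(v₍₋₁₎ · S(x)) v₍₀₎`. -/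
def actMulRight (y : TensorAlgebra k V) : H ⊗[k] V →ₗ[k] TensorAlgebra k V :=
  LinearMap.mul' k _ ∘ₗ TensorProduct.map (s.tensorAct.flip y) (TensorAlgebra.ι k)

@[simp]
theorem actMulRight_tmul (y : TensorAlgebra k V) (h : H) (v : V) :
    s.actMulRight y (h ⊗ₜ v) = s.tensorAct h y * TensorAlgebra.ι k v := rfl

theorem antipodeStep_apply (v : V) (y : TensorAlgebra k V) :
    s.antipodeStep v y = -s.actMulRight y (s.coact v) := by
  simp only [antipodeStep, LinearMap.neg_apply, LinearMap.comp_apply]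
  congr 1
  generalize s.coact v = z
  induction z with
  | zero => simp
  | add x y hx hy => simp only [map_add, LinearMap.add_apply, hx, hy]
  | tmul g v => simp

theorem antipodeEnd_ι (v : V) (y : TensorAlgebra k V) :
    s.antipodeEnd (TensorAlgebra.ι k v) y = -s.actMulRight y (s.coact v) := by
  simp [antipodeEnd, antipodeStep_apply]

variable {s}

theorem antipodeEnd_ι_of_coact {x : ι → V} {t : ι → ι → H} (hx : IsCoactionMatrix s.coact x t)
    (j : ι) (y : TensorAlgebra k V) :
    s.antipodeEnd (TensorAlgebra.ι k (x j)) y =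
      -∑ i, s.tensorAct (t j i) y * TensorAlgebra.ι k (x i) := by
  simp [antipodeEnd_ι, hx.apply, map_sum]

variable (hs : s.IsYetterDrinfeld)
include hs

theorem IsYetterDrinfeld.tensorComul_counit (x : TensorAlgebra k V) :
    TensorProduct.rid k _ (TensorProduct.map LinearMap.id
      (TensorAlgebra.algebraMapInv (R := k)).toLinearMap (s.tensorComul x)) = x := by
  have hlmul := hs.isCoaction.tensorAlgebra_intertwine (D := s.comulEnd)
    (D' := Algebra.lmul k (TensorAlgebra k V)) (A := (TensorProduct.rid k _).toLinearMap ∘ₗ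
      TensorProduct.map LinearMap.id (TensorAlgebra.algebraMapInv (R := k)).toLinearMap)
    (fun n x t hx j z => ?_) x (1 ⊗ₜ 1)
  · simpa [tensorComul_eq] using hlmul
  · induction z with
    | zero => simp
    | add x y hx hy => simp only [map_add, hx, hy]
    | tmul a c => simp [comulEnd_ι_of_coact hx, map_sum]

theorem IsYetterDrinfeld.counit_tensorComul (x : TensorAlgebra k V) :
    TensorProduct.lid k _ (TensorProduct.map
      (TensorAlgebra.algebraMapInv (R := k)).toLinearMap LinearMap.id (s.tensorComul x)) = x := by
  have hlmul := hs.isCoaction.tensorAlgebra_intertwine (D := s.comulEnd)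
    (D' := Algebra.lmul k (TensorAlgebra k V)) (A := (TensorProduct.lid k _).toLinearMap ∘ₗ
      TensorProduct.map (TensorAlgebra.algebraMapInv (R := k)).toLinearMap LinearMap.id)
    (fun n x t hx j z => ?_) x (1 ⊗ₜ 1)
  · simpa [tensorComul_eq] using hlmul
  · induction z with
    | zero => simp
    | add x y hx hy => simp only [map_add, hx, hy]
    | tmul a c => simp [comulEnd_ι_of_coact hx, map_sum, algebraMapInv_tensorAct, hx.counit]

theorem IsYetterDrinfeld.actMulRight_act (h : H) (z : H ⊗[k] V) (y : TensorAlgebra k V) :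
    s.actMulRight (s.tensorAct h y) z = s.actMulRight y (rightMul V h z) := by
  induction z with
  | zero => simp
  | add x y hx hy => simp only [map_add, hx, hy]
  | tmul g v => simp [hs.mul_tensorAct]

theorem IsYetterDrinfeld.tensorAntipode_act (h : H) (x : TensorAlgebra k V) :
    s.tensorAntipode (s.tensorAct h x) = s.tensorAct h (s.tensorAntipode x) := by
  suffices hlin : s.tensorAntipode ∘ₗ s.tensorAct.flip x =
      s.tensorAct.flip (s.tensorAntipode x) from LinearMap.congr_fun hlin h
  refine linearMap_ext_comatrix fun n t ht p q => ?_
  simp only [LinearMap.comp_apply, LinearMap.flip_apply]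
  rw [tensorAntipode_eq, tensorAntipode_eq,
    s.tensorAlgebra_covariant ht (D := s.antipodeEnd) (ρ := s.tensorAct) ?_ x 1 p q]
  · simp only [tensorAct_one, ht.counit]
    rw [Finset.sum_eq_single q] <;> simp +contextual
  · intro v z p q
    simp only [antipodeEnd_ι, map_neg, Finset.sum_neg_distrib, hs.actMulRight_act]
    rw [← map_sum, hs.compat ht]
    congr 1
    generalize s.coact v = y
    induction y with
    | zero => simp
    | add x y hx hy => simp only [map_add, Finset.sum_add_distrib, hx, hy]
    | tmul g v =>
      simp only [actMulRight_tmul, s.tensorAct_mul_comatrix ht, map_sum, TensorProduct.map_tmul,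
        LinearMap.mulLeft_apply, hs.mul_tensorAct, tensorAct_ι]

theorem IsYetterDrinfeld.tensorCoact_antipodeEnd (x y : TensorAlgebra k V) :
    s.tensorCoact (s.antipodeEnd x y) = s.coactEnd s.antipodeEnd x (s.tensorCoact y) := by
  refine hs.isCoaction.tensorAlgebra_intertwine (fun n x t hx j y => ?_) x y
  have hmul (l) : ∑ i, s.tensorCoact (s.tensorAct (t j i) y) * t i l ⊗ₜ TensorAlgebra.ι k (x l) =
      (∑ i, TensorProduct.map (LinearMap.mulLeft k (t j i)) (s.tensorAct (t i l))
        (s.tensorCoact y)) * 1 ⊗ₜ TensorAlgebra.ι k (x l) := by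
    simp only [← hs.tensorAct_compat hx.toIsComatrix, Finset.sum_mul, rightMul_eq_mul, mul_assoc,
      Algebra.TensorProduct.tmul_mul_tmul, one_mul, mul_one]
  simp only [antipodeEnd_ι_of_coact hx, coactEnd_ι_of_coact hx, map_neg, map_sum, tensorCoact_mul,
    tensorCoact_ι_of_coact hx, LinearMap.sum_apply, Finset.mul_sum]
  rw [Finset.sum_comm]
  simp only [hmul]
  generalize s.tensorCoact y = z
  induction z with
  | zero => simp
  | add y z hy hz => simp only [map_add, add_mul, Finset.sum_add_distrib, neg_add, hy, hz]
  | tmul g d =>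
    simp only [TensorProduct.map_tmul, LinearMap.mulLeft_apply, antipodeEnd_ι_of_coact hx,
      Finset.sum_mul, Algebra.TensorProduct.tmul_mul_tmul, mul_one, TensorProduct.tmul_neg,
      TensorProduct.tmul_sum, Finset.sum_neg_distrib]
    rw [Finset.sum_comm]

theorem IsYetterDrinfeld.tensorAntipode_coact (x : TensorAlgebra k V) :
    s.tensorCoact (s.tensorAntipode x) =
      TensorProduct.map LinearMap.id s.tensorAntipode (s.tensorCoact x) := by
  rw [tensorAntipode_eq, hs.tensorCoact_antipodeEnd, tensorCoact_one, coactEnd_one_tmul]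
  rfl

theorem IsYetterDrinfeld.tensorAntipode_left (x : TensorAlgebra k V) :
    LinearMap.mul' k _ (TensorProduct.map s.tensorAntipode LinearMap.id (s.tensorComul x)) =
      algebraMap k _ (TensorAlgebra.algebraMapInv x) := by
  have hcounit := hs.isCoaction.tensorAlgebra_intertwine (D := s.comulEnd)
    (D' := (Algebra.ofId k (Module.End k (TensorAlgebra k V))).comp TensorAlgebra.algebraMapInv)
    (A := LinearMap.mul' k _ ∘ₗ TensorProduct.map s.tensorAntipode LinearMap.id)
    (fun n x t hx j z => ?_) x (1 ⊗ₜ 1)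
  · simpa [tensorComul_eq, Algebra.ofId_apply, Algebra.algebraMap_eq_smul_one] using hcounit
  · induction z with
    | zero => simp
    | add x y hx hy => simp only [map_add, hx, hy]
    | tmul a c =>
      simp only [comulEnd_ι_of_coact hx, LinearMap.comp_apply, map_add, map_sum,
        TensorProduct.map_tmul, LinearMap.mul'_apply, LinearMap.id_apply, tensorAntipode_mul',
        antipodeEnd_ι_of_coact hx, hs.tensorAntipode_act, AlgHom.comp_apply, algebraMapInv_ι,
        map_zero, LinearMap.zero_apply, neg_mul, Finset.sum_mul, mul_assoc]
      exact neg_add_cancel _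

omit hs in
variable (s) in
/-- The action of `T(V)` on itself in which `v` acts by `y ↦ vy - (v₍₋₁₎ · y) v₍₀₎`, the braided
adjoint action up to the antipode. It computes `x₍₁₎ S(x₍₂₎)` as `x · 1`. -/
def adjointEnd : TensorAlgebra k V →ₐ[k] Module.End k (TensorAlgebra k V) :=
  TensorAlgebra.lift k (LinearMap.mul k _ ∘ₗ TensorAlgebra.ι k + s.antipodeStep)

omit hs in
theorem adjointEnd_ι_of_coact {x : ι → V} {t : ι → ι → H} (hx : IsCoactionMatrix s.coact x t)
    (j : ι) (y : TensorAlgebra k V) :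
    s.adjointEnd (TensorAlgebra.ι k (x j)) y = TensorAlgebra.ι k (x j) * y -
      ∑ i, s.tensorAct (t j i) y * TensorAlgebra.ι k (x i) := by
  simp [adjointEnd, antipodeStep_apply, hx.apply, map_sum, sub_eq_add_neg]

theorem IsYetterDrinfeld.adjointEnd_one (x : TensorAlgebra k V) :
    s.adjointEnd x 1 = algebraMap k _ (TensorAlgebra.algebraMapInv x) := by
  have hscalar := hs.isCoaction.tensorAlgebra_intertwine
    (D := (Algebra.ofId k (Module.End k k)).comp TensorAlgebra.algebraMapInv) (D' := s.adjointEnd)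
    (A := Algebra.linearMap k (TensorAlgebra k V)) (fun n x t hx j c => ?_) x 1
  · simpa [Algebra.ofId_apply] using hscalar.symm
  · simp only [adjointEnd_ι_of_coact hx, AlgHom.comp_apply, algebraMapInv_ι, map_zero,
      LinearMap.zero_apply, Algebra.linearMap_apply, tensorAct_algebraMap, hx.counit]
    rw [Finset.sum_eq_single j]
    · simp [← Algebra.commutes]
    · intro i _ hi
      simp [hi.symm]
    · simp

theorem IsYetterDrinfeld.tensorAntipode_right (x : TensorAlgebra k V) :
    LinearMap.mul' k _ (TensorProduct.map LinearMap.id s.tensorAntipode (s.tensorComul x)) =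
      algebraMap k _ (TensorAlgebra.algebraMapInv x) := by
  rw [← hs.adjointEnd_one]
  have hadjoint := hs.isCoaction.tensorAlgebra_intertwine (D := s.comulEnd) (D' := s.adjointEnd)
    (A := LinearMap.mul' k _ ∘ₗ TensorProduct.map LinearMap.id s.tensorAntipode)
    (fun n x t hx j z => ?_) x (1 ⊗ₜ 1)
  · simpa [tensorComul_eq] using hadjoint
  · induction z with
    | zero => simp
    | add x y hx hy => simp only [map_add, hx, hy]
    | tmul a c =>
      simp only [comulEnd_ι_of_coact hx, LinearMap.comp_apply, map_add, map_sum,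
        TensorProduct.map_tmul, LinearMap.mul'_apply, LinearMap.id_apply, tensorAntipode_mul',
        antipodeEnd_ι_of_coact hx, adjointEnd_ι_of_coact hx,
        s.tensorAct_mul_comatrix hx.toIsComatrix, mul_neg, Finset.sum_mul, Finset.mul_sum,
        mul_assoc, Finset.sum_neg_distrib, sub_eq_add_neg]
      rw [Finset.sum_comm]

variable (s) in
omit hs in
theorem tensorHopf_mul_act (h : H) (x y : TensorAlgebra k V) :
    s.tensorHopf.mul ((s.tensorHopf.tensor s.tensorHopf.toYDData).act h (x ⊗ₜ y)) =
      s.tensorAct h (x * y) := by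
  suffices hlin : s.tensorHopf.mul ∘ₗ
      (s.tensorHopf.tensor s.tensorHopf.toYDData).act.flip (x ⊗ₜ y) =
      s.tensorAct.flip (x * y) from LinearMap.congr_fun hlin h
  refine linearMap_ext_comatrix fun n t ht p q => ?_
  simp [tensor_act_tmul _ _ ht, s.tensorAct_mul_comatrix ht]

variable (s) in
omit hs in
theorem map_mul_coactMul (z w : H ⊗[k] TensorAlgebra k V) :
    TensorProduct.map LinearMap.id s.tensorHopf.mul (coactMul _ _ (z ⊗ₜ w)) = z * w := by
  induction z with
  | zero => simp
  | add x y hx hy => simp only [add_mul, TensorProduct.add_tmul, map_add, hx, hy]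
  | tmul g x =>
    induction w with
    | zero => simp
    | add x y hx hy => simp only [mul_add, TensorProduct.tmul_add, map_add, hx, hy]
    | tmul g' y => simp

variable (s) in
omit hs in
@[simp]
theorem tensorHopf_unit_one : s.tensorHopf.unit 1 = 1 := map_one (algebraMap k (TensorAlgebra k V))

variable (s) in
omit hs in
theorem isHom_tensorHopf_mul :
    (s.tensorHopf.tensor s.tensorHopf.toYDData).IsHom s.tensorHopf.toYDData s.tensorHopf.mul where
  map_act h m := by
    induction m with
    | zero => simp
    | add x y hx hy => simp only [map_add, hx, hy]
    | tmul x y => rw [tensorHopf_mul_act, tensorHopf_mul_tmul, tensorHopf_act]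
  coact_map := TensorProduct.ext' fun x y => by
    simp [tensor_coact_tmul, map_mul_coactMul, tensorCoact_mul]

variable (s) in
omit hs in
theorem isHom_tensorHopf_unit :
    YDData.unitObj.IsHom s.tensorHopf.toYDData s.tensorHopf.unit where
  map_act h c := (s.tensorAct_algebraMap h c).symm
  coact_map := LinearMap.ext_ring <| by
    change s.tensorCoact (algebraMap k _ 1) = 1 ⊗ₜ algebraMap k _ 1
    rw [map_one, tensorCoact_one]

theorem IsYetterDrinfeld.isHopfAlgebra_tensorHopf : s.tensorHopf.IsHopfAlgebra where
  isYetterDrinfeld := hs.tensorHopf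
  mul_hom := s.isHom_tensorHopf_mul
  unit_hom := s.isHom_tensorHopf_unit
  comul_hom :=
    { map_act := hs.tensorComul_act
      coact_map := LinearMap.ext hs.tensorComul_coact }
  counit_hom :=
    { map_act := s.algebraMapInv_tensorAct
      coact_map := LinearMap.ext fun x => (s.map_algebraMapInv_tensorCoact x).symm }
  antipode_hom :=
    { map_act := hs.tensorAntipode_act
      coact_map := LinearMap.ext hs.tensorAntipode_coact }
  mul_assoc := TensorProduct.ext_threefold fun x y z => mul_assoc x y z
  unit_mul x := by simp
  mul_unit x := by simp
  coassoc := LinearMap.ext hs.tensorComul_coassoc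
  counit_comul := LinearMap.ext hs.counit_tensorComul
  comul_counit := LinearMap.ext hs.tensorComul_counit
  counit_unit := by
    rw [tensorHopf_unit_one]
    exact map_one TensorAlgebra.algebraMapInv
  counit_mul := map_mul TensorAlgebra.algebraMapInv
  comul_unit := by
    rw [tensorHopf_unit_one]
    exact s.tensorComul_one
  comul_mul := TensorProduct.ext' hs.tensorComul_mul
  antipode_left := LinearMap.ext hs.tensorAntipode_left
  antipode_right := LinearMap.ext hs.tensorAntipode_right

end YDData

end TensorAlgebraAntipode

/-! ### Skew derivations and the pairing -/

section SkewDerivations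

variable {k : Type*} {H : Type*} [Field k] [Ring H] [HopfAlgebra k H]
variable {ι : Type*} [Fintype ι] [DecidableEq ι]
variable {V : Type*} [AddCommGroup V] [Module k V]

theorem tensorAlgebra_induction_left {p : TensorAlgebra k V → Prop} (one : p 1)
    (add : ∀ x y, p x → p y → p (x + y)) (smul : ∀ (c : k) x, p x → p (c • x))
    (ι_mul : ∀ v x, p x → p (TensorAlgebra.ι k v * x)) (x : TensorAlgebra k V) : p x := by
  suffices hmul : ∀ y, p y → p (x * y) by simpa using hmul 1 one
  induction x using TensorAlgebra.induction with
  | algebraMap r => exact fun y hy => Algebra.smul_def r y ▸ smul r y hy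
  | ι v => exact fun y => ι_mul v y
  | mul a b ha hb => exact fun y hy => (mul_assoc a b y).symm ▸ ha _ (hb _ hy)
  | add a b ha hb => exact fun y hy => (add_mul a b y).symm ▸ add _ _ (ha y hy) (hb y hy)

theorem ιInv_one : TensorAlgebra.ιInv (1 : TensorAlgebra k V) = 0 := by
  let : Module kᵐᵒᵖ V := Module.compHom _ ((RingHom.id k).fromOpposite mul_comm)
  have : IsCentralScalar k V := ⟨fun r m => rfl⟩
  change TrivSqZeroExt.snd (TensorAlgebra.toTrivSqZeroExt (1 : TensorAlgebra k V)) = 0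
  rw [map_one, TrivSqZeroExt.snd_one]

theorem ιInv_ι_mul (v : V) (x : TensorAlgebra k V) :
    TensorAlgebra.ιInv (TensorAlgebra.ι k v * x) = TensorAlgebra.algebraMapInv x • v := by
  let : Module kᵐᵒᵖ V := Module.compHom _ ((RingHom.id k).fromOpposite mul_comm)
  have : IsCentralScalar k V := ⟨fun r m => rfl⟩
  have hfst : (TrivSqZeroExt.fstHom k k V).comp TensorAlgebra.toTrivSqZeroExt =
      TensorAlgebra.algebraMapInv :=
    TensorAlgebra.hom_ext (LinearMap.ext fun v => by simp)
  change TrivSqZeroExt.snd (TensorAlgebra.toTrivSqZeroExt (TensorAlgebra.ι k v * x)) = _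
  rw [map_mul, TensorAlgebra.toTrivSqZeroExt_ι, TrivSqZeroExt.snd_mul, ← hfst]
  simp

/-- The extension of a functional on `V` to `T(V)` which vanishes outside of degree `1`. -/
def degreeOne : Module.Dual k V →ₗ[k] Module.Dual k (TensorAlgebra k V) :=
  LinearMap.lcomp k k TensorAlgebra.ιInv

@[simp]
theorem degreeOne_one (f : Module.Dual k V) : degreeOne f 1 = 0 := by
  simp [degreeOne, ιInv_one]

@[simp]
theorem degreeOne_ι_mul (f : Module.Dual k V) (v : V) (x : TensorAlgebra k V) :
    degreeOne f (TensorAlgebra.ι k v * x) = f v * TensorAlgebra.algebraMapInv x := by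
  simp [degreeOne, ιInv_ι_mul, mul_comm]

namespace YDData

variable (s : YDData k H V)

theorem degreeOne_act (f : Module.Dual k V) (h : H) (x : TensorAlgebra k V) :
    degreeOne f (s.tensorAct h x) = degreeOne (f ∘ₗ s.act h) x := by
  suffices hlin : degreeOne f ∘ₗ s.tensorAct.flip x =
      (LinearMap.applyₗ x ∘ₗ degreeOne) ∘ₗ f.compRight k ∘ₗ s.act from LinearMap.congr_fun hlin h
  refine linearMap_ext_comatrix fun n t ht p q => ?_
  change degreeOne f (s.tensorAct (t p q) x) = degreeOne (f ∘ₗ s.act (t p q)) x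
  induction x using tensorAlgebra_induction_left with
  | one =>
    rw [tensorAct_one, Algebra.algebraMap_eq_smul_one]
    simp
  | add x y hx hy => simp only [map_add, hx, hy]
  | smul c x hx => simp only [map_smul, hx]
  | ι_mul v x =>
    simp only [s.tensorAct_mul_comatrix ht, map_sum, tensorAct_ι, degreeOne_ι_mul,
      algebraMapInv_tensorAct, ht.counit]
    rw [Finset.sum_eq_single q] <;> simp +contextual

/-- The skew derivation `∂_f = (id ⊗ f) Δ` of `T(V)`. -/
def skewDer : Module.Dual k V →ₗ[k] Module.End k (TensorAlgebra k V) :=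
  (LinearMap.lcomp k _ s.tensorComul) ∘ₗ
    (TensorProduct.rid k (TensorAlgebra k V)).toLinearMap.compRight k ∘ₗ
      TensorProduct.mapBilinear (RingHom.id k) _ _ _ _ LinearMap.id ∘ₗ degreeOne

theorem skewDer_apply (f : Module.Dual k V) (x : TensorAlgebra k V) :
    s.skewDer f x = TensorProduct.rid k _
      (TensorProduct.map LinearMap.id (degreeOne f) (s.tensorComul x)) := rfl

@[simp]
theorem skewDer_one (f : Module.Dual k V) : s.skewDer f 1 = 0 := by simp [skewDer_apply]

variable {s} (hs : s.IsYetterDrinfeld)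
include hs

theorem IsYetterDrinfeld.skewDer_ι_mul {x : ι → V} {t : ι → ι → H}
    (hx : IsCoactionMatrix s.coact x t) (f : Module.Dual k V) (j : ι) (y : TensorAlgebra k V) :
    s.skewDer f (TensorAlgebra.ι k (x j) * y) = TensorAlgebra.ι k (x j) * s.skewDer f y +
      ∑ i, f (x i) • s.tensorAct (t j i) y := by
  conv_rhs => enter [2, 2, i]; rw [← hs.tensorComul_counit y]
  rw [skewDer_apply, skewDer_apply, tensorComul_mul']
  generalize s.tensorComul y = z
  induction z with
  | zero => simp
  | add y z hy hz =>
    simp only [map_add, mul_add, smul_add, Finset.sum_add_distrib, hy, hz]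
    abel
  | tmul a c => simp [comulEnd_ι_of_coact hx, map_sum, smul_smul]

theorem IsYetterDrinfeld.skewDer_act {t : ι → ι → H} (ht : IsComatrix k t) (f : Module.Dual k V)
    (p q : ι) (x : TensorAlgebra k V) :
    s.skewDer f (s.tensorAct (t p q) x) =
      ∑ l, s.tensorAct (t p l) (s.skewDer (f ∘ₗ s.act (t l q)) x) := by
  simp only [skewDer_apply, hs.tensorComul_act]
  generalize s.tensorComul x = z
  induction z with
  | zero => simp
  | add x y hx hy => simp only [map_add, Finset.sum_add_distrib, hx, hy]
  | tmul a c =>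
    simp only [tensor_act_tmul _ _ ht, tensorHopf_act, map_sum, TensorProduct.map_tmul,
      LinearMap.id_apply, TensorProduct.rid_tmul, map_smul, ← degreeOne_act]

theorem IsYetterDrinfeld.tensorComul_skewDer (f : Module.Dual k V) (x : TensorAlgebra k V) :
    s.tensorComul (s.skewDer f x) =
      TensorProduct.map LinearMap.id (s.skewDer f) (s.tensorComul x) := by
  have hassoc (z : TensorAlgebra k V ⊗[k] TensorAlgebra k V) :
      s.tensorComul (TensorProduct.rid k _ (TensorProduct.map LinearMap.id (degreeOne f) z)) =
      TensorProduct.map LinearMap.id ((TensorProduct.rid k _).toLinearMap ∘ₗ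
        TensorProduct.map LinearMap.id (degreeOne f))
          (TensorProduct.assoc k _ _ _ (TensorProduct.map s.tensorComul LinearMap.id z)) := by
    induction z with
    | zero => simp
    | add x y hx hy => simp only [map_add, hx, hy]
    | tmul a c =>
      simp only [TensorProduct.map_tmul, LinearMap.id_apply, TensorProduct.rid_tmul, map_smul]
      generalize s.tensorComul a = y
      induction y with
      | zero => simp
      | add x y hx hy => simp only [map_add, smul_add, TensorProduct.add_tmul, hx, hy]
      | tmul a a' => simp
  rw [skewDer_apply, hassoc, hs.tensorComul_coassoc]
  generalize s.tensorComul x = z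
  induction z with
  | zero => simp
  | add x y hx hy => simp only [map_add, hx, hy]
  | tmul a c => simp [skewDer_apply]

theorem IsYetterDrinfeld.skewDer_coord_ι_mul {b : Module.Basis ι k V} {t : ι → ι → H}
    (hb : IsCoactionMatrix s.coact b t) (i j : ι) (y : TensorAlgebra k V) :
    s.skewDer (b.coord i) (TensorAlgebra.ι k (b j) * y) =
      TensorAlgebra.ι k (b j) * s.skewDer (b.coord i) y + s.tensorAct (t j i) y := by
  rw [hs.skewDer_ι_mul hb, Finset.sum_eq_single i] <;> simp +contextual

theorem IsYetterDrinfeld.skewDer_coact {b : Module.Basis ι k V} {t : ι → ι → H}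
    (hb : IsCoactionMatrix s.coact b t) (j : ι) (x : TensorAlgebra k V) :
    ∑ i, rightMul _ (t i j) (s.tensorCoact (s.skewDer (b.coord i) x)) =
      TensorProduct.map LinearMap.id (s.skewDer (b.coord j)) (s.tensorCoact x) := by
  induction x using tensorAlgebra_induction_left with
  | one => simp [tensorCoact_one]
  | add x y hx hy => simp only [map_add, Finset.sum_add_distrib, hx, hy]
  | smul c x hx => simp only [map_smul, ← Finset.smul_sum, hx]
  | ι_mul v x hx =>
    suffices hlin : ∑ i, rightMul _ (t i j) ∘ₗ s.tensorCoact ∘ₗ s.skewDer (b.coord i) ∘ₗ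
        LinearMap.mulRight k x ∘ₗ TensorAlgebra.ι k =
        TensorProduct.map LinearMap.id (s.skewDer (b.coord j)) ∘ₗ s.tensorCoact ∘ₗ
          LinearMap.mulRight k x ∘ₗ TensorAlgebra.ι k by
      simpa [LinearMap.sum_apply] using LinearMap.congr_fun hlin v
    refine b.ext fun l => ?_
    have hι_mul : ∑ i, rightMul _ (t i j)
        (s.tensorCoact (TensorAlgebra.ι k (b l) * s.skewDer (b.coord i) x)) =
        s.tensorCoact (TensorAlgebra.ι k (b l)) *
          TensorProduct.map LinearMap.id (s.skewDer (b.coord j)) (s.tensorCoact x) := by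
      simp only [← hx, tensorCoact_mul, rightMul_eq_mul, mul_assoc, Finset.mul_sum]
    simp only [LinearMap.sum_apply, LinearMap.comp_apply, LinearMap.mulRight_apply,
      hs.skewDer_coord_ι_mul hb, map_add, Finset.sum_add_distrib, hι_mul,
      hs.tensorAct_compat hb.toIsComatrix]
    simp only [tensorCoact_mul, tensorCoact_ι_of_coact hb]
    generalize s.tensorCoact x = z
    induction z with
    | zero => simp
    | add y z hy hz =>
      simp only [map_add, mul_add, Finset.sum_add_distrib, ← hy, ← hz]
      abel
    | tmul g d =>
      simp only [TensorProduct.map_tmul, LinearMap.id_apply, Finset.sum_mul,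
        Algebra.TensorProduct.tmul_mul_tmul, map_sum, hs.skewDer_coord_ι_mul hb,
        TensorProduct.tmul_add, Finset.sum_add_distrib, LinearMap.mulLeft_apply]

end YDData

end SkewDerivations

section Pairing

variable {k : Type*} {H : Type*} [Field k] [Ring H] [HopfAlgebra k H]
variable {V : Type*} [AddCommGroup V] [Module k V]
variable {W : Type*} [AddCommGroup W] [Module k W]

namespace YDData

variable (s : YDData k H V) (κ : W →ₗ[k] Module.Dual k V)

/-- The action of `T(W)` on the dual of `T(V)` by transposes of skew derivations, for a family `κ`
of functionals on `V` parametrized by `W`. -/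
def pairEnd : TensorAlgebra k W →ₐ[k] Module.End k (Module.Dual k (TensorAlgebra k V)) :=
  TensorAlgebra.lift k (Module.Dual.transpose ∘ₗ s.skewDer ∘ₗ κ)

theorem pairEnd_ι_apply (w : W) (ξ : Module.Dual k (TensorAlgebra k V)) (x : TensorAlgebra k V) :
    s.pairEnd κ (TensorAlgebra.ι k w) ξ x = ξ (s.skewDer (κ w) x) := by
  simp [pairEnd, Module.Dual.transpose_apply]

/-- The pairing `⟨w₁ ⋯ wₙ, x⟩ = ε(∂_{wₙ} ⋯ ∂_{w₁} x)` of `T(W)` and `T(V)`, for a family `κ` of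
functionals on `V` parametrized by `W`. It is used for `W = *V` and, to exchange the roles of the
two arguments, for the evaluations of `*V` at the elements of `V`. -/
def pair : TensorAlgebra k W →ₗ[k] Module.Dual k (TensorAlgebra k V) :=
  LinearMap.applyₗ (TensorAlgebra.algebraMapInv (R := k)).toLinearMap ∘ₗ
    (s.pairEnd κ).toLinearMap

theorem pair_apply (F : TensorAlgebra k W) :
    s.pair κ F = s.pairEnd κ F TensorAlgebra.algebraMapInv.toLinearMap := rfl

@[simp]
theorem pair_one : s.pair κ 1 = TensorAlgebra.algebraMapInv.toLinearMap := by simp [pair_apply]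

theorem pair_ι_mul (w : W) (F : TensorAlgebra k W) (x : TensorAlgebra k V) :
    s.pair κ (TensorAlgebra.ι k w * F) x = s.pair κ F (s.skewDer (κ w) x) := by
  simp only [pair_apply, map_mul, Module.End.mul_apply, pairEnd_ι_apply]

theorem pair_apply_one (F : TensorAlgebra k W) :
    s.pair κ F 1 = TensorAlgebra.algebraMapInv F := by
  induction F using tensorAlgebra_induction_left with
  | one => simp
  | add F F' hF hF' => simp only [map_add, LinearMap.add_apply, hF, hF']
  | smul c F hF => simp only [map_smul, LinearMap.smul_apply, hF]
  | ι_mul w F => simp [pair_ι_mul]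

variable {s} in
theorem IsYetterDrinfeld.pair_mul (hs : s.IsYetterDrinfeld) (F G : TensorAlgebra k W)
    (x : TensorAlgebra k V) :
    s.pair κ (F * G) x = LinearMap.mul' k k
      (TensorProduct.map (s.pair κ G) (s.pair κ F) (s.tensorComul x)) := by
  induction F using tensorAlgebra_induction_left generalizing x with
  | one =>
    rw [one_mul, pair_one]
    conv_lhs => rw [← hs.tensorComul_counit x]
    generalize s.tensorComul x = z
    induction z with
    | zero => simp
    | add x y hx hy => simp only [map_add, hx, hy]
    | tmul a c => simp [mul_comm]
  | add F F' hF hF' =>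
    simp only [add_mul, map_add, LinearMap.add_apply, TensorProduct.map_add_right, hF, hF']
  | smul c F hF =>
    simp only [smul_mul_assoc, map_smul, LinearMap.smul_apply, TensorProduct.map_smul_right, hF]
  | ι_mul w F hF =>
    rw [mul_assoc, pair_ι_mul, hF, hs.tensorComul_skewDer]
    generalize s.tensorComul x = z
    induction z with
    | zero => simp
    | add x y hx hy => simp only [map_add, hx, hy]
    | tmul a c => simp [pair_ι_mul]

theorem pair_ι_mul_eq_comp (w : W) (F : TensorAlgebra k W) :
    s.pair κ (TensorAlgebra.ι k w * F) = s.pair κ F ∘ₗ s.skewDer (κ w) :=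
  LinearMap.ext (s.pair_ι_mul κ w F)

theorem antipodeEval_comp {X Y : Type*} [AddCommGroup X] [Module k X] [AddCommGroup Y] [Module k Y]
    (f : Module.Dual k Y) (g : X →ₗ[k] Y) (z : H ⊗[k] X) :
    antipodeEval H (f ∘ₗ g) z = antipodeEval H f (TensorProduct.map LinearMap.id g z) := by
  induction z with
  | zero => simp
  | add x y hx hy => simp only [map_add, hx, hy]
  | tmul h x => simp

theorem antipodeEval_algebraMapInv (x : TensorAlgebra k V) :
    antipodeEval H (TensorAlgebra.algebraMapInv (R := k)).toLinearMap (s.tensorCoact x) =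
      TensorAlgebra.algebraMapInv x • 1 := by
  rw [← LinearMap.id_comp TensorAlgebra.algebraMapInv.toLinearMap, antipodeEval_comp,
    map_algebraMapInv_tensorCoact]
  simp

/-- The pairing of `T(*V)` and `T(V)`. -/
abbrev dualPair : TensorAlgebra k (Module.Dual k V) →ₗ[k] Module.Dual k (TensorAlgebra k V) :=
  s.pair LinearMap.id

section Dual

variable [BijectiveAntipode k H] [Module.Finite k V]

theorem leftDual_act_antipode (h : H) (f : Module.Dual k V) :
    s.leftDual.act (HopfAlgebra.antipode k h) f = f ∘ₗ s.act h := by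
  ext x
  rw [leftDual_act_apply, antipodeInv_antipode, LinearMap.comp_apply]

theorem isCoactionMatrix_leftDual {ι : Type*} [Fintype ι] [DecidableEq ι]
    {b : Module.Basis ι k V} {t : ι → ι → H} (hb : IsCoactionMatrix s.coact b t) :
    IsCoactionMatrix s.leftDual.coact b.dualBasis fun i j => HopfAlgebra.antipode k (t j i) :=
  ⟨hb.antipode_transpose, fun j => by simpa using s.leftDual_coact_coord b hb j⟩

variable {s}
variable (hs : s.IsYetterDrinfeld)
include hs

theorem IsYetterDrinfeld.dualPair_act (h : H) (F : TensorAlgebra k (Module.Dual k V))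
    (x : TensorAlgebra k V) :
    s.dualPair (s.leftDual.tensorAct (HopfAlgebra.antipode k h) F) x =
      s.dualPair F (s.tensorAct h x) := by
  let ρ : H →ₗ[k] Module.End k (Module.Dual k (TensorAlgebra k V)) :=
    Module.Dual.transpose ∘ₗ s.tensorAct ∘ₗ antipodeInv k H
  have hρ (h ξ x) : ρ (HopfAlgebra.antipode k h) ξ x = ξ (s.tensorAct h x) := by
    simp [ρ, Module.Dual.transpose_apply, antipodeInv_antipode]
  suffices hlin : (LinearMap.applyₗ x ∘ₗ s.dualPair) ∘ₗ s.leftDual.tensorAct.flip F ∘ₗ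
      HopfAlgebra.antipode k = s.dualPair F ∘ₗ s.tensorAct.flip x from LinearMap.congr_fun hlin h
  refine linearMap_ext_comatrix fun n t ht p q => ?_
  have hcov := s.leftDual.tensorAlgebra_covariant ht.antipode_transpose (ρ := ρ)
    (D := s.pairEnd LinearMap.id) (fun f ξ p q => ?_) F TensorAlgebra.algebraMapInv.toLinearMap q p
  · have hcounit (l) : ρ (HopfAlgebra.antipode k (t p l))
        (TensorAlgebra.algebraMapInv (R := k) (M := V)).toLinearMap =
        (if p = l then (1 : k) else 0) • TensorAlgebra.algebraMapInv.toLinearMap := by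
      ext x
      rw [hρ, AlgHom.toLinearMap_apply, algebraMapInv_tensorAct, ht.counit]
      split_ifs <;> simp
    have hx := LinearMap.congr_fun hcov x
    simp only [hcounit, map_smul, hρ, ← pair_apply, LinearMap.sum_apply,
      LinearMap.smul_apply] at hx
    simpa using hx.symm
  · ext x
    simp only [hρ, pairEnd_ι_apply, hs.skewDer_act ht, map_sum, LinearMap.sum_apply,
      leftDual_act_antipode, LinearMap.id_apply]

omit hs in
theorem evalRight_dualPair_tensorCoact_ι_mul {ι : Type*} [Fintype ι] [DecidableEq ι]
    {b : Module.Basis ι k V} {t : ι → ι → H} (hb : IsCoactionMatrix s.coact b t) (j : ι)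
    (x : TensorAlgebra k V) (z : H ⊗[k] TensorAlgebra k (Module.Dual k V)) :
    evalRight H x (TensorProduct.map LinearMap.id s.dualPair
      (s.leftDual.tensorCoact (TensorAlgebra.ι k (b.dualBasis j)) * z)) =
      ∑ i, HopfAlgebra.antipode k (t i j) * evalRight H (s.skewDer (b.dualBasis i) x)
        (TensorProduct.map LinearMap.id s.dualPair z) := by
  rw [tensorCoact_ι_of_coact (s.isCoactionMatrix_leftDual hb)]
  induction z with
  | zero => simp
  | add y z hy hz => simp only [map_add, mul_add, Finset.sum_add_distrib, hy, hz]
  | tmul g F => simp [Finset.sum_mul, map_sum, pair_ι_mul]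

theorem IsYetterDrinfeld.evalRight_dualPair_tensorCoact (F : TensorAlgebra k (Module.Dual k V))
    (x : TensorAlgebra k V) :
    evalRight H x (TensorProduct.map LinearMap.id s.dualPair (s.leftDual.tensorCoact F)) =
      antipodeEval H (s.dualPair F) (s.tensorCoact x) := by
  induction F using tensorAlgebra_induction_left generalizing x with
  | one => simp [tensorCoact_one, antipodeEval_algebraMapInv]
  | add F F' hF hF' =>
    rw [map_add, map_add, map_add, map_add, hF, hF']
    simp only [antipodeEval, TensorProduct.map_add_right, LinearMap.comp_add, LinearMap.add_apply]
  | smul c F hF =>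
    rw [map_smul, map_smul, map_smul, map_smul, hF]
    simp only [antipodeEval, TensorProduct.map_smul_right, LinearMap.comp_smul,
      LinearMap.smul_apply]
  | ι_mul f F hF =>
    let b := Module.finBasis k V
    obtain ⟨t, hb⟩ := hs.isCoaction.exists_coact_basis b
    suffices hlin : evalRight H x ∘ₗ TensorProduct.map LinearMap.id s.dualPair ∘ₗ
        s.leftDual.tensorCoact ∘ₗ LinearMap.mulRight k F ∘ₗ TensorAlgebra.ι k =
        antipodeEval H (s.dualPair F) ∘ₗ LinearMap.applyₗ (s.tensorCoact x) ∘ₗ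
          LinearMap.lTensorHom H ∘ₗ s.skewDer by
      rw [pair_ι_mul_eq_comp, antipodeEval_comp]
      exact LinearMap.congr_fun hlin f
    refine b.dualBasis.ext fun j => ?_
    change evalRight H x (TensorProduct.map LinearMap.id s.dualPair
        (s.leftDual.tensorCoact (TensorAlgebra.ι k (b.dualBasis j) * F))) =
      antipodeEval H (s.dualPair F)
        (TensorProduct.map LinearMap.id (s.skewDer (b.dualBasis j)) (s.tensorCoact x))
    rw [tensorCoact_mul, evalRight_dualPair_tensorCoact_ι_mul hb]
    simp only [b.coe_dualBasis, ← hs.skewDer_coact hb, map_sum, hF, antipodeEval_rightMul]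

theorem IsYetterDrinfeld.dualPair_dualBasis_ι_mul {ι : Type*} [Fintype ι] [DecidableEq ι]
    {b : Module.Basis ι k V} {t : ι → ι → H} (hb : IsCoactionMatrix s.coact b t)
    {F : TensorAlgebra k (Module.Dual k V)} (hF : ∀ v x, s.dualPair F (TensorAlgebra.ι k v * x) =
      s.dualPair (s.leftDual.skewDer (Module.Dual.eval k V v) F) x)
    (j l : ι) (x : TensorAlgebra k V) :
    s.dualPair (TensorAlgebra.ι k (b.dualBasis j) * F) (TensorAlgebra.ι k (b l) * x) =
      s.dualPair (s.leftDual.skewDer (Module.Dual.eval k V (b l))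
        (TensorAlgebra.ι k (b.dualBasis j) * F)) x := by
  rw [pair_ι_mul, hs.skewDer_ι_mul hb, hs.leftDual.skewDer_ι_mul (s.isCoactionMatrix_leftDual hb)]
  simp only [map_add, LinearMap.add_apply, map_sum, LinearMap.sum_apply, map_smul,
    LinearMap.smul_apply, hs.dualPair_act, pair_ι_mul, hF]
  congr 1
  simp [Finsupp.single_apply]

theorem IsYetterDrinfeld.dualPair_apply_ι_mul (F : TensorAlgebra k (Module.Dual k V)) (v : V)
    (x : TensorAlgebra k V) :
    s.dualPair F (TensorAlgebra.ι k v * x) =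
      s.dualPair (s.leftDual.skewDer (Module.Dual.eval k V v) F) x := by
  induction F using tensorAlgebra_induction_left generalizing v x with
  | one => simp
  | add F F' hF hF' => simp only [map_add, LinearMap.add_apply, hF, hF']
  | smul c F hF => simp only [map_smul, LinearMap.smul_apply, hF]
  | ι_mul f F hF =>
    let b := Module.finBasis k V
    obtain ⟨t, hb⟩ := hs.isCoaction.exists_coact_basis b
    have hbilin := LinearMap.ext_basis b.dualBasis b
      (B := (s.dualPair ∘ₗ LinearMap.mulRight k F ∘ₗ TensorAlgebra.ι k).compl₂
        (LinearMap.mulRight k x ∘ₗ TensorAlgebra.ι k))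
      (B' := ((s.leftDual.skewDer ∘ₗ Module.Dual.eval k V).flip ∘ₗ
        LinearMap.mulRight k F ∘ₗ TensorAlgebra.ι k).compr₂ (LinearMap.applyₗ x ∘ₗ s.dualPair))
      fun j l => hs.dualPair_dualBasis_ι_mul hb hF j l x
    exact LinearMap.congr_fun₂ hbilin f v

theorem IsYetterDrinfeld.dualPair_eq_pair_eval (F : TensorAlgebra k (Module.Dual k V))
    (x : TensorAlgebra k V) :
    s.dualPair F x = s.leftDual.pair (Module.Dual.eval k V) x F := by
  induction x using tensorAlgebra_induction_left generalizing F with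
  | one => simp [pair_apply_one]
  | add x y hx hy => simp only [map_add, LinearMap.add_apply, hx, hy]
  | smul c x hx => simp only [map_smul, LinearMap.smul_apply, hx]
  | ι_mul v x hx => rw [hs.dualPair_apply_ι_mul, pair_ι_mul, hx]

theorem IsYetterDrinfeld.dualPair_apply_mul (F : TensorAlgebra k (Module.Dual k V))
    (x y : TensorAlgebra k V) :
    s.dualPair F (x * y) = LinearMap.mul' k k
      (TensorProduct.map (s.dualPair.flip y) (s.dualPair.flip x) (s.leftDual.tensorComul F)) := by
  have hflip (x) : s.dualPair.flip x = s.leftDual.pair (Module.Dual.eval k V) x :=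
    LinearMap.ext fun F => hs.dualPair_eq_pair_eval F x
  rw [hflip, hflip, ← hs.leftDual.pair_mul, hs.dualPair_eq_pair_eval]

end Dual

end YDData

end Pairing

section ConvolutionForms

variable {k : Type*} [Field k] {C : Type*} [AddCommGroup C] [Module k C] [Coalgebra k C]
variable {D : Type*} [AddCommGroup D] [Module k D] [Coalgebra k D]

/-- The product `c ⊗ d ↦ Φ(c₍₁₎)(d₍₂₎) Ψ(c₍₂₎)(d₍₁₎)` of two bilinear forms: the convolution on
`C ⊗ D` with `D` replaced by its co-opposite. -/
def convForm (Φ Ψ : C →ₗ[k] Module.Dual k D) (c : C) (d : D) : k :=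
  TensorProduct.dualDistrib k D D (TensorProduct.map Φ Ψ (Coalgebra.comul c))
    (TensorProduct.comm k D D (Coalgebra.comul d))

/-- A bilinear form on `C × D`, as an element of the convolution algebra of linear maps from `C` to
the opposite of the convolution algebra of `D`; the product of that algebra is `convForm`. -/
def toConvOp (Φ : C →ₗ[k] Module.Dual k D) :
    WithConv (C →ₗ[k] (WithConv (D →ₗ[k] k))ᵐᵒᵖ) :=
  WithConv.toConv
    { toFun := fun c => MulOpposite.op (WithConv.toConv (Φ c))
      map_add' := fun _ _ => by rw [map_add]; rfl
      map_smul' := fun _ _ => by rw [map_smul]; rfl }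

theorem toConvOp_mul_apply (Φ Ψ : C →ₗ[k] Module.Dual k D) (c : C) (d : D) :
    (MulOpposite.unop ((toConvOp Φ * toConvOp Ψ).ofConv c)).ofConv d = convForm Φ Ψ c d := by
  change (MulOpposite.unop (LinearMap.mul' k (WithConv (D →ₗ[k] k))ᵐᵒᵖ
    (TensorProduct.map _ _ (Coalgebra.comul (R := k) c)))).ofConv d = _
  rw [convForm]
  generalize (Coalgebra.comul (R := k) c) = y
  induction y with
  | zero => simp
  | add x y hx hy =>
    simp only [map_add, LinearMap.add_apply, ← hx, ← hy]
    rfl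
  | tmul a b =>
    change LinearMap.mul' k k (TensorProduct.map (Ψ b) (Φ a) (Coalgebra.comul d)) = _
    generalize (Coalgebra.comul (R := k) d) = z
    induction z with
    | zero => simp
    | add x y hx hy => simp only [map_add, hx, hy]
    | tmul a b => simp [mul_comm]

theorem one_convOp_apply (c : C) (d : D) :
    (MulOpposite.unop ((1 : WithConv (C →ₗ[k] (WithConv (D →ₗ[k] k))ᵐᵒᵖ)).ofConv c)).ofConv d =
      Coalgebra.counit (R := k) c * Coalgebra.counit (R := k) d := by
  change (MulOpposite.unop (algebraMap k (WithConv (D →ₗ[k] k))ᵐᵒᵖ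
    (Coalgebra.counit c))).ofConv d = _
  rw [Algebra.algebraMap_eq_smul_one]
  rfl

omit [Coalgebra k C] [Coalgebra k D] in
theorem convOp_ext {A B : WithConv (C →ₗ[k] (WithConv (D →ₗ[k] k))ᵐᵒᵖ)}
    (h : ∀ c d, (MulOpposite.unop (A.ofConv c)).ofConv d =
      (MulOpposite.unop (B.ofConv c)).ofConv d) : A = B :=
  WithConv.ext (LinearMap.ext fun c => MulOpposite.unop_injective
    (WithConv.ext (LinearMap.ext fun d => h c d)))

theorem convForm_left_inv_eq_right_inv {P Q₁ Q₂ : C →ₗ[k] Module.Dual k D}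
    (h₁ : ∀ c d, convForm Q₁ P c d = Coalgebra.counit (R := k) c * Coalgebra.counit (R := k) d)
    (h₂ : ∀ c d, convForm P Q₂ c d = Coalgebra.counit (R := k) c * Coalgebra.counit (R := k) d) :
    Q₁ = Q₂ := by
  have hconv : toConvOp Q₁ = toConvOp Q₂ := left_inv_eq_right_inv (a := toConvOp P)
    (convOp_ext fun c d => by rw [toConvOp_mul_apply, h₁, one_convOp_apply])
    (convOp_ext fun c d => by rw [toConvOp_mul_apply, h₂, one_convOp_apply])
  ext c d
  exact congrArg (fun A => (MulOpposite.unop (WithConv.ofConv A c)).ofConv d) hconv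

end ConvolutionForms

section PairingAntipode

variable {k : Type*} {H : Type*} [Field k] [Ring H] [HopfAlgebra k H]
variable {V : Type*} [AddCommGroup V] [Module k V]

namespace YDData

/-- The coalgebra structure of `T(V)`. -/
abbrev IsYetterDrinfeld.tensorCoalgebra {s : YDData k H V} (hs : s.IsYetterDrinfeld) :
    Coalgebra k (TensorAlgebra k V) where
  comul := s.tensorComul
  counit := TensorAlgebra.algebraMapInv.toLinearMap
  coassoc := LinearMap.ext fun x => hs.tensorComul_coassoc x
  rTensor_counit_comp_comul := LinearMap.ext fun x =>
    (TensorProduct.lid k _).injective <| by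
      simpa [LinearMap.rTensor] using hs.counit_tensorComul x
  lTensor_counit_comp_comul := LinearMap.ext fun x =>
    (TensorProduct.rid k _).injective <| by
      simpa [LinearMap.lTensor] using hs.tensorComul_counit x

theorem IsYetterDrinfeld.pair_mul'_map {W : Type*} [AddCommGroup W] [Module k W]
    {s : YDData k H V} (hs : s.IsYetterDrinfeld) (κ : W →ₗ[k] Module.Dual k V)
    (f g : Module.End k (TensorAlgebra k W)) (z : TensorAlgebra k W ⊗[k] TensorAlgebra k W)
    (x : TensorAlgebra k V) :
    s.pair κ (LinearMap.mul' k _ (TensorProduct.map f g z)) x =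
      TensorProduct.dualDistrib k _ _ (TensorProduct.map (s.pair κ ∘ₗ f) (s.pair κ ∘ₗ g) z)
        (TensorProduct.comm k _ _ (s.tensorComul x)) := by
  induction z with
  | zero => simp
  | add z w hz hw => simp only [map_add, LinearMap.add_apply, hz, hw]
  | tmul F G =>
    rw [TensorProduct.map_tmul, LinearMap.mul'_apply, hs.pair_mul]
    generalize s.tensorComul x = y
    induction y with
    | zero => simp
    | add x y hx hy => simp only [map_add, hx, hy]
    | tmul a c => simp [mul_comm]

variable {s : YDData k H V} [BijectiveAntipode k H] [Module.Finite k V] (hs : s.IsYetterDrinfeld)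
include hs

theorem IsYetterDrinfeld.dualPair_apply_mul'_map (F : TensorAlgebra k (Module.Dual k V))
    (f g : Module.End k (TensorAlgebra k V)) (z : TensorAlgebra k V ⊗[k] TensorAlgebra k V) :
    s.dualPair F (LinearMap.mul' k _ (TensorProduct.map f g z)) =
      TensorProduct.dualDistrib k _ _
        (TensorProduct.map (g.dualMap ∘ₗ s.dualPair) (f.dualMap ∘ₗ s.dualPair)
          (s.leftDual.tensorComul F)) (TensorProduct.comm k _ _ z) := by
  induction z with
  | zero => simp
  | add z w hz hw => simp only [map_add, hz, hw]
  | tmul x y =>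
    rw [TensorProduct.map_tmul, LinearMap.mul'_apply, hs.dualPair_apply_mul]
    generalize s.leftDual.tensorComul F = y
    induction y with
    | zero => simp
    | add x y hx hy => simp only [map_add, LinearMap.add_apply, hx, hy]
    | tmul F G => simp

/- Both sides are convolution inverse to the pairing. -/
theorem IsYetterDrinfeld.dualPair_antipode (F : TensorAlgebra k (Module.Dual k V))
    (x : TensorAlgebra k V) :
    s.dualPair (s.leftDual.tensorAntipode F) x = s.dualPair F (s.tensorAntipode x) := by
  let _ : Coalgebra k (TensorAlgebra k V) := hs.tensorCoalgebra
  let _ : Coalgebra k (TensorAlgebra k (Module.Dual k V)) := hs.leftDual.tensorCoalgebra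
  suffices h : s.dualPair ∘ₗ s.leftDual.tensorAntipode = s.tensorAntipode.dualMap ∘ₗ s.dualPair from
    LinearMap.congr_fun₂ h F x
  refine convForm_left_inv_eq_right_inv (P := s.dualPair) (fun F x => ?_) fun F x => ?_
  · refine (hs.pair_mul'_map LinearMap.id s.leftDual.tensorAntipode LinearMap.id
      (s.leftDual.tensorComul F) x).symm.trans ?_
    rw [hs.leftDual.tensorAntipode_left, Algebra.algebraMap_eq_smul_one, map_smul, pair_one]
    rfl
  · refine (hs.dualPair_apply_mul'_map F s.tensorAntipode LinearMap.id
      (s.tensorComul x)).symm.trans ?_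
    rw [hs.tensorAntipode_left, Algebra.algebraMap_eq_smul_one, map_smul, pair_apply_one,
      smul_eq_mul, mul_comm]
    rfl

end YDData

end PairingAntipode

/-! ### Quantum symmetrizers -/

section PermutationRecursion

/-- The permutation of `{0, …, n}` with `n ↦ p` that induces `y` on the remaining elements. -/
def insertPerm {n : ℕ} (p : Fin (n + 1)) (y : Equiv.Perm (Fin n)) : Equiv.Perm (Fin (n + 1)) :=
  (finSuccEquiv' (Fin.last n)).trans (y.optionCongr.trans (finSuccEquiv' p).symm)

@[simp]
theorem insertPerm_last {n : ℕ} (p : Fin (n + 1)) (y : Equiv.Perm (Fin n)) :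
    insertPerm p y (Fin.last n) = p := by simp [insertPerm]

@[simp]
theorem insertPerm_castSucc {n : ℕ} (p : Fin (n + 1)) (y : Equiv.Perm (Fin n)) (i : Fin n) :
    insertPerm p y i.castSucc = p.succAbove (y i) := by
  simp [insertPerm, finSuccEquiv'_last_apply_castSucc]

theorem insertPerm_bijective (n : ℕ) : Function.Bijective
    fun a : Fin (n + 1) × Equiv.Perm (Fin n) => insertPerm a.1 a.2 := by
  rw [Fintype.bijective_iff_injective_and_card]
  refine ⟨?_, by simp [Fintype.card_perm, Nat.factorial_succ]⟩
  rintro ⟨p, y⟩ ⟨q, z⟩ h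
  obtain rfl : p = q := by simpa using Equiv.congr_fun h (Fin.last n)
  congr 1
  ext i : 1
  simpa using Equiv.congr_fun h i.castSucc

theorem card_inversions_insertPerm_last {n : ℕ} (p : Fin (n + 1)) (y : Equiv.Perm (Fin n)) :
    (Finset.univ.filter fun i => i < Fin.last n ∧
      insertPerm p y (Fin.last n) < insertPerm p y i).card = n - p := by
  simp only [Finset.card_filter, Fin.sum_univ_castSucc, insertPerm_castSucc, insertPerm_last,
    Fin.castSucc_lt_last, true_and, lt_irrefl, and_false, if_false, add_zero]
  rw [Equiv.sum_comp y fun i => if p < p.succAbove i then 1 else 0]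
  simp only [Fin.lt_succAbove_iff_le_castSucc, Fin.le_def, Fin.val_castSucc]
  rw [Fin.sum_univ_eq_sum_range (fun i => if (p : ℕ) ≤ i then 1 else 0) n, ← Finset.card_filter,
    show (Finset.range n).filter (fun i => (p : ℕ) ≤ i) = Finset.Ico (p : ℕ) n by
      ext; simp [and_comm], Nat.card_Ico]

theorem card_inversions_insertPerm_castSucc {n : ℕ} (p : Fin (n + 1)) (y : Equiv.Perm (Fin n))
    (j : Fin n) :
    (Finset.univ.filter fun i => i < j.castSucc ∧
      insertPerm p y j.castSucc < insertPerm p y i).card =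
      (Finset.univ.filter fun i => i < j ∧ y j < y i).card := by
  simp only [Finset.card_filter, Fin.sum_univ_castSucc, insertPerm_castSucc,
    Fin.castSucc_lt_castSucc_iff, Fin.succAbove_lt_succAbove_iff]
  simp [(Fin.castSucc_lt_last j).le]

theorem reducedWord_insertPerm {n : ℕ} (p : Fin (n + 1)) (y : Equiv.Perm (Fin n)) :
    reducedWord (insertPerm p y).symm =
      reducedWord y.symm ++ (List.range (n - p)).map fun t => n - 1 - t := by
  simp only [reducedWord, List.finRange_succ_last, List.flatMap_append, List.flatMap_map,
    Equiv.symm_symm, card_inversions_insertPerm_castSucc, Fin.val_castSucc, List.flatMap_cons,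
    List.flatMap_nil, List.append_nil, card_inversions_insertPerm_last, Fin.val_last]

theorem reducedWord_lt {n : ℕ} (x : Equiv.Perm (Fin n)) {i : ℕ} (hi : i ∈ reducedWord x) :
    i + 1 < n := by
  simp only [reducedWord, List.mem_flatMap, List.mem_map, List.mem_range] at hi
  obtain ⟨j, -, t, ht, rfl⟩ := hi
  have hcard : (Finset.univ.filter fun i => i < j ∧ x.symm j < x.symm i).card ≤ j :=
    (Finset.card_le_card fun i => by simp +contextual).trans (Fin.card_Iio j).le
  omega

end PermutationRecursion

section SymmetrizerRecursion

variable {k : Type*} [Field k] {V : Type*} [AddCommGroup V] [Module k V]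
variable (c : V ⊗[k] V →ₗ[k] V ⊗[k] V)

theorem braidGen_tprod {n i : ℕ} (h : i + 1 < n) (v : Fin n → V) :
    braidGen c n i (PiTensorProduct.tprod k v) =
      insertPair ⟨i, Nat.lt_of_succ_lt h⟩ ⟨i + 1, h⟩ (by simp) v
        (c (v ⟨i, Nat.lt_of_succ_lt h⟩ ⊗ₜ v ⟨i + 1, h⟩)) := by
  simp [braidGen, h, applyAt]

@[simp]
theorem insertPair_tmul {n : ℕ} (a b : Fin n) (hab : a ≠ b) (v : Fin n → V) (x y : V) :
    insertPair a b hab v (x ⊗ₜ[k] y) =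
      PiTensorProduct.tprod k (Function.update (Function.update v a x) b y) := rfl

/-- `v₀ ⊗ ⋯ ⊗ vₙ ↦ f(vₙ) v₀ ⊗ ⋯ ⊗ vₙ₋₁`. -/
def contractLast (n : ℕ) (f : Module.Dual k V) : ⨂[k]^(n + 1) V →ₗ[k] ⨂[k]^n V :=
  PiTensorProduct.lift (MultilinearMap.uncurryRight
    ((LinearMap.lsmul k (⨂[k]^n V) ∘ₗ f).flip.compMultilinearMap (PiTensorProduct.tprod k)))

@[simp]
theorem contractLast_tprod {n : ℕ} (f : Module.Dual k V) (v : Fin (n + 1) → V) :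
    contractLast n f (PiTensorProduct.tprod k v) =
      f (v (Fin.last n)) • PiTensorProduct.tprod k (Fin.init v : Fin n → V) := by
  simp [contractLast]

/-- `v`, `v₁ ⊗ ⋯ ⊗ vₙ ↦ v ⊗ v₁ ⊗ ⋯ ⊗ vₙ`. -/
def tensorCons (n : ℕ) : V →ₗ[k] ⨂[k]^n V →ₗ[k] ⨂[k]^(n + 1) V :=
  PiTensorProduct.lift.toLinearMap ∘ₗ
    (PiTensorProduct.tprod k (s := fun _ : Fin (n + 1) => V)).curryLeft

@[simp]
theorem tensorCons_tprod {n : ℕ} (v : V) (u : Fin n → V) :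
    tensorCons n v (PiTensorProduct.tprod k u) =
      PiTensorProduct.tprod k (Fin.cons v u : Fin (n + 1) → V) := by
  simp [tensorCons]

/-- `v₁ ⊗ ⋯ ⊗ vₙ ↦ v₁ ⊗ ⋯ ⊗ vₙ ⊗ v`. -/
def tensorSnoc (n : ℕ) (v : V) : ⨂[k]^n V →ₗ[k] ⨂[k]^(n + 1) V :=
  PiTensorProduct.lift ((LinearMap.applyₗ v).compMultilinearMap
    (PiTensorProduct.tprod k (s := fun _ : Fin (n + 1) => V)).curryRight)

@[simp]
theorem tensorSnoc_tprod {n : ℕ} (v : V) (u : Fin n → V) :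
    tensorSnoc n v (PiTensorProduct.tprod k u) =
      PiTensorProduct.tprod k (Fin.snoc u v : Fin (n + 1) → V) := by
  simp [tensorSnoc]

theorem sum_tensorSnoc_contractLast {ι : Type*} [Fintype ι] {n : ℕ} (b : Module.Basis ι k V)
    (x : ⨂[k]^(n + 1) V) : ∑ i, tensorSnoc n (b i) (contractLast n (b.coord i) x) = x := by
  suffices h : ∑ i, tensorSnoc n (b i) ∘ₗ contractLast n (b.coord i) = LinearMap.id by
    simpa using LinearMap.congr_fun h x
  refine PiTensorProduct.ext (MultilinearMap.ext fun v => ?_)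
  have hlast := congrArg ((PiTensorProduct.tprod k
    (s := fun _ : Fin (n + 1) => V)).curryRight (Fin.init v)) (b.sum_repr (v (Fin.last n)))
  simp only [map_sum, map_smul, MultilinearMap.curryRight_apply, Fin.snoc_init_self] at hlast
  simpa [LinearMap.sum_apply] using hlast

theorem contractLast_ext {n : ℕ} [Module.Finite k V] {x : ⨂[k]^(n + 1) V}
    (h : ∀ f, contractLast n f x = 0) : x = 0 := by
  rw [← sum_tensorSnoc_contractLast (Module.finBasis k V) x]
  simp [h]

theorem contractLast_braidGen {n i : ℕ} (hi : i + 1 < n) (f : Module.Dual k V)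
    (x : ⨂[k]^(n + 1) V) :
    contractLast n f (braidGen c (n + 1) i x) = braidGen c n i (contractLast n f x) := by
  suffices h : contractLast n f ∘ₗ braidGen c (n + 1) i = braidGen c n i ∘ₗ contractLast n f from
    LinearMap.congr_fun h x
  refine PiTensorProduct.ext (MultilinearMap.ext fun v => ?_)
  simp only [LinearMap.compMultilinearMap_apply, LinearMap.comp_apply, contractLast_tprod, map_smul,
    braidGen_tprod c hi, braidGen_tprod c (hi.trans (Nat.lt_succ_self n))]
  change contractLast n f (insertPair (Fin.castSucc ⟨i, Nat.lt_of_succ_lt hi⟩)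
    (Fin.castSucc ⟨i + 1, hi⟩) _ v
      (c (Fin.init v ⟨i, Nat.lt_of_succ_lt hi⟩ ⊗ₜ[k] Fin.init v ⟨i + 1, hi⟩))) = _
  generalize c _ = z
  induction z with
  | zero => simp
  | add x y hx hy => simp only [map_add, smul_add, hx, hy]
  | tmul x y =>
    rw [insertPair_tmul, insertPair_tmul, contractLast_tprod, Fin.init_update_castSucc,
      Fin.init_update_castSucc, Function.update_of_ne (Fin.castSucc_lt_last _).ne',
      Function.update_of_ne (Fin.castSucc_lt_last _).ne']

theorem braidGen_tensorCons {n i : ℕ} (hi : i + 1 < n) (v : V) (x : ⨂[k]^n V) :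
    braidGen c (n + 1) (i + 1) (tensorCons n v x) = tensorCons n v (braidGen c n i x) := by
  suffices h : braidGen c (n + 1) (i + 1) ∘ₗ tensorCons n v = tensorCons n v ∘ₗ braidGen c n i from
    LinearMap.congr_fun h x
  refine PiTensorProduct.ext (MultilinearMap.ext fun u => ?_)
  simp only [LinearMap.compMultilinearMap_apply, LinearMap.comp_apply, tensorCons_tprod,
    braidGen_tprod c hi, braidGen_tprod c (Nat.succ_lt_succ hi)]
  change insertPair (Fin.succ ⟨i, Nat.lt_of_succ_lt hi⟩) (Fin.succ ⟨i + 1, hi⟩) _ _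
    (c ((Fin.cons v u : Fin (n + 1) → V) (Fin.succ ⟨i, Nat.lt_of_succ_lt hi⟩) ⊗ₜ[k]
      (Fin.cons v u : Fin (n + 1) → V) (Fin.succ ⟨i + 1, hi⟩))) = _
  rw [Fin.cons_succ, Fin.cons_succ]
  generalize c _ = z
  induction z with
  | zero => simp
  | add x y hx hy => simp only [map_add, hx, hy]
  | tmul x y =>
    rw [insertPair_tmul, insertPair_tmul, tensorCons_tprod, Fin.cons_update, Fin.cons_update]

theorem contractLast_tensorCons {n : ℕ} (f : Module.Dual k V) (v : V) (x : ⨂[k]^(n + 1) V) :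
    contractLast (n + 1) f (tensorCons (n + 1) v x) = tensorCons n v (contractLast n f x) := by
  suffices h : contractLast (n + 1) f ∘ₗ tensorCons (n + 1) v =
      tensorCons n v ∘ₗ contractLast n f from
    LinearMap.congr_fun h x
  refine PiTensorProduct.ext (MultilinearMap.ext fun u => ?_)
  simp only [LinearMap.compMultilinearMap_apply, LinearMap.comp_apply, tensorCons_tprod,
    contractLast_tprod, map_smul]
  congr 2
  funext i
  cases i using Fin.cases with
  | zero => rfl
  | succ i => simp [Fin.init]

/-- The endomorphism `σᵢ₊ᵣ₋₁ ⋯ σᵢ₊₁ σᵢ` of `V^{⊗n}`. -/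
def braidRun (n i r : ℕ) : Module.End k (⨂[k]^n V) :=
  ((List.range r).map fun t => braidGen c n (i + r - 1 - t)).prod

/-- The endomorphism `1 + σₙ₋₁ + σₙ₋₁ σₙ₋₂ + ⋯ + σₙ₋₁ ⋯ σ₀` of `V^{⊗(n + 1)}`. -/
def braidShuffle (n : ℕ) : Module.End k (⨂[k]^(n + 1) V) :=
  ∑ r ∈ Finset.range (n + 1), braidRun c (n + 1) (n - r) r

theorem symmetrizer_succ (n : ℕ) : symmetrizer c (n + 1) =
    (∑ y : Equiv.Perm (Fin n), ((reducedWord y).map (braidGen c (n + 1))).prod) *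
      braidShuffle c n := by
  have hsymm : symmetrizer c (n + 1) = ∑ x : Equiv.Perm (Fin (n + 1)), braidLift c x.symm :=
    (Equiv.sum_comp (Equiv.inv (Equiv.Perm (Fin (n + 1)))) (braidLift c)).symm
  have hwords : ∑ y : Equiv.Perm (Fin n), ((reducedWord y).map (braidGen c (n + 1))).prod =
      ∑ y : Equiv.Perm (Fin n), ((reducedWord y.symm).map (braidGen c (n + 1))).prod :=
    (Equiv.sum_comp (Equiv.inv (Equiv.Perm (Fin n)))
      fun y => ((reducedWord y).map (braidGen c (n + 1))).prod).symm
  rw [hsymm, hwords, ← (insertPerm_bijective n).sum_comp, Fintype.sum_prod_type, Finset.sum_comm,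
    Finset.sum_mul]
  refine Finset.sum_congr rfl fun y _ => ?_
  simp only [braidLift, reducedWord_insertPerm, List.map_append, List.prod_append, List.map_map]
  rw [← Finset.mul_sum, braidShuffle,
    Fin.sum_univ_eq_sum_range (fun p => ((List.range (n - p)).map
      (braidGen c (n + 1) ∘ fun t => n - 1 - t)).prod) (n + 1),
    ← Finset.sum_range_reflect (fun r => braidRun c (n + 1) (n - r) r)]
  congr 1
  refine Finset.sum_congr rfl fun p hp => ?_
  rw [Finset.mem_range] at hp
  rw [braidRun, show n + 1 - 1 - p = n - p by omega,
    show n - (n - p) + (n - p) - 1 = n - 1 by omega]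
  rfl

theorem list_prod_intertwine {X Y ι : Type*} [AddCommGroup X] [Module k X] [AddCommGroup Y]
    [Module k Y] (A : X →ₗ[k] Y) {f : ι → Module.End k X} {g : ι → Module.End k Y} {l : List ι}
    (h : ∀ i ∈ l, ∀ x, A (f i x) = g i (A x)) (x : X) :
    A ((l.map f).prod x) = (l.map g).prod (A x) := by
  induction l with
  | nil => simp
  | cons i l ih =>
    rw [List.forall_mem_cons] at h
    simp only [List.map_cons, List.prod_cons, Module.End.mul_apply, h.1, ih h.2]

theorem contractLast_symmetrizer (n : ℕ) (f : Module.Dual k V) (x : ⨂[k]^(n + 1) V) :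
    contractLast n f (symmetrizer c (n + 1) x) =
      symmetrizer c n (contractLast n f (braidShuffle c n x)) := by
  rw [symmetrizer_succ, Module.End.mul_apply, LinearMap.sum_apply, map_sum, symmetrizer,
    LinearMap.sum_apply]
  exact Finset.sum_congr rfl fun y _ => list_prod_intertwine (contractLast n f)
    (fun i hi => contractLast_braidGen c (reducedWord_lt y hi) f) _

theorem braidRun_tensorCons {n i r : ℕ} (h : i + r < n) (v : V) (x : ⨂[k]^n V) :
    braidRun c (n + 1) (i + 1) r (tensorCons n v x) = tensorCons n v (braidRun c n i r x) := by
  refine (list_prod_intertwine (tensorCons n v) (fun t ht x => ?_) x).symm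
  rw [List.mem_range] at ht
  rw [show i + 1 + r - 1 - t = i + r - 1 - t + 1 by omega, braidGen_tensorCons c (by omega)]

theorem braidRun_succ (n i r : ℕ) :
    braidRun c n i (r + 1) = braidRun c n (i + 1) r * braidGen c n i := by
  rw [braidRun, List.range_succ, List.map_append, List.prod_append, braidRun]
  congr 2
  · refine List.map_congr_left fun t _ => ?_
    congr 1
    omega
  · simp

theorem braidShuffle_tensorCons (n : ℕ) (v : V) (x : ⨂[k]^(n + 1) V) :
    braidShuffle c (n + 1) (tensorCons (n + 1) v x) =
      tensorCons (n + 1) v (braidShuffle c n x) +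
        braidRun c (n + 2) 0 (n + 1) (tensorCons (n + 1) v x) := by
  rw [braidShuffle, Finset.sum_range_succ, LinearMap.add_apply, LinearMap.sum_apply, braidShuffle,
    LinearMap.sum_apply, map_sum, Nat.sub_self]
  congr 1
  refine Finset.sum_congr rfl fun r hr => ?_
  rw [Finset.mem_range] at hr
  rw [← braidRun_tensorCons c (by omega)]
  congr 2
  omega

end SymmetrizerRecursion

section Radical

variable {k : Type*} [Field k] {V : Type*} [AddCommGroup V] [Module k V]

theorem linearMap_ext_tensorCons {X : Type*} [AddCommGroup X] [Module k X] {n : ℕ}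
    {F G : ⨂[k]^(n + 1) V →ₗ[k] X}
    (h : (tensorCons n).compr₂ F = (tensorCons n).compr₂ G) : F = G := by
  refine PiTensorProduct.ext (MultilinearMap.ext fun u => ?_)
  simpa using LinearMap.congr_fun₂ h (u 0) (PiTensorProduct.tprod k (Fin.tail u))

theorem toTensorAlgebra_tensorCons {n : ℕ} (v : V) (x : ⨂[k]^n V) :
    TensorPower.toTensorAlgebra (tensorCons n v x) =
      TensorAlgebra.ι k v * TensorPower.toTensorAlgebra x := by
  suffices h : TensorPower.toTensorAlgebra ∘ₗ tensorCons n v =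
      LinearMap.mulLeft k (TensorAlgebra.ι k v) ∘ₗ TensorPower.toTensorAlgebra from
    LinearMap.congr_fun h x
  refine PiTensorProduct.ext (MultilinearMap.ext fun u => ?_)
  simp [TensorPower.toTensorAlgebra_tprod, TensorAlgebra.tprod_apply]

theorem toTensorAlgebra_zero_eq (x : ⨂[k]^0 V) :
    ∃ a : k, x = a • PiTensorProduct.tprod k Fin.elim0 ∧
      TensorPower.toTensorAlgebra x = a • (1 : TensorAlgebra k V) := by
  suffices ∃ a : k, x = a • PiTensorProduct.tprod k Fin.elim0 by
    obtain ⟨a, rfl⟩ := this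
    exact ⟨a, rfl, by simp [TensorPower.toTensorAlgebra_tprod, TensorAlgebra.tprod_apply]⟩
  induction x using PiTensorProduct.induction_on with
  | smul_tprod a u => exact ⟨a, by rw [Subsingleton.elim u Fin.elim0]⟩
  | add x y hx hy =>
    obtain ⟨a, rfl⟩ := hx
    obtain ⟨c, rfl⟩ := hy
    exact ⟨a + c, (add_smul _ _ _).symm⟩

theorem exists_sum_toTensorAlgebra (x : TensorAlgebra k V) :
    ∃ (N : ℕ) (y : ∀ n, ⨂[k]^n V),
      x = ∑ n ∈ Finset.range N, TensorPower.toTensorAlgebra (y n) := by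
  classical
  let d := TensorAlgebra.toDirectSum x
  obtain ⟨N, hN⟩ := d.support.bddAbove
  refine ⟨N + 1, fun n => d n, ?_⟩
  rw [← TensorAlgebra.ofDirectSum_toDirectSum x]
  change TensorAlgebra.ofDirectSum d = _
  conv_lhs => rw [← DirectSum.sum_support_of d]
  rw [map_sum]
  have h : ∀ n (z : ⨂[k]^n V), TensorAlgebra.ofDirectSum (DirectSum.of _ n z) =
      TensorPower.toTensorAlgebra z := fun n z => DirectSum.toAddMonoid_of
      (fun _ => LinearMap.toAddMonoidHom TensorPower.toTensorAlgebra) n z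
  simp only [h]
  refine Finset.sum_subset (fun n hn => ?_) fun n _ hn => ?_
  · exact Finset.mem_range.2 (Nat.lt_succ_of_le (hN hn))
  · rw [DFinsupp.notMem_support_iff.1 hn, map_zero]

end Radical

section Symmetrizer

variable {k : Type*} {H : Type*} [Field k] [Ring H] [HopfAlgebra k H]
variable {ι : Type*} [Fintype ι] [DecidableEq ι]
variable {V : Type*} [AddCommGroup V] [Module k V] {W : Type*} [AddCommGroup W] [Module k W]

theorem algebraMapInv_toTensorAlgebra_succ {n : ℕ} (x : ⨂[k]^(n + 1) V) :
    TensorAlgebra.algebraMapInv (TensorPower.toTensorAlgebra x) = 0 := by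
  suffices h : (TensorAlgebra.algebraMapInv (R := k) (M := V)).toLinearMap ∘ₗ
      TensorPower.toTensorAlgebra (n := n + 1) = 0 from LinearMap.congr_fun h x
  refine linearMap_ext_tensorCons (LinearMap.ext₂ fun v y => ?_)
  simp [toTensorAlgebra_tensorCons]

namespace YDData

variable {s : YDData k H V} {x : ι → V} {t : ι → ι → H}

theorem braiding_tmul_of_coact (hx : IsCoactionMatrix s.coact x t) (r : YDData k H W) (j : ι)
    (w : W) : s.braiding r (x j ⊗ₜ w) = ∑ i, r.act (t j i) w ⊗ₜ x i := by
  simp [braiding_tmul, hx.apply, TensorProduct.sum_tmul]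

theorem braidGen_zero_tensorCons (hx : IsCoactionMatrix s.coact x t) {n : ℕ} (j : ι) (v : V)
    (y : ⨂[k]^n V) :
    braidGen (s.braiding s) (n + 2) 0 (tensorCons (n + 1) (x j) (tensorCons n v y)) =
      ∑ i, tensorCons (n + 1) (s.act (t j i) v) (tensorCons n (x i) y) := by
  suffices h : braidGen (s.braiding s) (n + 2) 0 ∘ₗ tensorCons (n + 1) (x j) ∘ₗ tensorCons n v =
      ∑ i, tensorCons (n + 1) (s.act (t j i) v) ∘ₗ tensorCons n (x i) by
    simpa using LinearMap.congr_fun h y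
  refine PiTensorProduct.ext (MultilinearMap.ext fun u => ?_)
  simp only [LinearMap.compMultilinearMap_apply, LinearMap.comp_apply, tensorCons_tprod,
    LinearMap.sum_apply]
  rw [braidGen_tprod _ (by omega)]
  change insertPair _ _ _ _ (s.braiding s (x j ⊗ₜ v)) = _
  rw [braiding_tmul_of_coact hx, map_sum]
  refine Finset.sum_congr rfl fun i _ => ?_
  rw [insertPair_tmul]
  congr 1
  change Function.update (Function.update _ 0 _) (Fin.succ 0) _ = _
  rw [Fin.update_cons_zero, ← Fin.cons_update, Fin.update_cons_zero]

theorem contractLast_braidRun (hx : IsCoactionMatrix s.coact x t) {n : ℕ}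
    (f : Module.Dual k V) (j : ι) (y : ⨂[k]^n V) :
    TensorPower.toTensorAlgebra (contractLast n f
        (braidRun (s.braiding s) (n + 1) 0 n (tensorCons n (x j) y))) =
      ∑ i, f (x i) • s.tensorAct (t j i) (TensorPower.toTensorAlgebra y) := by
  induction n generalizing j with
  | zero =>
    obtain ⟨a, rfl, hone⟩ := toTensorAlgebra_zero_eq y
    simp [hone, braidRun, tensorAct_one, hx.counit, TensorPower.toTensorAlgebra_tprod,
      TensorAlgebra.tprod_apply, smul_comm a]
  | succ n ih =>
    suffices h : TensorPower.toTensorAlgebra ∘ₗ contractLast (n + 1) f ∘ₗ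
        braidRun (s.braiding s) (n + 2) 0 (n + 1) ∘ₗ tensorCons (n + 1) (x j) =
        ∑ i, f (x i) • (s.tensorAct (t j i) ∘ₗ TensorPower.toTensorAlgebra) by
      simpa using LinearMap.congr_fun h y
    refine linearMap_ext_tensorCons (LinearMap.ext₂ fun v y => ?_)
    simp only [LinearMap.compr₂_apply, LinearMap.comp_apply, LinearMap.sum_apply,
      LinearMap.smul_apply, braidRun_succ, Module.End.mul_apply, braidGen_zero_tensorCons hx,
      map_sum, braidRun_tensorCons _ (show 0 + n < n + 1 by omega), contractLast_tensorCons,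
      toTensorAlgebra_tensorCons, ih, s.tensorAct_mul_comatrix hx.toIsComatrix, tensorAct_ι,
      Finset.mul_sum, Finset.smul_sum, mul_smul_comm]
    exact Finset.sum_comm

variable (hs : s.IsYetterDrinfeld)
include hs

theorem IsYetterDrinfeld.contractLast_braidShuffle {n : ℕ} (f : Module.Dual k V)
    (y : ⨂[k]^(n + 1) V) :
    TensorPower.toTensorAlgebra (contractLast n f (braidShuffle (s.braiding s) n y)) =
      s.skewDer f (TensorPower.toTensorAlgebra y) := by
  suffices h : TensorPower.toTensorAlgebra ∘ₗ contractLast n f ∘ₗ braidShuffle (s.braiding s) n =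
      s.skewDer f ∘ₗ TensorPower.toTensorAlgebra from LinearMap.congr_fun h y
  induction n with
  | zero =>
    refine linearMap_ext_tensorCons (hs.isCoaction.linearMap_ext fun _ x t hx j =>
      LinearMap.ext fun y => ?_)
    have hrun := contractLast_braidRun hx f j y
    simp only [LinearMap.compr₂_apply, LinearMap.comp_apply, toTensorAlgebra_tensorCons,
      hs.skewDer_ι_mul hx, ← hrun]
    obtain ⟨a, rfl, hone⟩ := toTensorAlgebra_zero_eq y
    simp [hone, skewDer_one, braidShuffle]
  | succ n ih =>
    refine linearMap_ext_tensorCons (hs.isCoaction.linearMap_ext fun _ x t hx j =>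
      LinearMap.ext fun y => ?_)
    have hrun := contractLast_braidRun hx f j y
    have hshuffle := LinearMap.congr_fun (ih y) y
    simp only [LinearMap.comp_apply] at hshuffle
    simp only [LinearMap.compr₂_apply, LinearMap.comp_apply, toTensorAlgebra_tensorCons,
      hs.skewDer_ι_mul hx, ← hrun, ← hshuffle, braidShuffle_tensorCons, map_add,
      contractLast_tensorCons]

variable {κ : W →ₗ[k] Module.Dual k V}

theorem IsYetterDrinfeld.pair_eq_zero_of_symmetrizer {n : ℕ} {y : ⨂[k]^n V}
    (hy : symmetrizer (s.braiding s) n y = 0) (F : TensorAlgebra k W) :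
    s.pair κ F (TensorPower.toTensorAlgebra y) = 0 := by
  induction n generalizing F with
  | zero =>
    have hsymm : symmetrizer (s.braiding s) 0 y = y := by
      simp [symmetrizer, braidLift, reducedWord]
    rw [← hsymm, hy, map_zero, map_zero]
  | succ n ih =>
    induction F using tensorAlgebra_induction_left with
    | one =>
      rw [pair_one]
      exact algebraMapInv_toTensorAlgebra_succ y
    | add F G hF hG => rw [map_add, LinearMap.add_apply, hF, hG, add_zero]
    | smul a F hF => rw [map_smul, LinearMap.smul_apply, hF, smul_zero]
    | ι_mul w F _ =>
      rw [pair_ι_mul, ← hs.contractLast_braidShuffle]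
      refine ih ?_ F
      rw [← contractLast_symmetrizer, hy, map_zero]

variable [Module.Finite k V]

theorem IsYetterDrinfeld.symmetrizer_eq_zero_of_pair (hκ : Function.Surjective κ) {n N : ℕ}
    (hn : n < N) {y : ∀ m, ⨂[k]^m V}
    (hy : ∀ F, s.pair κ F (∑ m ∈ Finset.range N, TensorPower.toTensorAlgebra (y m)) = 0) :
    symmetrizer (s.braiding s) n (y n) = 0 := by
  obtain ⟨N, rfl⟩ := Nat.exists_eq_add_one_of_ne_zero (Nat.ne_zero_of_lt hn)
  obtain ⟨a, hone, hone'⟩ := toTensorAlgebra_zero_eq (y 0)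
  induction n generalizing N y a with
  | zero =>
    have hpair := hy 1
    rw [pair_one, Finset.sum_range_succ', hone'] at hpair
    have ha : a = 0 := by simpa [algebraMapInv_toTensorAlgebra_succ] using hpair
    rw [hone, ha, zero_smul, map_zero]
  | succ n ih =>
    refine contractLast_ext fun f => ?_
    obtain ⟨w, rfl⟩ := hκ f
    rw [contractLast_symmetrizer]
    obtain ⟨N, rfl⟩ := Nat.exists_eq_add_one_of_ne_zero (n := N) (by omega)
    obtain ⟨a', hone₁, hone₁'⟩ := toTensorAlgebra_zero_eq
      (contractLast 0 (κ w) (braidShuffle (s.braiding s) 0 (y 1)))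
    refine ih (y := fun m => contractLast m (κ w) (braidShuffle (s.braiding s) m (y (m + 1))))
      N (by omega) (fun F => ?_) a' hone₁ hone₁'
    have hpair := hy (TensorAlgebra.ι k w * F)
    rw [pair_ι_mul, Finset.sum_range_succ', hone'] at hpair
    simp only [map_add, map_smul, skewDer_one, smul_zero, add_zero] at hpair
    simp only [hs.contractLast_braidShuffle, ← map_sum]
    exact hpair

theorem IsYetterDrinfeld.mem_nicholsIdeal (hκ : Function.Surjective κ) {y : TensorAlgebra k V} :
    y ∈ s.nicholsIdeal ↔ ∀ F, s.pair κ F y = 0 := by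
  constructor
  · intro hy F
    have hle : s.nicholsIdeal ≤ LinearMap.ker (s.pair κ F) := by
      refine iSup_le fun n => ?_
      rintro _ ⟨y, hy, rfl⟩
      exact hs.pair_eq_zero_of_symmetrizer hy F
    exact hle hy
  · intro hy
    obtain ⟨N, y, rfl⟩ := exists_sum_toTensorAlgebra y
    refine Submodule.sum_mem _ fun n hn => ?_
    exact Submodule.mem_iSup_of_mem n ⟨y n,
      hs.symmetrizer_eq_zero_of_pair hκ (Finset.mem_range.1 hn) hy, rfl⟩

end YDData

end Symmetrizer

/-! ### The Hopf ideal -/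

theorem eq_zero_of_forall_rid_map_eq_zero {k A Q X : Type*} [Field k] [AddCommGroup A] [Module k A]
    [AddCommGroup Q] [Module k Q] {φ : X → Module.Dual k Q}
    (hφ : ∀ q, (∀ x, φ x q = 0) → q = 0) {z : A ⊗[k] Q}
    (hz : ∀ x, TensorProduct.rid k A (TensorProduct.map LinearMap.id (φ x) z) = 0) : z = 0 := by
  let b := Module.Free.chooseBasis k A
  refine (TensorProduct.equivFinsuppOfBasisLeft b).injective ?_
  rw [map_zero]
  ext i
  refine hφ _ fun x => ?_
  have hcoord : φ x ∘ₗ Finsupp.lapply i ∘ₗ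
        (TensorProduct.equivFinsuppOfBasisLeft (N := Q) b).toLinearMap =
      b.coord i ∘ₗ (TensorProduct.rid k A).toLinearMap ∘ₗ
        TensorProduct.map LinearMap.id (φ x) := by
    ext a q
    simp [mul_comm]
  simpa [hz] using LinearMap.congr_fun hcoord z

section HopfIdeal

variable {k : Type*} {H : Type*} [Field k] [Ring H] [HopfAlgebra k H]
variable {V : Type*} [AddCommGroup V] [Module k V] [Module.Finite k V]

namespace YDData

variable {s : YDData k H V} (hs : s.IsYetterDrinfeld)
include hs

theorem IsYetterDrinfeld.mem_nicholsIdeal_iff {x : TensorAlgebra k V} :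
    x ∈ s.nicholsIdeal ↔ s.dualPair.flip x = 0 := by
  rw [hs.mem_nicholsIdeal (κ := LinearMap.id) Function.surjective_id, LinearMap.ext_iff]
  rfl

/-- The pairing of `T(*V)` with the quotient of `T(V)` by its radical. -/
def IsYetterDrinfeld.nicholsPair :
    TensorAlgebra k (Module.Dual k V) →ₗ[k] Module.Dual k s.NicholsSpace :=
  LinearMap.flip (s.nicholsIdeal.liftQ s.dualPair.flip
    fun _ hx => hs.mem_nicholsIdeal_iff.1 hx)

@[simp]
theorem IsYetterDrinfeld.nicholsPair_mk (F : TensorAlgebra k (Module.Dual k V))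
    (x : TensorAlgebra k V) :
    hs.nicholsPair F (Submodule.Quotient.mk x) = s.dualPair F x := rfl

theorem IsYetterDrinfeld.eq_zero_of_nicholsPair (q : s.NicholsSpace)
    (hq : ∀ F, hs.nicholsPair F q = 0) : q = 0 := by
  obtain ⟨x, rfl⟩ := s.nicholsIdeal.mkQ_surjective q
  exact (Submodule.Quotient.mk_eq_zero _).2
    (hs.mem_nicholsIdeal_iff.2 (LinearMap.ext fun F => hq F))

theorem IsYetterDrinfeld.nicholsPair_surjective [Module.Finite k s.NicholsSpace] :
    Function.Surjective hs.nicholsPair := by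
  have hbot : (LinearMap.range hs.nicholsPair).dualCoannihilator = ⊥ := by
    rw [eq_bot_iff]
    intro q hq
    refine hs.eq_zero_of_nicholsPair q fun F => ?_
    exact (Submodule.mem_dualCoannihilator q).1 hq _ ⟨F, rfl⟩
  rw [← LinearMap.range_eq_top, ← Subspace.dualCoannihilator_dualAnnihilator_eq
    (W := LinearMap.range hs.nicholsPair), hbot, Submodule.dualAnnihilator_bot]

theorem IsYetterDrinfeld.map_mkQ_tensorComul_eq_zero {x : TensorAlgebra k V}
    (hx : x ∈ s.nicholsIdeal) :
    TensorProduct.map s.nicholsIdeal.mkQ s.nicholsIdeal.mkQ (s.tensorComul x) = 0 := by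
  refine eq_zero_of_forall_rid_map_eq_zero hs.eq_zero_of_nicholsPair fun F =>
    hs.eq_zero_of_nicholsPair _ fun G => ?_
  have hpair := hs.pair_mul LinearMap.id F G x
  rw [show s.dualPair (F * G) x = 0 from LinearMap.congr_fun (hs.mem_nicholsIdeal_iff.1 hx) _]
    at hpair
  rw [hpair]
  generalize s.tensorComul x = z
  induction z with
  | zero => simp
  | add x y hx hy => simp only [map_add, hx, hy]
  | tmul a c => simp [mul_comm]

variable [BijectiveAntipode k H]

theorem IsYetterDrinfeld.mem_nicholsIdeal_leftDual {F : TensorAlgebra k (Module.Dual k V)} :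
    F ∈ s.leftDual.nicholsIdeal ↔ s.dualPair F = 0 := by
  rw [hs.leftDual.mem_nicholsIdeal (κ := Module.Dual.eval k V)
    (Module.evalEquiv k V).surjective, LinearMap.ext_iff]
  simp only [hs.dualPair_eq_pair_eval, LinearMap.zero_apply]

theorem IsYetterDrinfeld.ker_nicholsPair :
    LinearMap.ker hs.nicholsPair = s.leftDual.nicholsIdeal := by
  ext F
  rw [hs.mem_nicholsIdeal_leftDual, LinearMap.mem_ker]
  refine ⟨fun h => LinearMap.ext fun x => LinearMap.congr_fun h (Submodule.Quotient.mk x),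
    fun h => LinearMap.ext fun q => ?_⟩
  obtain ⟨x, rfl⟩ := s.nicholsIdeal.mkQ_surjective q
  exact LinearMap.congr_fun h x

theorem IsYetterDrinfeld.map_mkQ_tensorCoact_eq_zero {x : TensorAlgebra k V}
    (hx : x ∈ s.nicholsIdeal) :
    TensorProduct.map LinearMap.id s.nicholsIdeal.mkQ (s.tensorCoact x) = 0 := by
  refine eq_zero_of_forall_rid_map_eq_zero hs.eq_zero_of_nicholsPair fun F =>
    antipode_injective (k := k) ?_
  have hpair := hs.evalRight_dualPair_tensorCoact F x
  have hzero : evalRight H x ∘ₗ TensorProduct.map LinearMap.id s.dualPair = 0 :=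
    TensorProduct.ext' fun h G => by
      simp [show s.pair LinearMap.id G x = 0 from
        LinearMap.congr_fun (hs.mem_nicholsIdeal_iff.1 hx) G]
  have heval : HopfAlgebra.antipode k ∘ₗ (TensorProduct.rid k H).toLinearMap ∘ₗ
      TensorProduct.map LinearMap.id (hs.nicholsPair F) ∘ₗ
        TensorProduct.map LinearMap.id s.nicholsIdeal.mkQ = antipodeEval H (s.dualPair F) :=
    TensorProduct.ext' fun h y => by simp
  rw [map_zero]
  exact (LinearMap.congr_fun heval _).trans (hpair.symm.trans (LinearMap.congr_fun hzero _))

theorem IsYetterDrinfeld.isHopfIdeal_nicholsIdeal :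
    s.tensorHopf.IsHopfIdeal s.nicholsIdeal where
  act_mem h x hx := by
    rw [hs.mem_nicholsIdeal_iff] at hx ⊢
    ext F
    exact (hs.dualPair_act h F x).symm.trans (LinearMap.congr_fun hx _)
  coact_mem _ := hs.map_mkQ_tensorCoact_eq_zero
  mul_mem_left x y hy := by
    rw [hs.mem_nicholsIdeal_iff] at hy ⊢
    ext F
    refine (hs.dualPair_apply_mul F x y).trans ?_
    rw [hy, TensorProduct.map_zero_left, LinearMap.zero_apply, map_zero, LinearMap.zero_apply]
  mul_mem_right x hx y := by
    rw [hs.mem_nicholsIdeal_iff] at hx ⊢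
    ext F
    refine (hs.dualPair_apply_mul F x y).trans ?_
    rw [hx, TensorProduct.map_zero_right, LinearMap.zero_apply, map_zero, LinearMap.zero_apply]
  comul_mem _ := hs.map_mkQ_tensorComul_eq_zero
  counit_mem x hx := by
    have hone := LinearMap.congr_fun (hs.mem_nicholsIdeal_iff.1 hx) 1
    rwa [LinearMap.flip_apply, pair_one] at hone
  antipode_mem x hx := by
    rw [hs.mem_nicholsIdeal_iff] at hx ⊢
    ext F
    exact (hs.dualPair_antipode F x).symm.trans (LinearMap.congr_fun hx _)

end YDData

end HopfIdeal

/-! ### Surjective morphisms of Hopf algebras -/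

section Transport

variable {k : Type*} [Field k] {M : Type*} [AddCommGroup M] [Module k M]
variable {N : Type*} [AddCommGroup N] [Module k N] {f : M →ₗ[k] N}

section Comodule

variable {C : Type*} [AddCommGroup C] [Module k C] {D : Type*} [AddCommGroup D] [Module k D]
variable {δ : M →ₗ[k] C ⊗[k] M} {δ' : N →ₗ[k] D ⊗[k] N} {φ : C →ₗ[k] D}

theorem coassoc_of_surjective {Δ : C →ₗ[k] C ⊗[k] C} {Δ' : D →ₗ[k] D ⊗[k] D}
    (hf : Function.Surjective f) (hδ : δ' ∘ₗ f = TensorProduct.map φ f ∘ₗ δ)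
    (hΔ : Δ' ∘ₗ φ = TensorProduct.map φ φ ∘ₗ Δ)
    (h : (TensorProduct.assoc k C C M).toLinearMap ∘ₗ TensorProduct.map Δ LinearMap.id ∘ₗ δ =
      TensorProduct.map LinearMap.id δ ∘ₗ δ) :
    (TensorProduct.assoc k D D N).toLinearMap ∘ₗ TensorProduct.map Δ' LinearMap.id ∘ₗ δ' =
      TensorProduct.map LinearMap.id δ' ∘ₗ δ' := by
  have hΔf : TensorProduct.map Δ' LinearMap.id ∘ₗ TensorProduct.map φ f =
      TensorProduct.map (TensorProduct.map φ φ) f ∘ₗ TensorProduct.map Δ LinearMap.id := by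
    rw [← TensorProduct.map_comp, ← TensorProduct.map_comp, hΔ, LinearMap.id_comp,
      LinearMap.comp_id]
  have hδf : TensorProduct.map LinearMap.id δ' ∘ₗ TensorProduct.map φ f =
      TensorProduct.map φ (TensorProduct.map φ f) ∘ₗ TensorProduct.map LinearMap.id δ := by
    rw [← TensorProduct.map_comp, ← TensorProduct.map_comp, hδ, LinearMap.id_comp,
      LinearMap.comp_id]
  rw [← LinearMap.cancel_right hf]
  calc _ = (TensorProduct.assoc k D D N).toLinearMap ∘ₗ
        (TensorProduct.map Δ' LinearMap.id ∘ₗ TensorProduct.map φ f) ∘ₗ δ := by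
        simp only [LinearMap.comp_assoc, hδ]
    _ = TensorProduct.map φ (TensorProduct.map φ f) ∘ₗ
        (TensorProduct.assoc k C C M).toLinearMap ∘ₗ TensorProduct.map Δ LinearMap.id ∘ₗ δ := by
        rw [hΔf]
        simp only [← LinearMap.comp_assoc, TensorProduct.map_map_comp_assoc_eq]
    _ = _ := by
        rw [h, ← LinearMap.comp_assoc, ← hδf, LinearMap.comp_assoc, LinearMap.comp_assoc, hδ]

theorem counit_left_of_surjective {ε : C →ₗ[k] k} {ε' : D →ₗ[k] k}
    (hf : Function.Surjective f) (hδ : δ' ∘ₗ f = TensorProduct.map φ f ∘ₗ δ) (hε : ε' ∘ₗ φ = ε)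
    (h : (TensorProduct.lid k M).toLinearMap ∘ₗ TensorProduct.map ε LinearMap.id ∘ₗ δ =
      LinearMap.id) :
    (TensorProduct.lid k N).toLinearMap ∘ₗ TensorProduct.map ε' LinearMap.id ∘ₗ δ' =
      LinearMap.id := by
  have hlid : (TensorProduct.lid k N).toLinearMap ∘ₗ TensorProduct.map ε' LinearMap.id ∘ₗ
      TensorProduct.map φ f = f ∘ₗ (TensorProduct.lid k M).toLinearMap ∘ₗ
        TensorProduct.map ε LinearMap.id := TensorProduct.ext' fun c m => by simp [← hε]
  rw [← LinearMap.cancel_right hf, LinearMap.comp_assoc, LinearMap.comp_assoc, hδ]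
  simp only [← LinearMap.comp_assoc] at hlid h ⊢
  rw [hlid, LinearMap.comp_assoc, LinearMap.comp_assoc, ← LinearMap.comp_assoc δ, h]
  simp

theorem counit_right_of_surjective {δ : M →ₗ[k] M ⊗[k] C} {δ' : N →ₗ[k] N ⊗[k] D}
    {ε : C →ₗ[k] k} {ε' : D →ₗ[k] k} (hf : Function.Surjective f)
    (hδ : δ' ∘ₗ f = TensorProduct.map f φ ∘ₗ δ) (hε : ε' ∘ₗ φ = ε)
    (h : (TensorProduct.rid k M).toLinearMap ∘ₗ TensorProduct.map LinearMap.id ε ∘ₗ δ =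
      LinearMap.id) :
    (TensorProduct.rid k N).toLinearMap ∘ₗ TensorProduct.map LinearMap.id ε' ∘ₗ δ' =
      LinearMap.id := by
  have hrid : (TensorProduct.rid k N).toLinearMap ∘ₗ TensorProduct.map LinearMap.id ε' ∘ₗ
      TensorProduct.map f φ = f ∘ₗ (TensorProduct.rid k M).toLinearMap ∘ₗ
        TensorProduct.map LinearMap.id ε := TensorProduct.ext' fun m c => by simp [← hε]
  rw [← LinearMap.cancel_right hf, LinearMap.comp_assoc, LinearMap.comp_assoc, hδ]
  simp only [← LinearMap.comp_assoc] at hrid h ⊢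
  rw [hrid, LinearMap.comp_assoc, LinearMap.comp_assoc, ← LinearMap.comp_assoc δ, h]
  simp

end Comodule

variable {H : Type*} [Ring H] [HopfAlgebra k H]
variable {P : Type*} [AddCommGroup P] [Module k P]

namespace YDData

variable {s : YDData k H M} {t : YDData k H N} {u : YDData k H P}

theorem IsHom.coact_apply (hf : s.IsHom t f) (m : M) :
    t.coact (f m) = TensorProduct.map LinearMap.id f (s.coact m) :=
  LinearMap.congr_fun hf.coact_map m

theorem IsHom.comp {g : N →ₗ[k] P} (hg : t.IsHom u g) (hf : s.IsHom t f) :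
    s.IsHom u (g ∘ₗ f) where
  map_act h m := by simp only [LinearMap.comp_apply, hf.map_act, hg.map_act]
  coact_map := by
    rw [← LinearMap.comp_assoc, hg.coact_map, LinearMap.comp_assoc, hf.coact_map,
      ← LinearMap.comp_assoc, ← TensorProduct.map_comp, LinearMap.id_comp]

theorem IsHom.of_comp_surjective {g : N →ₗ[k] P} (hf : s.IsHom t f)
    (hsurj : Function.Surjective f) (hgf : s.IsHom u (g ∘ₗ f)) : t.IsHom u g where
  map_act h n := by
    obtain ⟨m, rfl⟩ := hsurj n
    rw [← hf.map_act]
    exact hgf.map_act h m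
  coact_map := by
    rw [← LinearMap.cancel_right hsurj, LinearMap.comp_assoc, hgf.coact_map,
      LinearMap.comp_assoc, hf.coact_map, ← LinearMap.comp_assoc, ← TensorProduct.map_comp,
      LinearMap.id_comp]

section Tensor

variable {M' : Type*} [AddCommGroup M'] [Module k M'] {N' : Type*} [AddCommGroup N'] [Module k N']
variable {s' : YDData k H M'} {t' : YDData k H N'} {f' : M' →ₗ[k] N'}

theorem IsHom.tensor (hf : s.IsHom t f) (hf' : s'.IsHom t' f') :
    (s.tensor s').IsHom (t.tensor t') (TensorProduct.map f f') where
  map_act h z := by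
    suffices hact : ∀ y : H ⊗[k] H,
        TensorProduct.map f f' ∘ₗ TensorProduct.homTensorHomMap (RingHom.id k) M M' M M'
            (TensorProduct.map s.act s'.act y) =
          TensorProduct.homTensorHomMap (RingHom.id k) N N' N N'
            (TensorProduct.map t.act t'.act y) ∘ₗ TensorProduct.map f f' from
      LinearMap.congr_fun (hact (Coalgebra.comul h)) z
    intro y
    induction y with
    | zero => simp
    | add x y hx hy =>
      simp only [map_add, LinearMap.comp_add, LinearMap.add_comp, hx, hy]
    | tmul a c => exact TensorProduct.ext' fun m n => by simp [hf.map_act, hf'.map_act]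
  coact_map := by
    have hmul : coactMul N N' ∘ₗ TensorProduct.map (TensorProduct.map LinearMap.id f)
          (TensorProduct.map LinearMap.id f') =
        TensorProduct.map (LinearMap.id (M := H)) (TensorProduct.map f f') ∘ₗ coactMul M M' :=
      TensorProduct.ext_fourfold' fun g m h n => by simp
    refine TensorProduct.ext' fun m n => ?_
    simp only [LinearMap.comp_apply, TensorProduct.map_tmul, tensor_coact_tmul, hf.coact_apply,
      hf'.coact_apply]
    exact LinearMap.congr_fun hmul (s.coact m ⊗ₜ s'.coact n)

theorem IsHom.braiding_comp_map (hf : s.IsHom t f) (hf' : s'.IsHom t' f') :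
    t.braiding t' ∘ₗ TensorProduct.map f f' = TensorProduct.map f' f ∘ₗ s.braiding s' := by
  have haux : t'.braidingAux N ∘ₗ TensorProduct.map (TensorProduct.map LinearMap.id f) f' =
      TensorProduct.map f' f ∘ₗ s'.braidingAux M :=
    TensorProduct.ext_threefold fun h m n => by simp [hf'.map_act]
  refine TensorProduct.ext' fun m n => ?_
  simp only [LinearMap.comp_apply, TensorProduct.map_tmul, braiding_tmul, hf.coact_apply]
  exact LinearMap.congr_fun haux (s.coact m ⊗ₜ n)

end Tensor

theorem sandwich_comp_map (hf : ∀ h m, f (s.act h m) = t.act h (f m)) :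
    t.sandwich ∘ₗ TensorProduct.map LinearMap.id (TensorProduct.map LinearMap.id f) =
      TensorProduct.map LinearMap.id f ∘ₗ s.sandwich := by
  ext a b c g m
  simp [sandwich_tmul, hf]

theorem IsHom.isYetterDrinfeld (hf : s.IsHom t f) (hsurj : Function.Surjective f)
    (hs : s.IsYetterDrinfeld) : t.IsYetterDrinfeld where
  one_act n := by
    obtain ⟨m, rfl⟩ := hsurj n
    rw [← hf.map_act, hs.one_act]
  mul_act g h n := by
    obtain ⟨m, rfl⟩ := hsurj n
    simp only [← hf.map_act, hs.mul_act]
  coassoc := coassoc_of_surjective hsurj hf.coact_map (by simp) hs.coassoc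
  counit_coact := counit_left_of_surjective hsurj hf.coact_map rfl hs.counit_coact
  coact_act h n := by
    obtain ⟨m, rfl⟩ := hsurj n
    rw [← hf.map_act, hf.coact_apply, hs.coact_act, hf.coact_apply]
    exact (LinearMap.congr_fun (sandwich_comp_map hf.map_act) (_ ⊗ₜ s.coact m)).symm

end YDData

theorem middle_comp_map {c : M ⊗[k] M →ₗ[k] M ⊗[k] M} {d : N ⊗[k] N →ₗ[k] N ⊗[k] N}
    (h : d ∘ₗ TensorProduct.map f f = TensorProduct.map f f ∘ₗ c) :
    middle d ∘ₗ TensorProduct.map (TensorProduct.map f f) (TensorProduct.map f f) =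
      TensorProduct.map (TensorProduct.map f f) (TensorProduct.map f f) ∘ₗ middle c := by
  refine TensorProduct.ext_fourfold' fun m n p q => ?_
  have hnp : d (f n ⊗ₜ f p) = TensorProduct.map f f (c (n ⊗ₜ p)) :=
    LinearMap.congr_fun h (n ⊗ₜ p)
  simp only [middle, TensorProduct.map_tmul, LinearMap.comp_apply, LinearEquiv.coe_coe,
    TensorProduct.assoc_tmul, TensorProduct.assoc_symm_tmul, LinearMap.id_apply, hnp]
  generalize c (n ⊗ₜ p) = z
  induction z with
  | zero => simp
  | add x y hx hy => simp only [map_add, TensorProduct.add_tmul, TensorProduct.tmul_add, hx, hy]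
  | tmul x y => simp

namespace HopfData

variable {A : HopfData k H M} {B : HopfData k H N} {C : HopfData k H P}

theorem IsHom.mul_tmul (hf : A.IsHom B f) (x y : M) :
    B.mul (f x ⊗ₜ f y) = f (A.mul (x ⊗ₜ y)) :=
  (LinearMap.congr_fun hf.map_mul (x ⊗ₜ y)).symm

theorem IsHom.comul_apply (hf : A.IsHom B f) (x : M) :
    B.comul (f x) = TensorProduct.map f f (A.comul x) :=
  LinearMap.congr_fun hf.map_comul x

theorem IsHom.unit_apply (hf : A.IsHom B f) (a : k) : B.unit a = f (A.unit a) :=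
  (LinearMap.congr_fun hf.map_unit a).symm

theorem IsHom.counit_apply (hf : A.IsHom B f) (x : M) : B.counit (f x) = A.counit x :=
  LinearMap.congr_fun hf.map_counit x

section Image

variable (hf : A.IsHom B f) (hsurj : Function.Surjective f) (hA : A.IsHopfAlgebra)
include hf hsurj hA

theorem IsHom.mul_assoc_of_surjective :
    B.mul ∘ₗ TensorProduct.map B.mul LinearMap.id =
      B.mul ∘ₗ TensorProduct.map LinearMap.id B.mul ∘ₗ
        (TensorProduct.assoc k N N N).toLinearMap := by
  refine TensorProduct.ext_threefold fun x y z => ?_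
  obtain ⟨x, rfl⟩ := hsurj x
  obtain ⟨y, rfl⟩ := hsurj y
  obtain ⟨z, rfl⟩ := hsurj z
  have hassoc := LinearMap.congr_fun hA.mul_assoc ((x ⊗ₜ y) ⊗ₜ z)
  simp only [LinearMap.comp_apply, TensorProduct.map_tmul, LinearMap.id_apply,
    LinearEquiv.coe_coe, TensorProduct.assoc_tmul] at hassoc ⊢
  simp only [hf.mul_tmul, hassoc]

theorem IsHom.comul_mul_of_surjective :
    B.comul ∘ₗ B.mul =
      TensorProduct.map B.mul B.mul ∘ₗ middle (B.toYDData.braiding B.toYDData) ∘ₗ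
        TensorProduct.map B.comul B.comul := by
  have hcomul : TensorProduct.map B.comul B.comul ∘ₗ TensorProduct.map f f =
      TensorProduct.map (TensorProduct.map f f) (TensorProduct.map f f) ∘ₗ
        TensorProduct.map A.comul A.comul := by
    rw [← TensorProduct.map_comp, ← TensorProduct.map_comp, hf.map_comul]
  have hmul : TensorProduct.map B.mul B.mul ∘ₗ
        TensorProduct.map (TensorProduct.map f f) (TensorProduct.map f f) =
      TensorProduct.map f f ∘ₗ TensorProduct.map A.mul A.mul := by
    rw [← TensorProduct.map_comp, ← TensorProduct.map_comp, hf.map_mul]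
  have hmiddle := middle_comp_map (hf.yd_hom.braiding_comp_map hf.yd_hom)
  rw [← LinearMap.cancel_right (TensorProduct.map_surjective hsurj hsurj)]
  calc _ = TensorProduct.map f f ∘ₗ A.comul ∘ₗ A.mul := by
        rw [LinearMap.comp_assoc, ← hf.map_mul, ← LinearMap.comp_assoc, hf.map_comul,
          LinearMap.comp_assoc]
    _ = TensorProduct.map B.mul B.mul ∘ₗ middle (B.toYDData.braiding B.toYDData) ∘ₗ
        TensorProduct.map (TensorProduct.map f f) (TensorProduct.map f f) ∘ₗ
          TensorProduct.map A.comul A.comul := by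
        rw [hA.comul_mul, ← LinearMap.comp_assoc, ← hmul, LinearMap.comp_assoc,
          ← LinearMap.comp_assoc _ _ (middle _), hmiddle, LinearMap.comp_assoc]
    _ = _ := by rw [← hcomul]; simp only [LinearMap.comp_assoc]

theorem IsHom.antipode_left_of_surjective :
    B.mul ∘ₗ TensorProduct.map B.antipode LinearMap.id ∘ₗ B.comul = B.unit ∘ₗ B.counit := by
  have hmap : TensorProduct.map B.antipode LinearMap.id ∘ₗ TensorProduct.map f f =
      TensorProduct.map f f ∘ₗ TensorProduct.map A.antipode LinearMap.id := by
    rw [← TensorProduct.map_comp, ← TensorProduct.map_comp, hf.map_antipode, LinearMap.id_comp,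
      LinearMap.comp_id]
  rw [← LinearMap.cancel_right hsurj]
  calc _ = B.mul ∘ₗ (TensorProduct.map B.antipode LinearMap.id ∘ₗ TensorProduct.map f f) ∘ₗ
        A.comul := by simp only [LinearMap.comp_assoc, hf.map_comul]
    _ = f ∘ₗ A.mul ∘ₗ TensorProduct.map A.antipode LinearMap.id ∘ₗ A.comul := by
        rw [hmap]
        simp only [← LinearMap.comp_assoc, hf.map_mul]
    _ = _ := by rw [hA.antipode_left, ← LinearMap.comp_assoc, hf.map_unit, LinearMap.comp_assoc,
      hf.map_counit]

theorem IsHom.antipode_right_of_surjective :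
    B.mul ∘ₗ TensorProduct.map LinearMap.id B.antipode ∘ₗ B.comul = B.unit ∘ₗ B.counit := by
  have hmap : TensorProduct.map LinearMap.id B.antipode ∘ₗ TensorProduct.map f f =
      TensorProduct.map f f ∘ₗ TensorProduct.map LinearMap.id A.antipode := by
    rw [← TensorProduct.map_comp, ← TensorProduct.map_comp, hf.map_antipode, LinearMap.id_comp,
      LinearMap.comp_id]
  rw [← LinearMap.cancel_right hsurj]
  calc _ = B.mul ∘ₗ (TensorProduct.map LinearMap.id B.antipode ∘ₗ TensorProduct.map f f) ∘ₗ
        A.comul := by simp only [LinearMap.comp_assoc, hf.map_comul]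
    _ = f ∘ₗ A.mul ∘ₗ TensorProduct.map LinearMap.id A.antipode ∘ₗ A.comul := by
        rw [hmap]
        simp only [← LinearMap.comp_assoc, hf.map_mul]
    _ = _ := by rw [hA.antipode_right, ← LinearMap.comp_assoc, hf.map_unit, LinearMap.comp_assoc,
      hf.map_counit]

theorem IsHom.isHopfAlgebra : B.IsHopfAlgebra where
  isYetterDrinfeld := hf.yd_hom.isYetterDrinfeld hsurj hA.isYetterDrinfeld
  mul_hom := (hf.yd_hom.tensor hf.yd_hom).of_comp_surjective
    (TensorProduct.map_surjective hsurj hsurj) (hf.map_mul ▸ hf.yd_hom.comp hA.mul_hom)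
  unit_hom := hf.map_unit ▸ hf.yd_hom.comp hA.unit_hom
  comul_hom := hf.yd_hom.of_comp_surjective hsurj
    (hf.map_comul ▸ (hf.yd_hom.tensor hf.yd_hom).comp hA.comul_hom)
  counit_hom := hf.yd_hom.of_comp_surjective hsurj (hf.map_counit.symm ▸ hA.counit_hom)
  antipode_hom := hf.yd_hom.of_comp_surjective hsurj
    (hf.map_antipode ▸ hf.yd_hom.comp hA.antipode_hom)
  mul_assoc := hf.mul_assoc_of_surjective hsurj hA
  unit_mul x := by
    obtain ⟨x, rfl⟩ := hsurj x
    rw [hf.unit_apply, hf.mul_tmul, hA.unit_mul]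
  mul_unit x := by
    obtain ⟨x, rfl⟩ := hsurj x
    rw [hf.unit_apply, hf.mul_tmul, hA.mul_unit]
  coassoc := coassoc_of_surjective hsurj hf.map_comul hf.map_comul hA.coassoc
  counit_comul := counit_left_of_surjective hsurj hf.map_comul hf.map_counit hA.counit_comul
  comul_counit := counit_right_of_surjective hsurj hf.map_comul hf.map_counit hA.comul_counit
  counit_unit := by rw [hf.unit_apply, hf.counit_apply, hA.counit_unit]
  counit_mul x y := by
    obtain ⟨x, rfl⟩ := hsurj x
    obtain ⟨y, rfl⟩ := hsurj y
    simp only [hf.mul_tmul, hf.counit_apply, hA.counit_mul]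
  comul_unit := by
    rw [hf.unit_apply, hf.comul_apply, hA.comul_unit, TensorProduct.map_tmul]
  comul_mul := hf.comul_mul_of_surjective hsurj hA
  antipode_left := hf.antipode_left_of_surjective hsurj hA
  antipode_right := hf.antipode_right_of_surjective hsurj hA

end Image

theorem isHom_mkQ (A : HopfData k H M) (I : Submodule k M) (hI : A.IsHopfIdeal I) :
    A.IsHom (A.quotient I hI) I.mkQ where
  yd_hom := ⟨fun _ _ => rfl, rfl⟩
  map_mul := TensorProduct.ext' fun _ _ => rfl
  map_unit := rfl
  map_comul := rfl
  map_counit := rfl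
  map_antipode := rfl

theorem IsHom.of_comp_surjective (hf : A.IsHom B f) (hsurj : Function.Surjective f)
    {g : N →ₗ[k] P} (hgf : A.IsHom C (g ∘ₗ f)) : B.IsHom C g where
  yd_hom := hf.yd_hom.of_comp_surjective hsurj hgf.yd_hom
  map_mul := by
    rw [← LinearMap.cancel_right (TensorProduct.map_surjective hsurj hsurj), LinearMap.comp_assoc,
      ← hf.map_mul, LinearMap.comp_assoc, ← TensorProduct.map_comp, ← hgf.map_mul,
      LinearMap.comp_assoc]
  map_unit := by rw [← hf.map_unit, ← LinearMap.comp_assoc, hgf.map_unit]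
  map_comul := by
    rw [← LinearMap.cancel_right hsurj, LinearMap.comp_assoc, hgf.map_comul,
      LinearMap.comp_assoc, hf.map_comul, ← LinearMap.comp_assoc, ← TensorProduct.map_comp]
  map_counit := by
    rw [← LinearMap.cancel_right hsurj, LinearMap.comp_assoc, hgf.map_counit, hf.map_counit]
  map_antipode := by
    rw [← LinearMap.cancel_right hsurj, LinearMap.comp_assoc, ← hf.map_antipode,
      ← LinearMap.comp_assoc, hgf.map_antipode, LinearMap.comp_assoc]

end HopfData

end Transport

/-! ### The dual Nichols algebra -/

section DualNichols

variable {k : Type*} {H : Type*} [Field k] [Ring H] [HopfAlgebra k H]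

namespace HopfData

variable {R : Type*} [AddCommGroup R] [Module k R] [Module.Finite k R]

@[simp]
theorem dualTensor_tmul_tmul (f g : Module.Dual k R) (x y : R) :
    dualTensor k R R (f ⊗ₜ g) (x ⊗ₜ y) = g x * f y := rfl

variable [BijectiveAntipode k H] {A : HopfData k H R}

theorem leftDual_bop_mul_apply (hA : A.toYDData.IsYetterDrinfeld)
    (z : Module.Dual k R ⊗[k] Module.Dual k R) (x : R) :
    A.leftDual.bop.mul z x = dualTensor k R R z (A.comul x) :=
  congrArg (fun y => dualTensor k R R y (A.comul x))
    (YDData.braidingInv_braiding hA.leftDual hA.leftDual z)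

theorem leftDual_bop_comul (hA : A.toYDData.IsYetterDrinfeld) :
    A.leftDual.bop.comul = (dualTensor k R R).symm.toLinearMap ∘ₗ A.mul.dualMap :=
  LinearMap.ext fun _ => YDData.braidingInv_braiding hA.leftDual hA.leftDual _

end HopfData

namespace YDData

variable {V : Type*} [AddCommGroup V] [Module k V]
variable {s : YDData k H V} (hs : s.IsYetterDrinfeld)
include hs

theorem IsYetterDrinfeld.isHopfAlgebra_nichols (hV : s.tensorHopf.IsHopfIdeal s.nicholsIdeal) :
    (s.nichols hV).IsHopfAlgebra :=
  (HopfData.isHom_mkQ _ _ hV).isHopfAlgebra (Submodule.mkQ_surjective _)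
    hs.isHopfAlgebra_tensorHopf

variable [Module.Finite k V] [BijectiveAntipode k H] [Module.Finite k s.NicholsSpace]
  (hV : s.tensorHopf.IsHopfIdeal s.nicholsIdeal)

theorem IsYetterDrinfeld.nicholsPair_act (h : H) (F : TensorAlgebra k (Module.Dual k V)) :
    hs.nicholsPair (s.leftDual.tensorAct h F) =
      (s.nichols hV).toYDData.leftDual.act h (hs.nicholsPair F) := by
  refine LinearMap.ext fun q => ?_
  obtain ⟨x, rfl⟩ := s.nicholsIdeal.mkQ_surjective q
  have hact := hs.dualPair_act (antipodeInv k H h) F x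
  rwa [antipode_antipodeInv] at hact

theorem IsYetterDrinfeld.nicholsPair_coact :
    (s.nichols hV).toYDData.leftDual.coact ∘ₗ hs.nicholsPair =
      TensorProduct.map LinearMap.id hs.nicholsPair ∘ₗ s.leftDual.tensorCoact := by
  refine LinearMap.ext fun F => evalRight_ext fun q => ?_
  obtain ⟨x, rfl⟩ := s.nicholsIdeal.mkQ_surjective q
  have hantipode : antipodeEval H (hs.nicholsPair F) ∘ₗ
      TensorProduct.map LinearMap.id s.nicholsIdeal.mkQ = antipodeEval H (s.dualPair F) :=
    TensorProduct.ext' fun h y => by simp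
  have heval : evalRight H (s.nicholsIdeal.mkQ x) ∘ₗ
      TensorProduct.map LinearMap.id hs.nicholsPair =
        evalRight H x ∘ₗ TensorProduct.map LinearMap.id s.dualPair :=
    TensorProduct.ext' fun h G => by simp
  calc evalRight H (s.nicholsIdeal.mkQ x)
        ((s.nichols hV).toYDData.leftDual.coact (hs.nicholsPair F))
      = antipodeEval H (hs.nicholsPair F)
          (TensorProduct.map LinearMap.id s.nicholsIdeal.mkQ (s.tensorCoact x)) :=
        evalRight_leftDual_coact _ _ _
    _ = antipodeEval H (s.dualPair F) (s.tensorCoact x) := LinearMap.congr_fun hantipode _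
    _ = evalRight H x (TensorProduct.map LinearMap.id s.dualPair (s.leftDual.tensorCoact F)) :=
        (hs.evalRight_dualPair_tensorCoact F x).symm
    _ = _ := (LinearMap.congr_fun heval _).symm

theorem IsYetterDrinfeld.nicholsPair_mul :
    hs.nicholsPair ∘ₗ LinearMap.mul' k (TensorAlgebra k (Module.Dual k V)) =
      (s.nichols hV).leftDual.bop.mul ∘ₗ TensorProduct.map hs.nicholsPair hs.nicholsPair := by
  refine TensorProduct.ext' fun F G => LinearMap.ext fun q => ?_
  obtain ⟨x, rfl⟩ := s.nicholsIdeal.mkQ_surjective q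
  have hcomul : (s.nichols hV).comul (s.nicholsIdeal.mkQ x) =
      TensorProduct.map s.nicholsIdeal.mkQ s.nicholsIdeal.mkQ (s.tensorComul x) := rfl
  rw [LinearMap.comp_apply, LinearMap.comp_apply, TensorProduct.map_tmul, LinearMap.mul'_apply,
    HopfData.leftDual_bop_mul_apply (hs.isHopfAlgebra_nichols hV).isYetterDrinfeld, hcomul,
    Submodule.mkQ_apply, nicholsPair_mk, hs.pair_mul LinearMap.id]
  generalize s.tensorComul x = z
  induction z with
  | zero => simp
  | add x y hx hy => simp only [map_add, hx, hy]
  | tmul a c => simp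

theorem IsYetterDrinfeld.nicholsPair_unit :
    hs.nicholsPair ∘ₗ Algebra.linearMap k (TensorAlgebra k (Module.Dual k V)) =
      (s.nichols hV).leftDual.bop.unit := by
  refine LinearMap.ext_ring (LinearMap.ext fun q => ?_)
  obtain ⟨x, rfl⟩ := s.nicholsIdeal.mkQ_surjective q
  calc s.dualPair (algebraMap k _ 1) x = TensorAlgebra.algebraMapInv x := by
        rw [map_one, pair_one, AlgHom.toLinearMap_apply]
    _ = (1 : k) * TensorAlgebra.algebraMapInv x := (one_mul _).symm

theorem IsYetterDrinfeld.nicholsPair_comul :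
    (s.nichols hV).leftDual.bop.comul ∘ₗ hs.nicholsPair =
      TensorProduct.map hs.nicholsPair hs.nicholsPair ∘ₗ s.leftDual.tensorComul := by
  rw [HopfData.leftDual_bop_comul (hs.isHopfAlgebra_nichols hV).isYetterDrinfeld]
  refine LinearMap.ext fun F => (HopfData.dualTensor k _ _).injective ?_
  simp only [LinearMap.comp_apply, LinearEquiv.coe_coe, LinearEquiv.apply_symm_apply]
  refine TensorProduct.ext' fun p q => ?_
  obtain ⟨x, rfl⟩ := s.nicholsIdeal.mkQ_surjective p
  obtain ⟨y, rfl⟩ := s.nicholsIdeal.mkQ_surjective q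
  refine (hs.dualPair_apply_mul F x y).trans ?_
  generalize s.leftDual.tensorComul F = z
  induction z with
  | zero => simp
  | add x y hx hy => simp only [map_add, LinearMap.add_apply, hx, hy]
  | tmul a c => simp [mul_comm]

theorem IsYetterDrinfeld.nicholsPair_antipode :
    hs.nicholsPair ∘ₗ s.leftDual.tensorAntipode =
      (s.nichols hV).leftDual.bop.antipode ∘ₗ hs.nicholsPair := by
  refine LinearMap.ext fun F => LinearMap.ext fun q => ?_
  obtain ⟨x, rfl⟩ := s.nicholsIdeal.mkQ_surjective q
  exact hs.dualPair_antipode F x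

theorem IsYetterDrinfeld.nicholsPair_counit :
    (s.nichols hV).leftDual.bop.counit ∘ₗ hs.nicholsPair =
      TensorAlgebra.algebraMapInv.toLinearMap := by
  refine LinearMap.ext fun F => ?_
  calc s.dualPair F (algebraMap k _ 1) = s.dualPair F 1 := by rw [map_one]
    _ = TensorAlgebra.algebraMapInv F := s.pair_apply_one LinearMap.id F

theorem IsYetterDrinfeld.isHom_nicholsPair :
    s.leftDual.tensorHopf.IsHom (s.nichols hV).leftDual.bop hs.nicholsPair where
  yd_hom := ⟨hs.nicholsPair_act hV, hs.nicholsPair_coact hV⟩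
  map_mul := hs.nicholsPair_mul hV
  map_unit := hs.nicholsPair_unit hV
  map_comul := hs.nicholsPair_comul hV
  map_counit := hs.nicholsPair_counit hV
  map_antipode := hs.nicholsPair_antipode hV

end YDData

end DualNichols

end BraidedHopf

end

theorem mainTheorem7 {k : Type*} {H : Type*} {V : Type*} [Field k] [Ring H] [HopfAlgebra k H]
    [BraidedHopf.BijectiveAntipode k H] [AddCommGroup V] [Module k V] [Module.Finite k V]
    (s : BraidedHopf.YDData k H V) (hs : s.IsYetterDrinfeld)
    [Module.Finite k s.NicholsSpace] :
    ∃ (hV : s.tensorHopf.IsHopfIdeal s.nicholsIdeal)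
      (hV' : s.leftDual.tensorHopf.IsHopfIdeal s.leftDual.nicholsIdeal),
      (s.nichols hV).IsHopfAlgebra ∧
      (s.leftDual.nichols hV').IsHopfAlgebra ∧
      (s.nichols hV).leftDual.bop.IsHopfAlgebra ∧
      (s.leftDual.nichols hV').Isomorphic (s.nichols hV).leftDual.bop := by
  have hV := hs.isHopfIdeal_nicholsIdeal
  have hV' := hs.leftDual.isHopfIdeal_nicholsIdeal
  refine ⟨hV, hV', hs.isHopfAlgebra_nichols hV, hs.leftDual.isHopfAlgebra_nichols hV',
    (hs.isHom_nicholsPair hV).isHopfAlgebra hs.nicholsPair_surjective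
      hs.leftDual.isHopfAlgebra_tensorHopf, ?_⟩
  let e := (Submodule.quotEquivOfEq _ _ hs.ker_nicholsPair.symm).trans
    (hs.nicholsPair.quotKerEquivOfSurjective hs.nicholsPair_surjective)
  exact ⟨e, (BraidedHopf.HopfData.isHom_mkQ _ _ hV').of_comp_surjective
    (Submodule.mkQ_surjective _) (hs.isHom_nicholsPair hV)⟩
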